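/- Let $W$ be a binary-input discrete memoryless channel, given by probability distributions $W(\cdot\mid 0)$, $W(\cdot\mid 1)$ on a countable output alphabet $\mathcal Y$, with symmetric capacity $I(W)=\sum_{x\in\{0,1\}}\sum_{y\in\mathcal Y}\frac12W(y\mid x)\log_2\frac{W(y\mid x)}{\frac12W(y\mid 0)+\frac12W(y\mid 1)}$. Let $G$ be an invertible $\ell\times\ell$ matrix over $\mathbb F_2$ (rows indexed by $0,\dots,\ell-1$) that no permutation of columns makes upper triangular. For $0\le i<\ell$ let $D^{[i]}$ be the minimum Hamming distance between $aG$ and $bG$ over all $a,b\in\mathbb F_2^\ell$ with $a_j=b_j=0$ for $j<i$, $a_i=0$, $b_i=1$, and put $$E(G)=\frac1\ell\sum_{i=0}^{\ell-1}\log_\ell D^{[i]},\qquad V(G)=\frac1\ell\sum_{i=0}^{\ell-1}\bigl(\log_\ell D^{[i]}-E(G)\bigr)^2 .$$ Let $Q(t)=\frac1{\sqrt{2\pi}}\int_t^\infty e^{-x^2/2}\,dx$. Put $N=\ell^n$, let $G_0=(1)$ and $G_{n+1}=(I_{\ell^n}\otimes G)R_{\ell,n+1}(I_\ell\otimes G_n)$,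 where $R_{\ell,n+1}$ is the permutation matrix for which entry $j\ell^n+m$ of $uR_{\ell,n+1}$ is $u_{\ell m+j}$ ($0\le j<\ell$, $0\le m<\ell^n$). A polar code of length $N$ is given by a set $\mathcal F\subseteq\{0,\dots,N-1\}$ of frozen indices; its rate is $(N-|\mathcal F|)/N$. The bits $u_0,\dots,u_{N-1}$ are independent and uniform, $x=uG_n$ is sent over $N$ independent uses of $W$, and $y$ is received. The successive cancellation (SC) decoder, which knows $u_i$ for $i\in\mathcal F$, decides $\hat u_0,\dots,\hat u_{N-1}$ in this order: $\hat u_i=u_i$ for $i\in\mathcal F$, and for $i\notin\mathcal F$ it takes for $\hat u_i$ the $b\in\{0,1\}$ that maximizes $$W_n^{\langle i\rangle}(y,\hat u_0^{i-1}\mid b)=\frac1{2^{N-1}}\sum_{u_{i+1},\dots,u_{N-1}}\ \prod_{j=0}^{N-1}W\bigl(y_j\mid ((\hat u_0^{i-1},b,u_{i+1}^{N-1})G_n)_j\bigr),$$ ties being broken by an independent fair coin. The error probability $P_{\mathrm{err}}(\mathcal F)$ is the probability that $\hat u\ne u$ (thus it is averaged over uniform frozen values). Theorem. Let $0<R<I(W)$.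 (i) For every $f:\mathbb N\to\mathbb R$ with $f(n)=o(\sqrt n)$ there is a sequence of polar codes $\mathcal F_n$ of length $\ell^n$, $n=0,1,2,\dots$, whose rate tends to $R$ and whose error probability satisfies $$P_{\mathrm{err}}(\mathcal F_n)=o\Bigl(2^{-\ell^{\,E(G)n+Q^{-1}(R/I(W))\sqrt{V(G)n}+f(n)}}\Bigr).$$ (ii) Conversely, if $I(W)<1$, then for every sequence of polar codes $\mathcal F_n$ of length $\ell^n$ whose rate tends to $R$ and for every $\epsilon>0$, $$P_{\mathrm{err}}(\mathcal F_n)=\omega\Bigl(2^{-\ell^{\,E(G)n+Q^{-1}(R/I(W))\sqrt{V(G)n}+\epsilon\sqrt n}}\Bigr).$$ -/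

import Mathlib

open Filter Asymptotics MeasureTheory
open scoped Kronecker

namespace PolarCode

noncomputable section

/-- A binary-input discrete memoryless channel with output alphabet `Y`:
`W x` is the law of the output when the bit `x` is sent. -/
abbrev BDMC (Y : Type*) := ZMod 2 → PMF Y

/-- The transition probability `W(y ∣ x)` as a real number. -/
def BDMC.prob {Y : Type*} (W : BDMC Y) (y : Y) (x : ZMod 2) : ℝ := (W x y).toReal

/-- The memoryless extension `W^N(y ∣ x) = ∏ i, W(y i ∣ x i)`. -/
def BDMC.blockProb {Y : Type*} (W : BDMC Y) {N : ℕ} (y : Fin N → Y) (x : Fin N → ZMod 2) : ℝ :=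
  ∏ i, W.prob (y i) (x i)

/-- The symmetric capacity `I(W)`, in bits. -/
def BDMC.symCapacity {Y : Type*} (W : BDMC Y) : ℝ :=
  ∑ x : ZMod 2, ∑' y : Y, 1 / 2 * W.prob y x *
    Real.logb 2 (W.prob y x / (1 / 2 * W.prob y 0 + 1 / 2 * W.prob y 1))

/-- The partial distance `D^[i]` of `G`: the least Hamming distance between `a G` and `b G`, where
`a` and `b` vanish before `i`, `a i = 0` and `b i = 1`. -/
def partialDist {ℓ : ℕ} (G : Matrix (Fin ℓ) (Fin ℓ) (ZMod 2)) (i : Fin ℓ) : ℕ :=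
  sInf {d | ∃ a b : Fin ℓ → ZMod 2, (∀ j < i, a j = 0) ∧ (∀ j < i, b j = 0) ∧
    a i = 0 ∧ b i = 1 ∧ d = hammingDist (Matrix.vecMul a G) (Matrix.vecMul b G)}

/-- The exponent `E(G)`. -/
def exponent {ℓ : ℕ} (G : Matrix (Fin ℓ) (Fin ℓ) (ZMod 2)) : ℝ :=
  1 / (ℓ : ℝ) * ∑ i, Real.logb ℓ (partialDist G i)

/-- The second exponent `V(G)`. -/
def secondExponent {ℓ : ℕ} (G : Matrix (Fin ℓ) (Fin ℓ) (ZMod 2)) : ℝ :=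
  1 / (ℓ : ℝ) * ∑ i, (Real.logb ℓ (partialDist G i) - exponent G) ^ 2

/-- The Gaussian tail function `Q`. -/
def gaussQ (t : ℝ) : ℝ :=
  1 / √(2 * Real.pi) * ∫ x in Set.Ioi t, Real.exp (-(x ^ 2 / 2))

/-- The inverse of `Q`, used on `(0, 1)`. -/
def gaussQInv (p : ℝ) : ℝ := Function.invFun gaussQ p

/-- `(m, j) ↦ ℓ m + j`. -/
def innerIdx (ℓ n : ℕ) : Fin (ℓ ^ n) × Fin ℓ ≃ Fin (ℓ ^ (n + 1)) :=
  finProdFinEquiv.trans (finCongr (pow_succ ℓ n).symm)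

/-- `(j, m) ↦ ℓ ^ n j + m`. -/
def outerIdx (ℓ n : ℕ) : Fin ℓ × Fin (ℓ ^ n) ≃ Fin (ℓ ^ (n + 1)) :=
  finProdFinEquiv.trans (finCongr (pow_succ' ℓ n).symm)

/-- The permutation matrix that sends `u` to
`(u_0, u_ℓ, u_{2ℓ}, …, u_1, u_{ℓ+1}, …, u_{ℓ-1}, u_{2ℓ-1}, …)`. -/
def shuffleMatrix (ℓ n : ℕ) : Matrix (Fin (ℓ ^ (n + 1))) (Fin (ℓ ^ (n + 1))) (ZMod 2) :=
  Matrix.of fun a b => if (outerIdx ℓ n).symm b = ((innerIdx ℓ n).symm a).swap then 1 else 0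

/-- The polar transform `G_n`, by
`G_{n+1} = (I_{ℓ^n} ⊗ G) R_{ℓ,n+1} (I_ℓ ⊗ G_n)` from `G_0 = (1)`, so that `G_1 = G`. -/
def polarMatrix {ℓ : ℕ} (G : Matrix (Fin ℓ) (Fin ℓ) (ZMod 2)) :
    (n : ℕ) → Matrix (Fin (ℓ ^ n)) (Fin (ℓ ^ n)) (ZMod 2)
  | 0 => 1
  | n + 1 =>
      Matrix.reindex (innerIdx ℓ n) (innerIdx ℓ n)
          ((1 : Matrix (Fin (ℓ ^ n)) (Fin (ℓ ^ n)) (ZMod 2)) ⊗ₖ G) *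
        shuffleMatrix ℓ n *
        Matrix.reindex (outerIdx ℓ n) (outerIdx ℓ n)
          ((1 : Matrix (Fin ℓ) (Fin ℓ) (ZMod 2)) ⊗ₖ polarMatrix G n)

/-- `W_n^⟨i⟩(y, v_0, …, v_{i-1} ∣ b)`: of `v`, only the entries before `i` are used. -/
def subchannelProb {Y : Type*} (W : BDMC Y) {ℓ : ℕ} (G : Matrix (Fin ℓ) (Fin ℓ) (ZMod 2)) (n : ℕ)
    (i : Fin (ℓ ^ n)) (y : Fin (ℓ ^ n) → Y) (v : Fin (ℓ ^ n) → ZMod 2) (b : ZMod 2) : ℝ :=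
  1 / 2 ^ (ℓ ^ n - 1) *
    ∑ u : Fin (ℓ ^ n) → ZMod 2 with (∀ j < i, u j = v j) ∧ u i = b,
      W.blockProb y (Matrix.vecMul u (polarMatrix G n))

/-- The probability that the successive cancellation decoder with frozen set `F` and frozen values
`u j`, `j ∈ F`, decides for the bit `v i` at step `i`, when it received `y` and its earlier
decisions were `v j`, `j < i`. Ties are broken by a fair coin. -/
def scStep {Y : Type*} (W : BDMC Y) {ℓ : ℕ} (G : Matrix (Fin ℓ) (Fin ℓ) (ZMod 2)) (n : ℕ)
    (F : Finset (Fin (ℓ ^ n))) (u : Fin (ℓ ^ n) → ZMod 2) (y : Fin (ℓ ^ n) → Y)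
    (v : Fin (ℓ ^ n) → ZMod 2) (i : Fin (ℓ ^ n)) : ℝ :=
  if i ∈ F then (if v i = u i then 1 else 0)
  else if subchannelProb W G n i y v (v i + 1) < subchannelProb W G n i y v (v i) then 1
  else if subchannelProb W G n i y v (v i + 1) = subchannelProb W G n i y v (v i) then 1 / 2
  else 0

/-- The probability that the successive cancellation decoder outputs `v` on the received word
`y`. -/
def scLaw {Y : Type*} (W : BDMC Y) {ℓ : ℕ} (G : Matrix (Fin ℓ) (Fin ℓ) (ZMod 2)) (n : ℕ)
    (F : Finset (Fin (ℓ ^ n))) (u : Fin (ℓ ^ n) → ZMod 2) (y : Fin (ℓ ^ n) → Y)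
    (v : Fin (ℓ ^ n) → ZMod 2) : ℝ :=
  ∏ i, scStep W G n F u y v i

/-- The block error probability under successive cancellation decoding of the polar code of
length `ℓ ^ n` with frozen set `F`, for uniform message bits and uniform frozen values (the latter
known to the decoder): `u` collects all of these bits and is encoded as `u G_n`. -/
def errorProb {Y : Type*} (W : BDMC Y) {ℓ : ℕ} (G : Matrix (Fin ℓ) (Fin ℓ) (ZMod 2)) (n : ℕ)
    (F : Finset (Fin (ℓ ^ n))) : ℝ :=
  ∑ u : Fin (ℓ ^ n) → ZMod 2, 1 / 2 ^ (ℓ ^ n) *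
    ∑' y : Fin (ℓ ^ n) → Y, W.blockProb y (Matrix.vecMul u (polarMatrix G n)) *
      ∑ v : Fin (ℓ ^ n) → ZMod 2 with v ≠ u, scLaw W G n F u y v

/-- The coding rate `|Fᶜ| / ℓ ^ n`. -/
def rate {ℓ n : ℕ} (F : Finset (Fin (ℓ ^ n))) : ℝ := (Fᶜ.card : ℝ) / (ℓ : ℝ) ^ n

end

end PolarCode

/-! Each index of the polar transform gives a binary-input channel, that of one input bit when the
earlier ones are known. The proof follows two numbers attached to it: its Bhattacharyya parameter z
and its conditional entropy h. One more level of the transform appends a letter j in {0,…,ℓ-1} to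
the index, so indices of depth n are words of n letters and uniform indices are words with
independent uniform letters.

Three facts drive the argument. (1) Appending j satisfies z^D ≤ z' ≤ 2^ℓ z^D with D = D^[j]
(`IsKernel.le_bhatt_split`, `IsKernel.bhatt_split_le`). (2) Entropy is conserved on average over j
(`IsKernel.sum_condEnt_split`), while some fixed letter lowers it strictly unless z is 0 or 1
(`IsKernel.condEnt_split_le`); the bounded martingale h therefore polarizes, and a proportion
tending to I(W) of the indices have z ≤ δ (`PolarProcess.tendsto_frac_mid`,
`PolarProcess.le_frac_small`, `PolarProcess.frac_small_le`). (3) The error probability lies between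
z²/4 for any unfrozen index and the sum of z over all of them (`le_errorProb`, `errorProb_le`).

By (1), log(1/z) is multiplied by the product of the D along the word, up to the accumulated factors
2^ℓ. The base-ℓ logarithm of this product is a sum of independent terms of mean E(G) and variance
V(G), to which the central limit theorem applies (`tendsto_wordFrac`). The factors 2^ℓ cost a factor
(2^ℓ)^S inside the power, where S sums the reciprocals of the partial products of D. The mean of S
is bounded in the length of the word, so Markov's inequality makes S ≤ B for most words, and
starting from a small enough z absorbs the cost (`PolarProcess.le_card_word`).

Hence the proportion of indices with z ≤ 2^(-ℓ^a), where a = E(G)n + t√(V(G)n) + o(√n), tends to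
I(W)Q(t). The lower bound is `PolarProcess.le_frac`. For the upper bound `PolarProcess.frac_le`,
words starting at z near 1 are controlled by conservation of entropy and intermediate z are rare.
Taking I(W)Q(t) = R gives the codes of (i); a slightly larger t leaves too few good indices for rate
R and gives (ii). -/

namespace PolarCode

/-! ### Entropy and Bhattacharyya parameter of a single channel. -/

noncomputable section

lemma sum_zmod_two {M : Type*} [AddCommMonoid M] (f : ZMod 2 → M) : ∑ x, f x = f 0 + f 1 :=
  Fin.sum_univ_two f

/-- The transition probabilities `K a x` of a binary-input channel with output alphabet `A`. -/
structure IsKernel {A : Type*} (K : A → ZMod 2 → ℝ) : Prop where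
  nonneg : ∀ a x, 0 ≤ K a x
  hasSum : ∀ x, HasSum (fun a => K a x) 1

/-- The homogeneous form of the binary entropy function, in nats. -/
def binEnt (a b : ℝ) : ℝ := Real.negMulLog a + Real.negMulLog b - Real.negMulLog (a + b)

/-- The Bhattacharyya parameter. -/
def bhatt {A : Type*} (K : A → ZMod 2 → ℝ) : ℝ := ∑' a, √(K a 0 * K a 1)

/-- The conditional entropy, in bits, of a uniform input given the output. -/
def condEnt {A : Type*} (K : A → ZMod 2 → ℝ) : ℝ :=
  (∑' a, binEnt (K a 0) (K a 1)) / (2 * Real.log 2)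

/-- Two channels used independently with the same input. -/
def pairing {A B : Type*} (K : A → ZMod 2 → ℝ) (L : B → ZMod 2 → ℝ) : A × B → ZMod 2 → ℝ :=
  fun a x => K a.1 x * L a.2 x

/-- The channel with `s` added to its input. -/
def shift {A : Type*} (s : ZMod 2) (K : A → ZMod 2 → ℝ) : A → ZMod 2 → ℝ := fun a x => K a (s + x)

/-- Summed over two laws, this is the bound of relative entropy below by squared Hellinger distance;
it is log u ≤ u - 1 at u = √y/√x. Since `Real.log 0 = 0`, absolute continuity has to be assumed. -/
lemma two_sub_two_sqrt_le_mul_log {x y : ℝ} (hx : 0 ≤ x) (hy : 0 ≤ y) (h : y = 0 → x = 0) :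
    2 * x - 2 * (√x * √y) ≤ x * (Real.log x - Real.log y) := by
  rcases hx.eq_or_lt with rfl | hx
  · simp
  have hy : 0 < y := lt_of_le_of_ne hy fun h0 => hx.ne' (h h0.symm)
  have h1 := Real.log_le_sub_one_of_pos (x := √y / √x) (by positivity)
  rw [Real.log_div (by positivity) (by positivity), Real.log_sqrt hx.le, Real.log_sqrt hy.le] at h1
  have h2 : x * (√y / √x) = √x * √y := by
    rw [mul_div_assoc', div_eq_iff (by positivity)]
    linear_combination (-√y) * Real.mul_self_sqrt hx.le
  nlinarith

lemma binEnt_eq (a b : ℝ) : binEnt a b =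
    a * (Real.log (a + b) - Real.log a) + b * (Real.log (a + b) - Real.log b) := by
  simp only [binEnt, Real.negMulLog]; ring

lemma mul_log_sub_log_nonneg {a b : ℝ} (ha : 0 ≤ a) (hb : 0 ≤ b) :
    0 ≤ a * (Real.log (a + b) - Real.log a) := by
  rcases ha.eq_or_lt with rfl | ha
  · simp
  · exact mul_nonneg ha.le (sub_nonneg.2 (Real.log_le_log ha (by linarith)))

lemma mul_log_sub_log_le {a b : ℝ} (ha : 0 ≤ a) (hb : 0 ≤ b) :
    a * (Real.log (a + b) - Real.log a) ≤ 2 * √(a * b) := by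
  have h1 := two_sub_two_sqrt_le_mul_log ha (add_nonneg ha hb) (by intro h; linarith)
  have h2 : √(a + b) ≤ √a + √b := by
    rw [Real.sqrt_le_left (by positivity)]
    nlinarith [Real.sq_sqrt ha, Real.sq_sqrt hb, Real.sqrt_nonneg a, Real.sqrt_nonneg b,
      mul_nonneg (Real.sqrt_nonneg a) (Real.sqrt_nonneg b)]
  rw [Real.sqrt_mul ha]
  nlinarith [Real.mul_self_sqrt ha, Real.sqrt_nonneg a]

lemma binEnt_nonneg {a b : ℝ} (ha : 0 ≤ a) (hb : 0 ≤ b) : 0 ≤ binEnt a b := by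
  rw [binEnt_eq]
  have := mul_log_sub_log_nonneg hb ha
  rw [add_comm b a] at this
  exact add_nonneg (mul_log_sub_log_nonneg ha hb) this

lemma binEnt_le {a b : ℝ} (ha : 0 ≤ a) (hb : 0 ≤ b) : binEnt a b ≤ 4 * √(a * b) := by
  rw [binEnt_eq]
  have h1 := mul_log_sub_log_le ha hb
  have h2 := mul_log_sub_log_le hb ha
  rw [add_comm b a, mul_comm b a] at h2
  linarith

lemma sqrt_mul_le_half_add {a b : ℝ} (ha : 0 ≤ a) (hb : 0 ≤ b) : √(a * b) ≤ 1 / 2 * (a + b) := by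
  rw [Real.sqrt_le_left (by positivity)]
  nlinarith [sq_nonneg (a - b)]

/-- Bounds the distance of the entropy from its maximum by a chi-square distance from the uniform
law, through log u ≤ u - 1 at u = 2c/(a+b). -/
lemma log_two_mul_sub_le_binEnt {a b : ℝ} (ha : 0 ≤ a) (hb : 0 ≤ b) :
    Real.log 2 * (a + b) - ((a + b) - 4 * (a * b / (a + b))) ≤ binEnt a b := by
  rw [binEnt_eq]
  rcases (add_nonneg ha hb).eq_or_lt with h | h
  · have ha0 : a = 0 := by linarith
    have hb0 : b = 0 := by linarith
    simp [ha0, hb0]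
  have key : ∀ c, 0 ≤ c → Real.log 2 * c + (c - 2 * c ^ 2 / (a + b)) ≤
      c * (Real.log (a + b) - Real.log c) := by
    intro c hc
    rcases hc.eq_or_lt with rfl | hc
    · simp
    have h1 := Real.log_le_sub_one_of_pos (x := 2 * c / (a + b)) (by positivity)
    rw [Real.log_div (by positivity) (by positivity), Real.log_mul (by positivity) (by positivity)]
      at h1
    have h2 : 2 * c ^ 2 / (a + b) = c * (2 * c / (a + b)) := by ring
    rw [h2]
    nlinarith
  have h3 : 2 * a ^ 2 / (a + b) + 2 * b ^ 2 / (a + b) =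
      2 * (a + b) - 4 * (a * b / (a + b)) := by
    field_simp; ring
  linarith [key a ha, key b hb]

/-- Gibbs' inequality with a remainder: describing a bit by the posterior from `a` alone, when `b`
has been observed too, costs an excess relative entropy. Its Hellinger lower bound is at least the
weighted variance of √b₀, √b₁, which is the second term on the left. -/
lemma binEnt_mul_le {a₀ a₁ b₀ b₁ : ℝ} (ha₀ : 0 ≤ a₀) (ha₁ : 0 ≤ a₁) (hb₀ : 0 ≤ b₀) (hb₁ : 0 ≤ b₁) :
    binEnt (a₀ * b₀) (a₁ * b₁) + a₀ * a₁ / (a₀ + a₁) * (b₀ + b₁ - 2 * √(b₀ * b₁)) ≤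
      a₀ * (Real.log (a₀ + a₁) - Real.log a₀) * b₀ +
      a₁ * (Real.log (a₀ + a₁) - Real.log a₁) * b₁ := by
  rcases (add_nonneg ha₀ ha₁).eq_or_lt with h | hs
  · have h0 : a₀ = 0 := by linarith
    have h1 : a₁ = 0 := by linarith
    simp [h0, h1, binEnt]
  have ht0 : 0 ≤ a₀ * b₀ + a₁ * b₁ := by positivity
  set s := a₀ + a₁ with hsdef
  set t := a₀ * b₀ + a₁ * b₁ with htdef
  rw [binEnt_eq, ← htdef]
  -- t/s is the mean of b₀, b₁ under the posterior from `a`; a·(t/s) is the reference weight in the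
  -- relative entropy.
  set c := √(t / s) with hc
  have hc0 : 0 ≤ c := Real.sqrt_nonneg _
  have hcc : c * c = t / s := Real.mul_self_sqrt (by positivity)
  have key : ∀ a b, 0 ≤ a → 0 ≤ b → (t = 0 → a * b = 0) →
      2 * (a * b) - 2 * (a * √b * c) + a * b * (Real.log t - Real.log (a * b)) ≤
        a * (Real.log s - Real.log a) * b := by
    intro a b ha hb h0
    rcases (mul_nonneg ha hb).eq_or_lt with h | h
    · have h' : a * √b = 0 := by
        rcases mul_eq_zero.1 h.symm with h | h <;> simp [h]
      rw [h', ← h, show a * (Real.log s - Real.log a) * b =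
        (a * b) * (Real.log s - Real.log a) by ring, ← h]
      simp
    have ht : 0 < t := lt_of_le_of_ne ht0 fun h1 => h.ne' (h0 h1.symm)
    have ha : 0 < a := lt_of_le_of_ne ha (by rintro rfl; simp at h)
    have hb : 0 < b := lt_of_le_of_ne hb (by rintro rfl; simp at h)
    have h1 := two_sub_two_sqrt_le_mul_log (x := a * b) (y := a * (t / s)) (by positivity)
      (by positivity) (fun h2 => absurd h2 (by positivity))
    rw [Real.sqrt_mul ha.le, Real.sqrt_mul ha.le, Real.log_mul ha.ne' (by positivity),
      Real.log_mul ha.ne' (by positivity), Real.log_div (by positivity) (by positivity)] at h1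
    rw [Real.log_mul ha.ne' (by positivity)]
    have h3 : √a * √b * (√a * c) = a * √b * c := by
      linear_combination (√b * c) * Real.mul_self_sqrt ha.le
    rw [← hc, h3] at h1
    nlinarith
  have h0 := key a₀ b₀ ha₀ hb₀ (fun h => by
    have := mul_nonneg ha₀ hb₀; have := mul_nonneg ha₁ hb₁; linarith)
  have h1 := key a₁ b₁ ha₁ hb₁ (fun h => by
    have := mul_nonneg ha₀ hb₀; have := mul_nonneg ha₁ hb₁; linarith)
  have hq : a₀ * a₁ / s * (b₀ + b₁ - 2 * √(b₀ * b₁)) ≤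
      2 * t - 2 * ((a₀ * √b₀ + a₁ * √b₁) * c) := by
    rw [Real.sqrt_mul hb₀]
    have e0 := Real.mul_self_sqrt hb₀
    have e1 := Real.mul_self_sqrt hb₁
    set p := √b₀
    set q := √b₁
    have hts : t = s * (c * c) := by rw [hcc]; field_simp
    have : a₀ * a₁ / s * (b₀ + b₁ - 2 * (p * q)) = t - (a₀ * p + a₁ * q) ^ 2 / s := by
      rw [htdef, ← e0, ← e1]; field_simp; rw [hsdef]; ring
    rw [this]
    have h5 : (a₀ * p + a₁ * q) ^ 2 / s - 2 * ((a₀ * p + a₁ * q) * c) + t =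
        ((a₀ * p + a₁ * q) - s * c) ^ 2 / s := by
      rw [hts]; field_simp; ring
    have h6 : 0 ≤ ((a₀ * p + a₁ * q) - s * c) ^ 2 / s := by positivity
    linarith
  nlinarith

section Kernel

variable {A : Type*} {K : A → ZMod 2 → ℝ}

lemma IsKernel.summable_of_le (hK : IsKernel K) {f : A → ℝ} (c : ℝ) (h0 : ∀ a, 0 ≤ f a)
    (h : ∀ a, f a ≤ c * (K a 0 + K a 1)) : Summable f :=
  Summable.of_nonneg_of_le h0 h (((hK.hasSum 0).summable.add (hK.hasSum 1).summable).mul_left c)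

lemma IsKernel.hasSum_add (hK : IsKernel K) : HasSum (fun a => K a 0 + K a 1) 2 := by
  have := (hK.hasSum 0).add (hK.hasSum 1)
  norm_num at this
  exact this

lemma IsKernel.summable_bhatt (hK : IsKernel K) : Summable fun a => √(K a 0 * K a 1) :=
  hK.summable_of_le (1 / 2) (fun _ => Real.sqrt_nonneg _)
    fun a => sqrt_mul_le_half_add (hK.nonneg a 0) (hK.nonneg a 1)

lemma IsKernel.summable_binEnt (hK : IsKernel K) : Summable fun a => binEnt (K a 0) (K a 1) :=
  hK.summable_of_le 2 (fun a => binEnt_nonneg (hK.nonneg a 0) (hK.nonneg a 1)) fun a => by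
    have h1 := binEnt_le (hK.nonneg a 0) (hK.nonneg a 1)
    have h2 := sqrt_mul_le_half_add (hK.nonneg a 0) (hK.nonneg a 1)
    linarith

lemma mul_div_add_nonneg {a b : ℝ} (ha : 0 ≤ a) (hb : 0 ≤ b) : 0 ≤ a * b / (a + b) := by positivity

lemma mul_div_add_le {a b : ℝ} (ha : 0 ≤ a) (hb : 0 ≤ b) : a * b / (a + b) ≤ 1 * (a + b) := by
  refine div_le_of_le_mul₀ (by positivity) (by positivity) ?_
  nlinarith [mul_nonneg ha hb]

lemma IsKernel.summable_mul_div (hK : IsKernel K) :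
    Summable fun a => K a 0 * K a 1 / (K a 0 + K a 1) :=
  hK.summable_of_le 1 (fun a => mul_div_add_nonneg (hK.nonneg a 0) (hK.nonneg a 1))
    fun a => mul_div_add_le (hK.nonneg a 0) (hK.nonneg a 1)

lemma bhatt_nonneg : 0 ≤ bhatt K := tsum_nonneg fun _ => Real.sqrt_nonneg _

lemma IsKernel.bhatt_le_one (hK : IsKernel K) : bhatt K ≤ 1 := by
  have := hK.summable_bhatt.tsum_le_tsum
    (fun a => sqrt_mul_le_half_add (hK.nonneg a 0) (hK.nonneg a 1))
    (hK.hasSum_add.summable.mul_left _)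
  rw [(hK.hasSum_add.mul_left _).tsum_eq] at this
  simpa [bhatt] using this

lemma IsKernel.condEnt_nonneg (hK : IsKernel K) : 0 ≤ condEnt K :=
  div_nonneg (tsum_nonneg fun a => binEnt_nonneg (hK.nonneg a 0) (hK.nonneg a 1)) (by positivity)

lemma IsKernel.condEnt_le_bhatt (hK : IsKernel K) : condEnt K ≤ 2 / Real.log 2 * bhatt K := by
  have h := hK.summable_binEnt.tsum_le_tsum
    (fun a => binEnt_le (hK.nonneg a 0) (hK.nonneg a 1)) (hK.summable_bhatt.mul_left _)
  rw [tsum_mul_left] at h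
  have hl : 0 < Real.log 2 := Real.log_pos one_lt_two
  rw [condEnt, div_le_iff₀ (by positivity)]
  refine h.trans (le_of_eq ?_)
  rw [bhatt]; field_simp; ring

/-- Cauchy–Schwarz with the weights K a 0 + K a 1 of total mass 2, used pointwise as an
arithmetic–geometric mean inequality tuned by `bhatt K`. -/
lemma IsKernel.sq_bhatt_le (hK : IsKernel K) :
    bhatt K ^ 2 ≤ 2 * ∑' a, K a 0 * K a 1 / (K a 0 + K a 1) := by
  set T := ∑' a, K a 0 * K a 1 / (K a 0 + K a 1) with hT
  have hZ0 : 0 ≤ bhatt K := bhatt_nonneg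
  have hpt : ∀ a, 2 * bhatt K * √(K a 0 * K a 1) ≤
      2 * (K a 0 * K a 1 / (K a 0 + K a 1)) + bhatt K ^ 2 / 2 * (K a 0 + K a 1) := by
    intro a
    have h0 := hK.nonneg a 0
    have h1 := hK.nonneg a 1
    rcases (add_nonneg h0 h1).eq_or_lt with h | h
    · have : K a 0 = 0 := by linarith
      simp only [this, zero_mul, Real.sqrt_zero, mul_zero, zero_div, zero_add]
      positivity
    · have e : (√(K a 0 * K a 1)) ^ 2 = K a 0 * K a 1 := Real.sq_sqrt (by positivity)
      rw [← e, Real.sqrt_sq (Real.sqrt_nonneg _)]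
      have : 2 * (√(K a 0 * K a 1) ^ 2 / (K a 0 + K a 1)) + bhatt K ^ 2 / 2 * (K a 0 + K a 1) -
          2 * bhatt K * √(K a 0 * K a 1) =
          (2 * √(K a 0 * K a 1) - bhatt K * (K a 0 + K a 1)) ^ 2 / (2 * (K a 0 + K a 1)) := by
        field_simp; ring
      have h2 : 0 ≤ (2 * √(K a 0 * K a 1) - bhatt K * (K a 0 + K a 1)) ^ 2 /
        (2 * (K a 0 + K a 1)) := by positivity
      linarith
  have hs := (hK.summable_mul_div.hasSum.mul_left 2).add (hK.hasSum_add.mul_left (bhatt K ^ 2 / 2))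
  have := hasSum_le hpt (hK.summable_bhatt.hasSum.mul_left (2 * bhatt K)) hs
  rw [← hT] at this
  change 2 * bhatt K * bhatt K ≤ _ at this
  nlinarith

/-- The chi-square bound on entropy and Cauchy–Schwarz meet in the same sum of K₀K₁/(K₀+K₁). It
shows that z near 1 forces h near 1. -/
lemma IsKernel.one_sub_condEnt_le (hK : IsKernel K) :
    Real.log 2 * (1 - condEnt K) ≤ 1 - bhatt K ^ 2 := by
  have hl : 0 < Real.log 2 := Real.log_pos one_lt_two
  have hs := (hK.hasSum_add.mul_left (Real.log 2)).sub
    (hK.hasSum_add.sub (hK.summable_mul_div.hasSum.mul_left 4))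
  have h := hasSum_le (fun a => log_two_mul_sub_le_binEnt (hK.nonneg a 0) (hK.nonneg a 1)) hs
    hK.summable_binEnt.hasSum
  have h2 := hK.sq_bhatt_le
  have h3 : Real.log 2 * condEnt K = (∑' a, binEnt (K a 0) (K a 1)) / 2 := by
    rw [condEnt]; field_simp
  linarith

lemma binEnt_le_log_two {a b : ℝ} (ha : 0 ≤ a) (hb : 0 ≤ b) :
    binEnt a b ≤ Real.log 2 * (a + b) := by
  have h := Real.concaveOn_negMulLog.2 ha hb (by norm_num : (0 : ℝ) ≤ 1 / 2)
    (by norm_num : (0 : ℝ) ≤ 1 / 2) (by norm_num)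
  simp only [smul_eq_mul] at h
  rw [← mul_add, ← mul_add] at h
  rcases (add_nonneg ha hb).eq_or_lt with h0 | h0
  · have ha0 : a = 0 := by linarith
    have hb0 : b = 0 := by linarith
    simp [ha0, hb0, binEnt]
  rw [binEnt]
  have : Real.negMulLog (1 / 2 * (a + b)) =
      1 / 2 * Real.negMulLog (a + b) + 1 / 2 * (Real.log 2 * (a + b)) := by
    simp only [Real.negMulLog]
    rw [Real.log_mul (by norm_num) h0.ne', one_div, Real.log_inv]
    ring
  linarith

lemma IsKernel.condEnt_le_one (hK : IsKernel K) : condEnt K ≤ 1 := by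
  have hl : 0 < Real.log 2 := Real.log_pos one_lt_two
  have h := hasSum_le (fun a => binEnt_le_log_two (hK.nonneg a 0) (hK.nonneg a 1))
    hK.summable_binEnt.hasSum (hK.hasSum_add.mul_left _)
  rw [condEnt, div_le_one (by positivity)]
  linarith

lemma hasSum_mul_of_nonneg {A B : Type*} {f : A → ℝ} {g : B → ℝ} {s t : ℝ} (hf : HasSum f s)
    (hg : HasSum g t) (hf0 : ∀ a, 0 ≤ f a) (hg0 : ∀ b, 0 ≤ g b) :
    HasSum (fun p : A × B => f p.1 * g p.2) (s * t) :=
  hf.mul hg (hf.summable.mul_of_nonneg hg.summable hf0 hg0)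

lemma IsKernel.to_pairing {B : Type*} {L : B → ZMod 2 → ℝ} (hK : IsKernel K) (hL : IsKernel L) :
    IsKernel (pairing K L) where
  nonneg a x := mul_nonneg (hK.nonneg _ _) (hL.nonneg _ _)
  hasSum x := by
    have := hasSum_mul_of_nonneg (hK.hasSum x) (hL.hasSum x) (fun a => hK.nonneg a x)
      (fun a => hL.nonneg a x)
    rwa [mul_one] at this

lemma IsKernel.to_shift (hK : IsKernel K) (s : ZMod 2) : IsKernel (shift s K) where
  nonneg _ _ := hK.nonneg _ _
  hasSum x := hK.hasSum (s + x)

lemma binEnt_comm (a b : ℝ) : binEnt a b = binEnt b a := by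
  simp only [binEnt, add_comm]

lemma condEnt_shift (s : ZMod 2) : condEnt (shift s K) = condEnt K := by
  rcases (by decide : ∀ x : ZMod 2, x = 0 ∨ x = 1) s with rfl | rfl
  · simp [shift, condEnt]
  · have : (1 + 1 : ZMod 2) = 0 := by decide
    simp only [shift, condEnt, this, add_zero, binEnt_comm (K _ 1)]

lemma bhatt_shift (s : ZMod 2) : bhatt (shift s K) = bhatt K := by
  rcases (by decide : ∀ x : ZMod 2, x = 0 ∨ x = 1) s with rfl | rfl
  · simp [shift, bhatt]
  · have : (1 + 1 : ZMod 2) = 0 := by decide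
    simp only [shift, bhatt, this, add_zero, mul_comm (K _ 1)]

/-- Source of polarization: a second observation of the same bit strictly lowers the entropy unless
`L` is useless or `K` is perfect. It is `binEnt_mul_le` summed over both outputs. -/
lemma IsKernel.condEnt_pairing_le {B : Type*} {L : B → ZMod 2 → ℝ} (hK : IsKernel K)
    (hL : IsKernel L) :
    condEnt (pairing K L) + (1 - bhatt L) * bhatt K ^ 2 / (2 * Real.log 2) ≤
      condEnt K := by
  have hl : 0 < Real.log 2 := Real.log_pos one_lt_two
  have n0 := fun a => hK.nonneg a 0
  have n1 := fun a => hK.nonneg a 1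
  have m0 := fun a => hL.nonneg a 0
  have m1 := fun a => hL.nonneg a 1
  have l0 : ∀ a, 0 ≤ K a 0 * (Real.log (K a 0 + K a 1) - Real.log (K a 0)) :=
    fun a => mul_log_sub_log_nonneg (n0 a) (n1 a)
  have l1 : ∀ a, 0 ≤ K a 1 * (Real.log (K a 0 + K a 1) - Real.log (K a 1)) := fun a => by
    rw [add_comm]; exact mul_log_sub_log_nonneg (n1 a) (n0 a)
  have s0 : Summable fun a => K a 0 * (Real.log (K a 0 + K a 1) - Real.log (K a 0)) :=
    hK.summable_binEnt.of_nonneg_of_le l0 fun a => by rw [binEnt_eq]; linarith [l1 a]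
  have s1 : Summable fun a => K a 1 * (Real.log (K a 0 + K a 1) - Real.log (K a 1)) :=
    hK.summable_binEnt.of_nonneg_of_le l1 fun a => by rw [binEnt_eq]; linarith [l0 a]
  have hR := (hasSum_mul_of_nonneg s0.hasSum (hL.hasSum 0) l0 m0).add
    (hasSum_mul_of_nonneg s1.hasSum (hL.hasSum 1) l1 m1)
  have hB : HasSum (fun b => L b 0 + L b 1 - 2 * √(L b 0 * L b 1)) (2 - 2 * bhatt L) :=
    hL.hasSum_add.sub (hL.summable_bhatt.hasSum.mul_left 2)
  have hS := ((hK.to_pairing hL).summable_binEnt.hasSum).add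
    (hasSum_mul_of_nonneg hK.summable_mul_div.hasSum hB
      (fun a => mul_div_add_nonneg (n0 a) (n1 a))
      (fun b => by linarith [sqrt_mul_le_half_add (m0 b) (m1 b)]))
  have h := hasSum_le (fun p : A × B => binEnt_mul_le (n0 p.1) (n1 p.1) (m0 p.2) (m1 p.2)) hS hR
  have e : (∑' a, binEnt (K a 0) (K a 1)) =
      ∑' a, K a 0 * (Real.log (K a 0 + K a 1) - Real.log (K a 0)) +
      ∑' a, K a 1 * (Real.log (K a 0 + K a 1) - Real.log (K a 1)) := by
    rw [← s0.tsum_add s1]; simp only [binEnt_eq]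
  rw [mul_one, mul_one, ← e] at h
  have h2 := hK.sq_bhatt_le
  have h3 := hL.bhatt_le_one
  have h4 : (1 - bhatt L) * bhatt K ^ 2 ≤
      (∑' a, K a 0 * K a 1 / (K a 0 + K a 1)) * (2 - 2 * bhatt L) := by nlinarith
  rw [condEnt, condEnt, ← add_div]
  exact div_le_div_of_nonneg_right (by linarith) (by positivity)

lemma IsKernel.summable_min (hK : IsKernel K) : Summable fun a => min (K a 0) (K a 1) :=
  hK.summable_of_le 1 (fun a => le_min (hK.nonneg a 0) (hK.nonneg a 1)) fun a => by
    linarith [min_le_left (K a 0) (K a 1), hK.nonneg a 1]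

/-- The sum of minima is twice the error probability of the best decision on a uniform bit; this
bound and the next translate between it and z. -/
lemma IsKernel.tsum_min_le_bhatt (hK : IsKernel K) : ∑' a, min (K a 0) (K a 1) ≤ bhatt K :=
  hK.summable_min.tsum_le_tsum (fun a => by
    refine Real.le_sqrt_of_sq_le ?_
    have h0 := hK.nonneg a 0
    have h1 := hK.nonneg a 1
    rcases min_cases (K a 0) (K a 1) with ⟨h, h'⟩ | ⟨h, h'⟩ <;> rw [h] <;> nlinarith)
    hK.summable_bhatt

lemma IsKernel.sq_bhatt_le_tsum_min (hK : IsKernel K) :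
    bhatt K ^ 2 ≤ 2 * ∑' a, min (K a 0) (K a 1) := by
  refine hK.sq_bhatt_le.trans (mul_le_mul_of_nonneg_left ?_ zero_le_two)
  refine hK.summable_mul_div.tsum_le_tsum (fun a => ?_) hK.summable_min
  have h0 := hK.nonneg a 0
  have h1 := hK.nonneg a 1
  refine div_le_of_le_mul₀ (by positivity) (le_min h0 h1) ?_
  rcases min_cases (K a 0) (K a 1) with ⟨h, h'⟩ | ⟨h, h'⟩ <;> rw [h] <;> nlinarith

end Kernel

lemma isKernel_prob {Y : Type*} (W : BDMC Y) : IsKernel W.prob where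
  nonneg _ _ := ENNReal.toReal_nonneg
  hasSum x := by
    have h := (W x).tsum_coe
    have := (ENNReal.summable_toReal (f := W x) (by simp [h])).hasSum
    rwa [← ENNReal.tsum_toReal_eq fun a => (W x).apply_ne_top a, h, ENNReal.toReal_one] at this

lemma symCapacity_eq {Y : Type*} (W : BDMC Y) : W.symCapacity = 1 - condEnt W.prob := by
  have hK := isKernel_prob W
  have hl : 0 < Real.log 2 := Real.log_pos one_lt_two
  have n0 := fun a => hK.nonneg a 0
  have n1 := fun a => hK.nonneg a 1
  have l0 : ∀ a, 0 ≤ W.prob a 0 * (Real.log (W.prob a 0 + W.prob a 1) - Real.log (W.prob a 0)) :=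
    fun a => mul_log_sub_log_nonneg (n0 a) (n1 a)
  have l1 : ∀ a, 0 ≤ W.prob a 1 * (Real.log (W.prob a 0 + W.prob a 1) - Real.log (W.prob a 1)) :=
    fun a => by rw [add_comm]; exact mul_log_sub_log_nonneg (n1 a) (n0 a)
  have s0 : Summable fun a =>
      W.prob a 0 * (Real.log (W.prob a 0 + W.prob a 1) - Real.log (W.prob a 0)) :=
    hK.summable_binEnt.of_nonneg_of_le l0 fun a => by rw [binEnt_eq]; linarith [l1 a]
  have s1 : Summable fun a =>
      W.prob a 1 * (Real.log (W.prob a 0 + W.prob a 1) - Real.log (W.prob a 1)) :=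
    hK.summable_binEnt.of_nonneg_of_le l1 fun a => by rw [binEnt_eq]; linarith [l0 a]
  have key : ∀ x : ZMod 2, (Summable fun a =>
      W.prob a x * (Real.log (W.prob a 0 + W.prob a 1) - Real.log (W.prob a x))) →
      ∑' y, 1 / 2 * W.prob y x *
      Real.logb 2 (W.prob y x / (1 / 2 * W.prob y 0 + 1 / 2 * W.prob y 1)) =
      1 / 2 * 1 - (∑' y, W.prob y x * (Real.log (W.prob y 0 + W.prob y 1) -
        Real.log (W.prob y x))) / (2 * Real.log 2) := by
    intro x hx
    rw [← (((hK.hasSum x).mul_left (1 / 2)).sub (hx.hasSum.div_const _)).tsum_eq]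
    refine tsum_congr fun y => ?_
    rcases (hK.nonneg y x).eq_or_lt with h | h
    · simp [← h]
    have hs : 0 < W.prob y 0 + W.prob y 1 := by
      rcases (by decide : ∀ x : ZMod 2, x = 0 ∨ x = 1) x with rfl | rfl
      · linarith [n1 y]
      · linarith [n0 y]
    rw [← mul_add, Real.logb, Real.log_div h.ne' (by positivity),
      Real.log_mul (by norm_num) hs.ne', one_div, Real.log_inv]
    field_simp
    ring
  have e : (∑' a, binEnt (W.prob a 0) (W.prob a 1)) =
      ∑' a, W.prob a 0 * (Real.log (W.prob a 0 + W.prob a 1) - Real.log (W.prob a 0)) +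
      ∑' a, W.prob a 1 * (Real.log (W.prob a 0 + W.prob a 1) - Real.log (W.prob a 1)) := by
    rw [← s0.tsum_add s1]; simp only [binEnt_eq]
  rw [BDMC.symCapacity, sum_zmod_two, condEnt, e, key 0 s0, key 1 s1]
  ring

end

end PolarCode

/-! ### Sums over product alphabets. -/

namespace PolarCode

noncomputable section

lemma hasSum_fin_pi_prod {A : Type*} {n : ℕ} {f : Fin n → A → ℝ} {s : Fin n → ℝ}
    (h0 : ∀ k a, 0 ≤ f k a) (h : ∀ k, HasSum (f k) (s k)) :
    HasSum (fun a : Fin n → A => ∏ k, f k (a k)) (∏ k, s k) := by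
  induction n with
  | zero => simp
  | succ n ih =>
    rw [← (Fin.consEquiv fun _ => A).hasSum_iff, Fin.prod_univ_succ]
    have := hasSum_mul_of_nonneg (h 0) (ih (fun k => h0 k.succ) fun k => h k.succ) (h0 0)
      (fun a => Finset.prod_nonneg fun k _ => h0 k.succ (a k))
    refine this.congr_fun fun p => ?_
    simp [Fin.consEquiv, Fin.prod_univ_succ]

lemma hasSum_pi_prod {ι A : Type*} [Fintype ι] {f : ι → A → ℝ} {s : ι → ℝ}
    (h0 : ∀ k a, 0 ≤ f k a) (h : ∀ k, HasSum (f k) (s k)) :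
    HasSum (fun a : ι → A => ∏ k, f k (a k)) (∏ k, s k) := by
  have e := Fintype.equivFin ι
  rw [← (e.symm.arrowCongr (Equiv.refl A)).hasSum_iff, ← e.symm.prod_comp]
  have := hasSum_fin_pi_prod (fun k => h0 (e.symm k)) (fun k => h (e.symm k))
  refine this.congr_fun fun a => ?_
  simp only [Function.comp]
  rw [← e.symm.prod_comp]
  simp

lemma hasSum_prod_fintype {A B : Type*} [Fintype B] {f : A → B → ℝ} {s : B → ℝ}
    (h : ∀ b, HasSum (fun a => f a b) (s b)) :
    HasSum (fun p : A × B => f p.1 p.2) (∑ b, s b) := by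
  classical
  have h1 : ∀ b, HasSum (fun p : A × B => if p.2 = b then f p.1 p.2 else 0) (s b) := by
    intro b
    have hinj : Function.Injective fun a : A => (a, b) := fun a a' h => (Prod.ext_iff.1 h).1
    rw [← hinj.hasSum_iff]
    · simpa [Function.comp_def] using h b
    · rintro ⟨a, b'⟩ hx
      simp only [Set.mem_range, Prod.mk.injEq, exists_eq_left] at hx
      rw [if_neg]
      rintro rfl
      simp at hx
  have := hasSum_sum (s := Finset.univ) fun b _ => h1 b
  simpa using this

/-- The sum over two distinguished coordinates separates from the others. -/
lemma hasSum_pi_prod_of_two {ι A : Type*} [Fintype ι] [DecidableEq ι] {a b : ι} (hab : a ≠ b)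
    {g : A × A → ℝ} {t : ℝ} (hg0 : ∀ p, 0 ≤ g p) (hg : HasSum g t)
    {f : ι → A → ℝ} (h0 : ∀ k x, 0 ≤ f k x) (h : ∀ k, HasSum (f k) 1) :
    HasSum (fun y : ι → A => g (y a, y b) * ∏ k with k ≠ a ∧ k ≠ b, f k (y k)) t := by
  let p : ι → Prop := fun k => k ≠ a ∧ k ≠ b
  let e : (ι → A) ≃ (A × A) × ({k // p k} → A) :=
    { toFun := fun y => ((y a, y b), fun k => y k)
      invFun := fun z k => if h : p k then z.2 ⟨k, h⟩ else if k = a then z.1.1 else z.1.2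
      left_inv := fun y => by
        funext k
        by_cases h : p k
        · simp [h]
        · simp only [h, dite_false]
          by_cases ha : k = a
          · simp [ha]
          · simp only [p, not_and, ne_eq, not_not] at h
            simp [h ha, hab.symm]
      right_inv := fun z => by
        refine Prod.ext (Prod.ext ?_ ?_) ?_
        · simp [p]
        · simp [p, hab.symm]
        · funext k
          simp [k.2] }
  have h1 := hasSum_mul_of_nonneg hg
    (hasSum_pi_prod (fun (k : {k // p k}) x => h0 k x) fun k => h k) hg0
    (fun y => Finset.prod_nonneg fun k _ => h0 _ _)
  rw [Finset.prod_const_one, mul_one, ← e.hasSum_iff] at h1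
  convert h1 using 2 with y
  simp only [Function.comp, e, Equiv.coe_fn_mk]
  congr 1
  exact (Finset.prod_subtype _ (by simp [p]) fun k => f k (y k))

/-! ### Sums over words with a given prefix, and the chain rule. -/

section Prefix

variable {N : ℕ}

lemma card_prefix (j : ℕ) (hj : j ≤ N) (v : Fin N → ZMod 2) :
    (Finset.univ.filter fun w : Fin N → ZMod 2 => ∀ i : Fin N, i.val < j → w i = v i).card =
      2 ^ (N - j) := by
  have : (Finset.univ.filter fun w : Fin N → ZMod 2 => ∀ i : Fin N, i.val < j → w i = v i) =
      Fintype.piFinset fun i => if i.val < j then {v i} else Finset.univ := by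
    ext w
    simp only [Finset.mem_filter, Finset.mem_univ, true_and, Fintype.mem_piFinset]
    refine forall_congr' fun i => ?_
    split_ifs with h <;> simp [h]
  rw [this, Fintype.card_piFinset]
  have h2 : ∀ i : Fin N, (if i.val < j then {v i} else (Finset.univ : Finset (ZMod 2))).card =
      if i.val < j then 1 else 2 := by
    intro i
    split_ifs <;> simp
  simp only [h2]
  rw [Finset.prod_ite, Finset.prod_const_one, one_mul, Finset.prod_const]
  congr 1
  rw [Finset.filter_not, Finset.card_sdiff_of_subset (Finset.filter_subset _ _), Finset.card_univ,
    Fintype.card_fin, Fin.card_filter_val_lt, min_eq_right hj]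

/-- Prefixes are represented by whole words, so every prefix of length j is counted 2^(N-j) times;
the normalizations 1/2^(N-j) elsewhere undo this. -/
lemma sum_sum_prefix (j : ℕ) (hj : j ≤ N) (F : (Fin N → ZMod 2) → ℝ)  :
    ∑ v : Fin N → ZMod 2, ∑ w : Fin N → ZMod 2 with (∀ i : Fin N, i.val < j → w i = v i), F w =
      2 ^ (N - j) * ∑ w, F w := by
  simp only [Finset.sum_filter]
  rw [Finset.sum_comm, Finset.mul_sum]
  refine Finset.sum_congr rfl fun w _ => ?_
  rw [← Finset.sum_filter, Finset.sum_const, nsmul_eq_mul]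
  have := card_prefix j hj w
  simp only [eq_comm (a := w _)] at *
  rw [this]
  norm_num

lemma prefix_succ_iff (j : Fin N) (v w : Fin N → ZMod 2) (b : ZMod 2) :
    ((∀ i < j, w i = v i) ∧ w j = b) ↔
      ∀ i : Fin N, i.val < j.val + 1 → w i = Function.update v j b i := by
  constructor
  · rintro ⟨h, hb⟩ i hi
    rcases eq_or_ne i j with rfl | hij
    · simp [hb]
    · rw [Function.update_of_ne hij]
      exact h i (lt_of_le_of_ne (Nat.lt_succ_iff.1 hi) hij)
  · intro h
    refine ⟨fun i hi => ?_, ?_⟩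
    · have := h i (Nat.lt_succ_of_lt hi)
      rwa [Function.update_of_ne hi.ne] at this
    · simpa using h j (Nat.lt_succ_self _)

lemma card_prefix_succ (j : Fin N) (v : Fin N → ZMod 2) (b : ZMod 2) :
    (Finset.univ.filter fun w : Fin N → ZMod 2 => (∀ i < j, w i = v i) ∧ w j = b).card =
      2 ^ (N - (j.val + 1)) := by
  simp only [prefix_succ_iff]
  exact card_prefix _ j.2 _

lemma zmod_two_eq (x : ZMod 2) : x = 0 ∨ x = 1 := by
  revert x; decide

lemma sum_update (j : Fin N) (g : (Fin N → ZMod 2) → ℝ) :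
    ∑ v, (g (Function.update v j 0) + g (Function.update v j 1)) = 2 * ∑ v, g v := by
  have h : ∀ v : Fin N → ZMod 2, g (Function.update v j 0) + g (Function.update v j 1) =
      g v + g (v + Pi.single j 1) := by
    intro v
    have h1 : v + Pi.single j 1 = Function.update v j (v j + 1) := by
      funext i
      rcases eq_or_ne i j with rfl | h <;> simp [*]
    have h2 : v = Function.update v j (v j) := by simp
    rw [h1]
    rcases zmod_two_eq (v j) with h | h
    · rw [h, zero_add]; nth_rw 3 [h2]; rw [h]
    · rw [h, show (1 + 1 : ZMod 2) = 0 by decide, add_comm]; nth_rw 3 [h2]; rw [h]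
  simp only [h]
  have h2 := Equiv.sum_comp (Equiv.addRight (Pi.single j (1 : ZMod 2) : Fin N → ZMod 2)) g
  simp only [Equiv.coe_addRight] at h2
  rw [Finset.sum_add_distrib, h2, two_mul]

/-- The sum of `p` over the words that continue the first `j` letters of `v`. -/
def prefixSum (p : (Fin N → ZMod 2) → ℝ) (j : ℕ) (v : Fin N → ZMod 2) : ℝ :=
  ∑ w : Fin N → ZMod 2 with (∀ i : Fin N, i.val < j → w i = v i), p w

/-- The sum of `p` over the words that continue the first `j` letters of `v` by the letter `b`. -/
def branchSum (p : (Fin N → ZMod 2) → ℝ) (j : Fin N) (v : Fin N → ZMod 2) (b : ZMod 2) : ℝ :=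
  ∑ w : Fin N → ZMod 2 with (∀ i < j, w i = v i) ∧ w j = b, p w

lemma branchSum_eq (p : (Fin N → ZMod 2) → ℝ) (j : Fin N) (v : Fin N → ZMod 2) (b : ZMod 2) :
    branchSum p j v b = prefixSum p (j + 1) (Function.update v j b) := by
  simp only [branchSum, prefixSum, prefix_succ_iff]

lemma branchSum_add (p : (Fin N → ZMod 2) → ℝ) (j : Fin N) (v : Fin N → ZMod 2) :
    branchSum p j v 0 + branchSum p j v 1 = prefixSum p j v := by
  simp only [branchSum, prefixSum]
  rw [← Finset.sum_union]
  · refine Finset.sum_congr ?_ fun _ _ => rfl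
    ext w
    simp only [Finset.mem_union, Finset.mem_filter, Finset.mem_univ, true_and, ← and_or_left]
    exact ⟨fun h => h.1, fun h => ⟨h, zmod_two_eq _⟩⟩
  · rw [Finset.disjoint_filter]
    rintro w - ⟨-, h⟩ ⟨-, h'⟩
    rw [h] at h'
    exact absurd h' (by decide)

lemma prefixSum_zero (p : (Fin N → ZMod 2) → ℝ) (v : Fin N → ZMod 2) :
    prefixSum p 0 v = ∑ w, p w := by
  simp [prefixSum]

lemma prefixSum_self (p : (Fin N → ZMod 2) → ℝ) (v : Fin N → ZMod 2) :
    prefixSum p N v = p v := by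
  have : ∀ w : Fin N → ZMod 2, (∀ i : Fin N, i.val < N → w i = v i) ↔ w = v :=
    fun w => ⟨fun h => funext fun i => h i i.2, fun h i _ => congrFun h i⟩
  simp only [prefixSum, this]
  simp [Finset.sum_filter]

/-- The chain rule for the entropy of a word, letter by letter. -/
lemma sum_binEnt_branchSum (p : (Fin N → ZMod 2) → ℝ) :
    ∑ j : Fin N, (1 / 2 ^ (N - j.val)) * ∑ v, binEnt (branchSum p j v 0) (branchSum p j v 1) =
      ∑ w, Real.negMulLog (p w) - Real.negMulLog (∑ w, p w) := by
  -- T j is the entropy term of the first j letters, each prefix counted once; the entropy of letter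
  -- j given its predecessors is the increment, so the sum telescopes.
  let T : ℕ → ℝ := fun j => 1 / 2 ^ (N - j) * ∑ v, Real.negMulLog (prefixSum p j v)
  have h1 : ∀ j : Fin N, (1 / 2 ^ (N - j.val)) *
      ∑ v, binEnt (branchSum p j v 0) (branchSum p j v 1) = T (j + 1) - T j := by
    intro j
    simp only [binEnt, branchSum_add]
    rw [Finset.sum_sub_distrib]
    simp only [branchSum_eq]
    rw [sum_update j (fun v => Real.negMulLog (prefixSum p (j + 1) v)), mul_sub]
    simp only [T]
    congr 1
    rw [show N - j.val = (N - (j.val + 1)) + 1 by omega, pow_succ]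
    field_simp
  rw [Finset.sum_congr rfl fun j _ => h1 j, Fin.sum_univ_eq_sum_range (fun j => T (j + 1) - T j),
    Finset.sum_range_sub]
  simp [T, prefixSum_zero, prefixSum_self]

end Prefix

/-! ### The channel of one letter given the earlier letters, and its Bhattacharyya parameter. -/

/-- The `j`-th channel obtained from independent copies of `K` whose inputs are `w M`. The whole
word `v` is listed in the output, but only its letters before `j` matter. -/
def split {A : Type*} {N : ℕ} (M : Matrix (Fin N) (Fin N) (ZMod 2)) (j : Fin N)
    (K : A → ZMod 2 → ℝ) : (Fin N → A) × (Fin N → ZMod 2) → ZMod 2 → ℝ :=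
  fun p b => 1 / 2 ^ (N - 1) * (1 / 2 ^ (N - j.val)) *
    branchSum (fun w => ∏ k, K (p.1 k) (Matrix.vecMul w M k)) j p.2 b

section Split

variable {A : Type*} {N : ℕ} {K : A → ZMod 2 → ℝ} (M : Matrix (Fin N) (Fin N) (ZMod 2))

/-- Total mass one: the output lists 2^N words v, and each leaves 2^(N-j-1) continuations after
letter j is fixed, each of mass 1. -/
lemma splitCoef_mul (j : Fin N) :
    (1 : ℝ) / 2 ^ (N - 1) * (1 / 2 ^ (N - j.val)) * (2 ^ N * 2 ^ (N - (j.val + 1))) = 1 := by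
  have h0 := j.2
  have h1 : (2 : ℝ) ^ N = 2 ^ (N - 1) * 2 := by rw [← pow_succ]; congr 1; omega
  rw [show N - j.val = (N - (j.val + 1)) + 1 by omega, h1, pow_succ]
  field_simp

lemma branchSum_nonneg {p : (Fin N → ZMod 2) → ℝ} (hp : ∀ w, 0 ≤ p w) (j : Fin N)
    (v : Fin N → ZMod 2) (b : ZMod 2) : 0 ≤ branchSum p j v b :=
  Finset.sum_nonneg fun w _ => hp w

lemma IsKernel.prod_nonneg (hK : IsKernel K) (a : Fin N → A) (x : Fin N → ZMod 2) :
    0 ≤ ∏ k, K (a k) (x k) := Finset.prod_nonneg fun _ _ => hK.nonneg _ _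

lemma IsKernel.hasSum_prod (hK : IsKernel K) (x : Fin N → ZMod 2) :
    HasSum (fun a : Fin N → A => ∏ k, K (a k) (x k)) 1 := by
  have := hasSum_pi_prod (fun k a => hK.nonneg a (x k)) (fun k => hK.hasSum (x k))
  rwa [Finset.prod_const_one] at this

lemma IsKernel.to_split (hK : IsKernel K) (j : Fin N) : IsKernel (split M j K) where
  nonneg a b := mul_nonneg (by positivity) (branchSum_nonneg (fun w => hK.prod_nonneg _ _) _ _ _)
  hasSum b := by
    have h : ∀ v : Fin N → ZMod 2, HasSum (fun a => split M j K (a, v) b)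
        (1 / 2 ^ (N - 1) * (1 / 2 ^ (N - j.val)) * 2 ^ (N - (j.val + 1))) := by
      intro v
      refine HasSum.mul_left _ ?_
      have := hasSum_sum (s := Finset.univ.filter fun w : Fin N → ZMod 2 =>
        (∀ i < j, w i = v i) ∧ w j = b) fun w _ => hK.hasSum_prod (Matrix.vecMul w M)
      rw [Finset.sum_const, card_prefix_succ, nsmul_eq_mul, mul_one] at this
      push_cast at this
      exact this
    have h2 := hasSum_prod_fintype h
    rw [Finset.sum_const, Finset.card_univ, Fintype.card_fun, ZMod.card, Fintype.card_fin,
      nsmul_eq_mul] at h2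
    push_cast at h2
    rw [← splitCoef_mul j]
    convert h2 using 1
    ring

lemma hammingDist_vecMul (a b : Fin N → ZMod 2) :
    hammingDist (Matrix.vecMul a M) (Matrix.vecMul b M) =
      hammingNorm (Matrix.vecMul (a - b) M) := by
  rw [hammingDist_comm, hammingDist_eq_hammingNorm, Matrix.sub_vecMul, neg_add_eq_sub]

lemma partialDist_le_hammingNorm {j : Fin N} {d : Fin N → ZMod 2} (h0 : ∀ i < j, d i = 0)
    (h1 : d j = 1) : partialDist M j ≤ hammingNorm (Matrix.vecMul d M) :=
  Nat.sInf_le ⟨0, d, by simp, h0, by simp, h1, by simp⟩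

lemma exists_hammingNorm_eq_partialDist (j : Fin N) : ∃ d : Fin N → ZMod 2, (∀ i < j, d i = 0) ∧
    d j = 1 ∧ hammingNorm (Matrix.vecMul d M) = partialDist M j := by
  obtain ⟨a, b, ha, hb, haj, hbj, h⟩ := Nat.sInf_mem (s := {d | ∃ a b : Fin N → ZMod 2,
    (∀ i < j, a i = 0) ∧ (∀ i < j, b i = 0) ∧ a j = 0 ∧ b j = 1 ∧
    d = hammingDist (Matrix.vecMul a M) (Matrix.vecMul b M)})
    ⟨_, 0, Pi.single j 1, by simp, fun i hi => by simp [hi.ne], by simp, by simp, rfl⟩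
  refine ⟨a - b, fun i hi => by simp [ha i hi, hb i hi], ?_, ?_⟩
  · rw [Pi.sub_apply, haj, hbj]; decide
  · rw [← hammingDist_vecMul]
    exact h.symm

/-- The sum factors over coordinates: those where the two inputs agree give 1, the others give
`bhatt K`. -/
lemma IsKernel.hasSum_sqrt_prod (hK : IsKernel K) (x x' : Fin N → ZMod 2) :
    HasSum (fun a : Fin N → A => √((∏ k, K (a k) (x k)) * ∏ k, K (a k) (x' k)))
      (bhatt K ^ hammingDist x x') := by
  have h : ∀ k, HasSum (fun a => √(K a (x k) * K a (x' k))) (if x k ≠ x' k then bhatt K else 1) := by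
    intro k
    split_ifs with h
    · have hb := hK.summable_bhatt.hasSum
      rcases zmod_two_eq (x k) with h0 | h0 <;> rcases zmod_two_eq (x' k) with h1 | h1
      · exact absurd (h0.trans h1.symm) h
      · simpa [h0, h1, bhatt] using hb
      · simpa [h0, h1, mul_comm, bhatt] using hb
      · exact absurd (h0.trans h1.symm) h
    · rw [not_not] at h
      refine (hK.hasSum (x k)).congr_fun fun a => ?_
      rw [← h, Real.sqrt_mul_self (hK.nonneg _ _)]
  have h2 := hasSum_pi_prod (fun k a => Real.sqrt_nonneg _) h
  rw [Finset.prod_ite, Finset.prod_const_one, mul_one, Finset.prod_const] at h2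
  refine h2.congr_fun fun a => ?_
  rw [← Finset.prod_mul_distrib, Real.sqrt_prod _ fun k _ =>
    mul_nonneg (hK.nonneg _ _) (hK.nonneg _ _)]

lemma sqrt_sum_le {ι : Type*} (s : Finset ι) {f : ι → ℝ} (hf : ∀ i, 0 ≤ f i) :
    √(∑ i ∈ s, f i) ≤ ∑ i ∈ s, √(f i) := by
  rw [Real.sqrt_le_left (Finset.sum_nonneg fun _ _ => Real.sqrt_nonneg _)]
  calc ∑ i ∈ s, f i = ∑ i ∈ s, √(f i) ^ 2 :=
        Finset.sum_congr rfl fun i _ => (Real.sq_sqrt (hf i)).symm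
    _ ≤ _ := Finset.sum_sq_le_sq_sum_of_nonneg fun _ _ => Real.sqrt_nonneg _

lemma sqrt_mul_mul_mul {c x y : ℝ} (hc : 0 ≤ c) : √(c * x * (c * y)) = c * √(x * y) := by
  rw [show c * x * (c * y) = c ^ 2 * (x * y) by ring, Real.sqrt_mul (sq_nonneg c),
    Real.sqrt_sq hc]

/-- √ is subadditive, so the parameter is at most a sum over pairs of words that first differ at j.
The codewords of such a pair are at distance at least `partialDist M j`; counting the pairs gives
the factor, crudely enlarged to 2^N. -/
lemma IsKernel.bhatt_split_le (hK : IsKernel K) (j : Fin N) :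
    bhatt (split M j K) ≤ 2 ^ N * bhatt K ^ partialDist M j := by
  set c : ℝ := 1 / 2 ^ (N - 1) * (1 / 2 ^ (N - j.val)) with hc
  have hc0 : 0 ≤ c := by positivity
  let S : (Fin N → ZMod 2) → ZMod 2 → Finset (Fin N → ZMod 2) := fun v b =>
    Finset.univ.filter fun w : Fin N → ZMod 2 => (∀ i < j, w i = v i) ∧ w j = b
  have h1 := hasSum_prod_fintype (fun v : Fin N → ZMod 2 => (hasSum_sum (s := S v 0) fun w _ =>
    hasSum_sum (s := S v 1) fun w' _ =>
      hK.hasSum_sqrt_prod (Matrix.vecMul w M) (Matrix.vecMul w' M)).mul_left c)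
  have h2 := hasSum_le (fun p => ?_) (hK.to_split M j).summable_bhatt.hasSum h1
  · refine h2.trans ?_
    have h3 : ∀ v, ∀ w ∈ S v 0, ∀ w' ∈ S v 1,
        bhatt K ^ hammingDist (Matrix.vecMul w M) (Matrix.vecMul w' M) ≤
          bhatt K ^ partialDist M j := by
      intro v w hw w' hw'
      simp only [S, Finset.mem_filter, Finset.mem_univ, true_and] at hw hw'
      refine pow_le_pow_of_le_one bhatt_nonneg hK.bhatt_le_one ?_
      rw [hammingDist_vecMul]
      refine partialDist_le_hammingNorm M (fun i hi => ?_) ?_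
      · simp [hw.1 i hi, hw'.1 i hi]
      · rw [Pi.sub_apply, hw.2, hw'.2]; decide
    have h4 : ∀ v b, ((S v b).card : ℝ) = 2 ^ (N - (j.val + 1)) := by
      intro v b
      rw [card_prefix_succ]; norm_num
    calc _ ≤ ∑ v : Fin N → ZMod 2, c * (2 ^ (N - (j.val + 1)) *
          (2 ^ (N - (j.val + 1)) * bhatt K ^ partialDist M j)) := by
          refine Finset.sum_le_sum fun v _ => mul_le_mul_of_nonneg_left ?_ hc0
          rw [← h4 v 0, ← nsmul_eq_mul]
          refine Finset.sum_le_card_nsmul _ _ _ fun w hw => ?_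
          rw [h4 v 0, ← h4 v 1, ← nsmul_eq_mul]
          exact Finset.sum_le_card_nsmul _ _ _ fun w' hw' => h3 v w hw w' hw'
      _ = (c * (2 ^ N * 2 ^ (N - (j.val + 1)))) *
          (2 ^ (N - (j.val + 1)) * bhatt K ^ partialDist M j) := by
          rw [Finset.sum_const, Finset.card_univ, Fintype.card_fun, ZMod.card, Fintype.card_fin,
            nsmul_eq_mul]
          push_cast
          ring
      _ ≤ _ := by
          rw [hc, splitCoef_mul, one_mul]
          refine mul_le_mul_of_nonneg_right ?_ (pow_nonneg bhatt_nonneg _)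
          exact pow_le_pow_right₀ one_le_two (Nat.sub_le _ _)
  · have n : ∀ w, 0 ≤ ∏ k, K (p.1 k) (Matrix.vecMul w M k) := fun w => hK.prod_nonneg _ _
    simp only [split]
    rw [← hc, sqrt_mul_mul_mul hc0]
    refine mul_le_mul_of_nonneg_left ?_ hc0
    rw [Real.sqrt_mul (branchSum_nonneg n _ _ _)]
    refine (mul_le_mul (sqrt_sum_le _ n) (sqrt_sum_le _ n) (Real.sqrt_nonneg _)
      (Finset.sum_nonneg fun _ _ => Real.sqrt_nonneg _)).trans (le_of_eq ?_)
    rw [Finset.sum_mul_sum]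
    exact Finset.sum_congr rfl fun w _ => Finset.sum_congr rfl fun w' _ =>
      (Real.sqrt_mul (n w) _).symm

/-- Let d attain the partial distance. Translation by d matches the words with letter 0 at j to
those with letter 1, and Cauchy–Schwarz along this matching loses nothing but the cross terms. -/
lemma IsKernel.le_bhatt_split (hK : IsKernel K) (j : Fin N) :
    bhatt K ^ partialDist M j ≤ bhatt (split M j K) := by
  set c : ℝ := 1 / 2 ^ (N - 1) * (1 / 2 ^ (N - j.val)) with hc
  have hc0 : 0 ≤ c := by positivity
  obtain ⟨d, hd0, hd1, hd⟩ := exists_hammingNorm_eq_partialDist M j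
  let S : (Fin N → ZMod 2) → ZMod 2 → Finset (Fin N → ZMod 2) := fun v b =>
    Finset.univ.filter fun w : Fin N → ZMod 2 => (∀ i < j, w i = v i) ∧ w j = b
  have h1 := hasSum_prod_fintype (fun v : Fin N → ZMod 2 => (hasSum_sum (s := S v 0) fun w _ =>
      hK.hasSum_sqrt_prod (Matrix.vecMul w M) (Matrix.vecMul (w + d) M)).mul_left c)
  have h2 := hasSum_le (fun p => ?_) h1 (hK.to_split M j).summable_bhatt.hasSum
  · refine le_trans (le_of_eq ?_) h2
    have h3 : ∀ w, hammingDist (Matrix.vecMul w M) (Matrix.vecMul (w + d) M) =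
        partialDist M j := by
      intro w
      rw [hammingDist_comm, hammingDist_vecMul, add_sub_cancel_left, hd]
    simp only [h3, Finset.sum_const, S, card_prefix_succ]
    rw [Finset.card_univ, Fintype.card_fun, ZMod.card, Fintype.card_fin, nsmul_eq_mul, nsmul_eq_mul]
    have := splitCoef_mul j
    rw [← hc] at this
    push_cast
    linear_combination (-bhatt K ^ partialDist M j) * this
  · have n : ∀ w, 0 ≤ ∏ k, K (p.1 k) (Matrix.vecMul w M k) := fun w => hK.prod_nonneg _ _
    simp only [split]
    rw [← hc, sqrt_mul_mul_mul hc0]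
    refine mul_le_mul_of_nonneg_left ?_ hc0
    have hB : branchSum (fun w => ∏ k, K (p.1 k) (Matrix.vecMul w M k)) j p.2 1 =
        ∑ w ∈ S p.2 0, ∏ k, K (p.1 k) (Matrix.vecMul (w + d) M k) := by
      have h11 : (1 + 1 : ZMod 2) = 0 := by decide
      have hdd : d + d = 0 := funext fun i => CharTwo.add_self_eq_zero (d i)
      refine (Finset.sum_bij' (fun w _ => w + d) (fun w _ => w + d) ?_ ?_ ?_ ?_ ?_).symm
      · intro w hw
        simp only [S, Finset.mem_filter, Finset.mem_univ, true_and, Pi.add_apply] at hw ⊢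
        exact ⟨fun i hi => by rw [hw.1 i hi, hd0 i hi, add_zero], by rw [hw.2, hd1, zero_add]⟩
      · intro w hw
        simp only [S, Finset.mem_filter, Finset.mem_univ, true_and, Pi.add_apply] at hw ⊢
        exact ⟨fun i hi => by rw [hw.1 i hi, hd0 i hi, add_zero], by rw [hw.2, hd1, h11]⟩
      · intro w _; rw [add_assoc, hdd, add_zero]
      · intro w _; rw [add_assoc, hdd, add_zero]
      · intro w _; rfl
    rw [Real.sqrt_mul (branchSum_nonneg n _ _ _), hB]
    refine le_trans (le_of_eq ?_) (Real.sum_sqrt_mul_sqrt_le _ n fun w => n (w + d))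
    exact Finset.sum_congr rfl fun w _ => Real.sqrt_mul (n w) _

end Split

end

end PolarCode

/-! ### Conservation of entropy, and the letter that gains. -/

namespace PolarCode

noncomputable section

lemma prod_ite_eq_erase {ι : Type*} [DecidableEq ι] [Fintype ι] (k : ι) (f g : ι → ℝ) :
    ∏ i, (if i = k then f i else g i) = f k * ∏ i ∈ Finset.univ.erase k, g i := by
  rw [← Finset.mul_prod_erase _ _ (Finset.mem_univ k), if_pos rfl]
  congr 1
  exact Finset.prod_congr rfl fun i hi => if_neg (Finset.ne_of_mem_erase hi)

/-- `Real.negMulLog` obeys the Leibniz rule on products, which is why entropy is additive over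
independent coordinates. -/
lemma negMulLog_prod {ι : Type*} [DecidableEq ι] (s : Finset ι) (t : ι → ℝ) :
    Real.negMulLog (∏ k ∈ s, t k) =
      ∑ k ∈ s, ∏ i ∈ s, (if i = k then Real.negMulLog (t i) else t i) := by
  induction s using Finset.induction_on with
  | empty => simp
  | insert a s ha ih =>
    rw [Finset.prod_insert ha, Real.negMulLog_mul, ih, Finset.sum_insert ha,
      Finset.prod_insert ha, if_pos rfl]
    congr 1
    · rw [mul_comm]
      congr 1
      exact Finset.prod_congr rfl fun i hi => (if_neg (by rintro rfl; exact ha hi)).symm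
    · rw [Finset.mul_sum]
      refine Finset.sum_congr rfl fun k hk => ?_
      rw [Finset.prod_insert ha, if_neg (by rintro rfl; exact ha hk)]

lemma sum_prod_apply {ι : Type*} [Fintype ι] [DecidableEq ι] (f : ι → ZMod 2 → ℝ) :
    ∑ x : ι → ZMod 2, ∏ k, f k (x k) = ∏ k, (f k 0 + f k 1) := by
  simp only [← sum_zmod_two]
  exact (Fintype.prod_sum f).symm

/-- The entropy of a product law. -/
lemma sum_negMulLog_prod {ι : Type*} [Fintype ι] [DecidableEq ι] (q : ι → ZMod 2 → ℝ) :
    ∑ x : ι → ZMod 2, Real.negMulLog (∏ k, q k (x k)) -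
        Real.negMulLog (∑ x : ι → ZMod 2, ∏ k, q k (x k)) =
      ∑ k, ∏ i, (if i = k then binEnt (q i 0) (q i 1) else q i 0 + q i 1) := by
  rw [sum_prod_apply]
  simp only [negMulLog_prod]
  rw [Finset.sum_comm, ← Finset.sum_sub_distrib]
  refine Finset.sum_congr rfl fun k _ => ?_
  rw [sum_prod_apply (fun i b => if i = k then Real.negMulLog (q i b) else q i b)]
  have h : ∀ i, ((if i = k then Real.negMulLog (q i 0) else q i 0) +
      if i = k then Real.negMulLog (q i 1) else q i 1) =
      if i = k then Real.negMulLog (q i 0) + Real.negMulLog (q i 1) else q i 0 + q i 1 := by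
    intro i; split_ifs <;> rfl
  simp only [h, prod_ite_eq_erase]
  rw [← sub_mul, binEnt]

lemma binEnt_mul {c : ℝ} (a b : ℝ) : binEnt (c * a) (c * b) = c * binEnt a b := by
  simp only [binEnt, ← mul_add, Real.negMulLog_mul]; ring

section Conservation

variable {A : Type*} {N : ℕ} {K : A → ZMod 2 → ℝ} {M : Matrix (Fin N) (Fin N) (ZMod 2)}

lemma vecMul_bijective (hM : IsUnit M.det) :
    Function.Bijective fun w : Fin N → ZMod 2 => Matrix.vecMul w M := by
  refine Finite.injective_iff_bijective.1 ?_
  exact Matrix.vecMul_injective_of_isUnit ((Matrix.isUnit_iff_isUnit_det M).2 hM)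

lemma sum_vecMul (hM : IsUnit M.det) (f : (Fin N → ZMod 2) → ℝ) :
    ∑ w, f (Matrix.vecMul w M) = ∑ x, f x :=
  (Equiv.ofBijective _ (vecMul_bijective hM)).sum_comp f

/-- The transformation by an invertible matrix conserves entropy. -/
lemma IsKernel.sum_condEnt_split (hK : IsKernel K) (hM : IsUnit M.det) :
    ∑ j, condEnt (split M j K) = N * condEnt K := by
  rcases Nat.eq_zero_or_pos N with rfl | hN
  · simp
  have hl : 0 < Real.log 2 := Real.log_pos one_lt_two
  set E := ∑' a, binEnt (K a 0) (K a 1) with hE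
  set c : ℝ := 1 / 2 ^ (N - 1) with hc
  have h1 : ∀ j v, Summable fun a => binEnt (split M j K (a, v) 0)
      (split M j K (a, v) 1) := fun j v =>
    (hK.to_split M j).summable_binEnt.comp_injective (i := fun a => (a, v))
      fun a a' h => (Prod.ext_iff.1 h).1
  have h2 := hasSum_sum (s := Finset.univ) fun (j : Fin N) _ =>
    hasSum_sum (s := Finset.univ) fun v _ => (h1 j v).hasSum
  have h3 : ∀ j : Fin N, ∑ v, ∑' a, binEnt (split M j K (a, v) 0)
      (split M j K (a, v) 1) = condEnt (split M j K) * (2 * Real.log 2) := by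
    intro j
    rw [condEnt, div_mul_cancel₀ _ (by positivity)]
    exact ((hasSum_prod_fintype fun v => (h1 j v).hasSum).tsum_eq).symm
  simp only [h3, ← Finset.sum_mul] at h2
  have h4 : ∀ k : Fin N, HasSum (fun a : Fin N → A => ∏ i, (if i = k then
      binEnt (K (a i) 0) (K (a i) 1) else K (a i) 0 + K (a i) 1)) (E * 2 ^ (N - 1)) := by
    intro k
    have := hasSum_pi_prod (f := fun (i : Fin N) a => if i = k then binEnt (K a 0) (K a 1) else
      K a 0 + K a 1) (s := fun i => if i = k then E else 2) ?_ ?_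
    · rw [prod_ite_eq_erase k (fun _ => E), Finset.prod_const,
        Finset.card_erase_of_mem (Finset.mem_univ _), Finset.card_univ, Fintype.card_fin] at this
      exact this
    · intro i a
      split_ifs
      · exact binEnt_nonneg (hK.nonneg _ _) (hK.nonneg _ _)
      · exact add_nonneg (hK.nonneg _ _) (hK.nonneg _ _)
    · intro i
      split_ifs with h
      · exact hK.summable_binEnt.hasSum
      · exact hK.hasSum_add
  have h5 := (hasSum_sum (s := Finset.univ) fun k _ => h4 k).mul_left c
  have h6 := h2.unique (h5.congr_fun fun a => ?_)
  · rw [Finset.sum_const, Finset.card_univ, Fintype.card_fin, nsmul_eq_mul] at h6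
    rw [condEnt, ← hE, ← mul_div_assoc, eq_div_iff (by positivity), h6, hc]
    field_simp
  -- For fixed outputs both sides are the entropy of the whole word: the chain rule splits it over
  -- the letters of w, independence splits it over the coordinates of wM, and w ↦ wM is a bijection.
  · rw [← sum_negMulLog_prod fun k => K (a k), ← sum_vecMul hM, ← sum_vecMul hM fun x => ∏ k, K (a k) (x k),
      ← sum_binEnt_branchSum, Finset.mul_sum]
    refine Finset.sum_congr rfl fun j _ => ?_
    simp only [split]
    rw [Finset.mul_sum, Finset.mul_sum]
    refine Finset.sum_congr rfl fun v _ => ?_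
    rw [binEnt_mul, ← mul_assoc]

/-- The Gibbs inequality for the homogeneous binary entropy. -/
lemma binEnt_mul_le_of_gibbs {p₀ p₁ r₀ r₁ : ℝ} (hp₀ : 0 ≤ p₀) (hp₁ : 0 ≤ p₁) (hr₀ : 0 ≤ r₀)
    (hr₁ : 0 ≤ r₁) : binEnt (p₀ * r₀) (p₁ * r₁) ≤
      p₀ * (Real.log (p₀ + p₁) - Real.log p₀) * r₀ +
      p₁ * (Real.log (p₀ + p₁) - Real.log p₁) * r₁ := by
  have h := binEnt_mul_le hp₀ hp₁ hr₀ hr₁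
  have h1 : 0 ≤ p₀ * p₁ / (p₀ + p₁) * (r₀ + r₁ - 2 * √(r₀ * r₁)) :=
    mul_nonneg (mul_div_add_nonneg hp₀ hp₁) (by linarith [sqrt_mul_le_half_add hr₀ hr₁])
  linarith

/-- If two columns of `M` have their last nonzero entry in the same row `j`, then the `j`-th
channel is at least as good as two uses of `K`. -/
lemma IsKernel.condEnt_split_le (hK : IsKernel K) (j : Fin N) {a b : Fin N} (hab : a ≠ b)
    (ha : M j a = 1) (hb : M j b = 1) (ha0 : ∀ i, j < i → M i a = 0) (hb0 : ∀ i, j < i → M i b = 0) :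
    condEnt (split M j K) ≤
      condEnt K - (1 - bhatt K) * bhatt K ^ 2 / (2 * Real.log 2) := by
  have hl : 0 < Real.log 2 := Real.log_pos one_lt_two
  set c : ℝ := 1 / 2 ^ (N - 1) * (1 / 2 ^ (N - j.val)) with hc
  have hc0 : 0 ≤ c := by positivity
  set r : ℝ := 2 ^ (N - (j.val + 1)) with hr
  -- Columns a and b have no entry below row j, so there wM is a function σ of the prefix plus
  -- letter j: two uses of `K` with known shifts, whatever the later letters are.
  let σ : Fin N → (Fin N → ZMod 2) → ZMod 2 := fun k v => ∑ i with i < j, v i * M i k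
  have hσ : ∀ k, M j k = 1 → (∀ i, j < i → M i k = 0) → ∀ v w : Fin N → ZMod 2, ∀ β : ZMod 2,
      ((∀ i < j, w i = v i) ∧ w j = β) → Matrix.vecMul w M k = σ k v + β := by
    intro k h1 h0 v w β hw
    rw [Matrix.vecMul, dotProduct, ← Finset.sum_filter_add_sum_filter_not _ (fun i => i < j)]
    congr 1
    · refine Finset.sum_congr rfl fun i hi => ?_
      rw [hw.1 i (Finset.mem_filter.1 hi).2]
    · rw [Finset.sum_eq_single_of_mem j (by simp)]
      · rw [h1, hw.2, mul_one]
      · intro i hi hij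
        rw [h0 i (lt_of_le_of_ne (not_lt.1 (Finset.mem_filter.1 hi).2) hij.symm), mul_zero]
  let S : (Fin N → ZMod 2) → ZMod 2 → Finset (Fin N → ZMod 2) := fun v b =>
    Finset.univ.filter fun w : Fin N → ZMod 2 => (∀ i < j, w i = v i) ∧ w j = b
  let R : (Fin N → ZMod 2) → ZMod 2 → (Fin N → A) → ℝ := fun v β y =>
    ∑ w ∈ S v β, ∏ k with k ≠ a ∧ k ≠ b, K (y k) (Matrix.vecMul w M k)
  have hR0 : ∀ v β y, 0 ≤ R v β y := fun v β y =>
    Finset.sum_nonneg fun w _ => Finset.prod_nonneg fun k _ => hK.nonneg _ _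
  let L : (Fin N → ZMod 2) → A × A → ZMod 2 → ℝ := fun v =>
    pairing (shift (σ a v) K) (shift (σ b v) K)
  have hL : ∀ v, IsKernel (L v) := fun v => (hK.to_shift _).to_pairing (hK.to_shift _)
  have hB : ∀ v β y, branchSum (fun w => ∏ k, K (y k) (Matrix.vecMul w M k)) j v β =
      L v (y a, y b) β * R v β y := by
    intro v β y
    simp only [R, branchSum, Finset.mul_sum]
    refine Finset.sum_congr rfl fun w hw => ?_
    have hw' := (Finset.mem_filter.1 hw).2
    rw [← Finset.mul_prod_erase _ _ (Finset.mem_univ a),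
      ← Finset.mul_prod_erase _ _ (Finset.mem_erase.2 ⟨hab.symm, Finset.mem_univ b⟩), ← mul_assoc,
      hσ a ha ha0 v w β hw', hσ b hb hb0 v w β hw']
    refine congrArg₂ (· * ·) rfl (Finset.prod_congr ?_ fun _ _ => rfl)
    ext k
    simp only [Finset.mem_erase, Finset.mem_filter, Finset.mem_univ, true_and, and_comm]
  have n0 := fun v p => (hL v).nonneg p 0
  have n1 := fun v p => (hL v).nonneg p 1
  let g₀ : (Fin N → ZMod 2) → A × A → ℝ := fun v p =>
    L v p 0 * (Real.log (L v p 0 + L v p 1) - Real.log (L v p 0))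
  let g₁ : (Fin N → ZMod 2) → A × A → ℝ := fun v p =>
    L v p 1 * (Real.log (L v p 0 + L v p 1) - Real.log (L v p 1))
  have l0 : ∀ v p, 0 ≤ g₀ v p := fun v p => mul_log_sub_log_nonneg (n0 v p) (n1 v p)
  have l1 : ∀ v p, 0 ≤ g₁ v p := fun v p => by
    simp only [g₁]
    rw [add_comm]; exact mul_log_sub_log_nonneg (n1 v p) (n0 v p)
  have s0 : ∀ v, Summable (g₀ v) := fun v => (hL v).summable_binEnt.of_nonneg_of_le (l0 v)
    fun p => by rw [binEnt_eq]; exact le_add_of_nonneg_right (l1 v p)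
  have s1 : ∀ v, Summable (g₁ v) := fun v => (hL v).summable_binEnt.of_nonneg_of_le (l1 v)
    fun p => by rw [binEnt_eq]; exact le_add_of_nonneg_left (l0 v p)
  have hs : ∀ v, (∑' p, g₀ v p) + ∑' p, g₁ v p = condEnt (L v) * (2 * Real.log 2) := by
    intro v
    rw [condEnt, div_mul_cancel₀ _ (by positivity), ← (s0 v).tsum_add (s1 v)]
    simp only [binEnt_eq, g₀, g₁]
  have hgR : ∀ v β (g : A × A → ℝ), (∀ p, 0 ≤ g p) → Summable g →
      HasSum (fun y : Fin N → A => g (y a, y b) * R v β y) (r * ∑' p, g p) := by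
    intro v β g hg0 hg
    have := hasSum_sum (s := S v β) fun w _ => hasSum_pi_prod_of_two hab hg0 hg.hasSum
      (fun k x => hK.nonneg x (Matrix.vecMul w M k)) (fun k => hK.hasSum (Matrix.vecMul w M k))
    rw [Finset.sum_const, card_prefix_succ, nsmul_eq_mul] at this
    push_cast at this
    simpa only [R, Finset.mul_sum] using this
  have h1 := hasSum_prod_fintype fun v => ((hgR v 0 _ (l0 v) (s0 v)).add
    (hgR v 1 _ (l1 v) (s1 v))).mul_left c
  have h2 := hasSum_le (fun p => ?_) (hK.to_split M j).summable_binEnt.hasSum h1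
  · have h3 : ∀ v, condEnt (L v) ≤
        condEnt K - (1 - bhatt K) * bhatt K ^ 2 / (2 * Real.log 2) := by
      intro v
      have := (hK.to_shift (σ a v)).condEnt_pairing_le (hK.to_shift (σ b v))
      rw [condEnt_shift, bhatt_shift, bhatt_shift] at this
      exact le_sub_iff_add_le.2 this
    rw [condEnt, div_le_iff₀ (by positivity)]
    refine h2.trans ?_
    set D := condEnt K - (1 - bhatt K) * bhatt K ^ 2 / (2 * Real.log 2)
    calc _ ≤ ∑ v : Fin N → ZMod 2, c * (r * (D * (2 * Real.log 2))) := by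
          refine Finset.sum_le_sum fun v _ => mul_le_mul_of_nonneg_left ?_ hc0
          rw [← mul_add, hs v]
          exact mul_le_mul_of_nonneg_left (mul_le_mul_of_nonneg_right (h3 v) (by positivity))
            (by positivity)
      _ = c * (2 ^ N * r) * (D * (2 * Real.log 2)) := by
          rw [Finset.sum_const, Finset.card_univ, Fintype.card_fun, ZMod.card, Fintype.card_fin,
            nsmul_eq_mul]
          push_cast
          ring
      _ = _ := by rw [hc, hr, splitCoef_mul, one_mul]
  -- Gibbs' inequality discards the outputs other than a and b, which can only help; they enter
  -- through the factor R, which `hgR` has summed out.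
  · simp only [split]
    rw [← hc, binEnt_mul, hB, hB]
    exact mul_le_mul_of_nonneg_left
      (binEnt_mul_le_of_gibbs (n0 _ _) (n1 _ _) (hR0 _ _ _) (hR0 _ _ _)) hc0

/-- An invertible matrix that no permutation of columns makes upper triangular has two columns
with their last nonzero entries in the same row. -/
lemma exists_last_entries_eq (hM : IsUnit M.det)
    (hpol : ∀ σ : Equiv.Perm (Fin N), ¬ (M.submatrix id σ).BlockTriangular id) :
    ∃ j a b : Fin N, a ≠ b ∧ M j a = 1 ∧ M j b = 1 ∧ (∀ i, j < i → M i a = 0) ∧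
      ∀ i, j < i → M i b = 0 := by
  have hcol : ∀ a, ∃ i, M i a = 1 ∧ ∀ i', i < i' → M i' a = 0 := by
    intro a
    have hne : (Finset.univ.filter fun i => M i a = 1).Nonempty := by
      by_contra h
      rw [Finset.not_nonempty_iff_eq_empty, Finset.filter_eq_empty_iff] at h
      have h0 : ∀ i, M i a = 0 := fun i => (zmod_two_eq _).resolve_right (h (Finset.mem_univ i))
      rw [Matrix.det_eq_zero_of_column_eq_zero a h0] at hM
      exact not_isUnit_zero hM
    refine ⟨_, (Finset.mem_filter.1 (Finset.max'_mem _ hne)).2, fun i' hi' => ?_⟩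
    refine (zmod_two_eq _).resolve_right fun h1 => ?_
    exact absurd (Finset.le_max' (Finset.univ.filter fun i => M i a = 1) i' (by simp [h1]))
      (not_le.2 hi')
  choose l hl1 hl0 using hcol
  by_contra hcon
  push Not at hcon
  have hinj : Function.Injective l := by
    intro a b h
    by_contra hab
    obtain ⟨i, hi, hne⟩ := hcon (l a) a b hab (hl1 a) (h ▸ hl1 b) (hl0 a)
    exact hne (hl0 b i (h ▸ hi))
  -- With distinct last rows l is a permutation, and ordering the columns by last row makes M upper
  -- triangular.
  let e := Equiv.ofBijective l (Finite.injective_iff_bijective.1 hinj)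
  refine hpol e.symm fun i k hik => ?_
  refine hl0 (e.symm k) i ?_
  have : l (e.symm k) = k := e.apply_symm_apply k
  rw [this]
  exact hik

end Conservation

end

end PolarCode

/-! ### Recursive structure of the polar transform. -/

namespace PolarCode

noncomputable section

section Recursion

variable {A : Type*} {ℓ : ℕ} {K : A → ZMod 2 → ℝ} (G : Matrix (Fin ℓ) (Fin ℓ) (ZMod 2)) (n : ℕ)

lemma innerIdx_val (m : Fin (ℓ ^ n)) (j : Fin ℓ) : (innerIdx ℓ n (m, j)).val = j + ℓ * m := rfl

lemma innerIdx_lt_iff (m m' : Fin (ℓ ^ n)) (j j' : Fin ℓ) :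
    innerIdx ℓ n (m', j') < innerIdx ℓ n (m, j) ↔ m' < m ∨ m' = m ∧ j' < j := by
  rw [Fin.lt_def, innerIdx_val, innerIdx_val, Fin.lt_def, Fin.lt_def, Fin.ext_iff]
  have h1 := j.2
  have h2 := j'.2
  constructor
  · intro h
    rcases lt_trichotomy m'.val m.val with h3 | h3 | h3
    · exact Or.inl h3
    · rw [h3] at h; exact Or.inr ⟨h3, by omega⟩
    · have := Nat.mul_le_mul_left ℓ (Nat.succ_le_of_lt h3)
      rw [Nat.mul_succ] at this
      omega
  · rintro (h | ⟨h3, h⟩)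
    · have := Nat.mul_le_mul_left ℓ (Nat.succ_le_of_lt h)
      rw [Nat.mul_succ] at this
      omega
    · rw [h3]; omega

variable {n}

/-- The `m`-th block of length `ℓ` of `u`. -/
def block {B : Type*} (u : Fin (ℓ ^ (n + 1)) → B) (m : Fin (ℓ ^ n)) : Fin ℓ → B :=
  fun j => u (innerIdx ℓ n (m, j))

/-- The inputs to the `ℓ` copies of the transform of depth `n`. -/
def innerWord (u : Fin (ℓ ^ (n + 1)) → ZMod 2) (k : Fin ℓ) : Fin (ℓ ^ n) → ZMod 2 :=
  fun m => Matrix.vecMul (block u m) G k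

lemma vecMul_reindex_inner (u : Fin (ℓ ^ (n + 1)) → ZMod 2) (m : Fin (ℓ ^ n)) (k : Fin ℓ) :
    Matrix.vecMul u (Matrix.reindex (innerIdx ℓ n) (innerIdx ℓ n)
      ((1 : Matrix (Fin (ℓ ^ n)) (Fin (ℓ ^ n)) (ZMod 2)) ⊗ₖ G)) (innerIdx ℓ n (m, k)) =
      innerWord G u k m := by
  rw [Matrix.vecMul, dotProduct, ← (innerIdx ℓ n).sum_comp, Fintype.sum_prod_type]
  simp [Matrix.one_apply, innerWord, Matrix.vecMul, dotProduct, block]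

lemma vecMul_shuffle (x : Fin (ℓ ^ (n + 1)) → ZMod 2) (m : Fin (ℓ ^ n)) (k : Fin ℓ) :
    Matrix.vecMul x (shuffleMatrix ℓ n) (outerIdx ℓ n (k, m)) = x (innerIdx ℓ n (m, k)) := by
  rw [Matrix.vecMul, dotProduct, ← (innerIdx ℓ n).sum_comp,
    Finset.sum_eq_single_of_mem (m, k) (Finset.mem_univ _)]
  · simp [shuffleMatrix]
  · rintro ⟨m', k'⟩ - hne
    simp only [shuffleMatrix, Matrix.of_apply, Equiv.symm_apply_apply, Prod.swap_prod_mk,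
      Prod.mk.injEq]
    rw [if_neg, mul_zero]
    rintro ⟨rfl, rfl⟩
    exact hne rfl

lemma vecMul_reindex_outer (z : Fin (ℓ ^ (n + 1)) → ZMod 2)
    (M : Matrix (Fin (ℓ ^ n)) (Fin (ℓ ^ n)) (ZMod 2)) (k : Fin ℓ) (t : Fin (ℓ ^ n)) :
    Matrix.vecMul z (Matrix.reindex (outerIdx ℓ n) (outerIdx ℓ n)
      ((1 : Matrix (Fin ℓ) (Fin ℓ) (ZMod 2)) ⊗ₖ M)) (outerIdx ℓ n (k, t)) =
      Matrix.vecMul (fun m => z (outerIdx ℓ n (k, m))) M t := by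
  rw [Matrix.vecMul, dotProduct, ← (outerIdx ℓ n).sum_comp, Fintype.sum_prod_type]
  simp only [Matrix.reindex_apply, Matrix.submatrix_apply, Equiv.symm_apply_apply,
    Matrix.kroneckerMap_apply, Matrix.one_apply]
  rw [Finset.sum_eq_single_of_mem k (Finset.mem_univ _)]
  · simp [Matrix.vecMul, dotProduct]
  · intro k' _ hk
    simp [hk]

/-- The shuffle sends output k of every block of length ℓ to copy k, so depth n + 1 is ℓ parallel
encoders of depth n fed by `innerWord`. -/
lemma vecMul_polarMatrix_succ (u : Fin (ℓ ^ (n + 1)) → ZMod 2) (k : Fin ℓ) (t : Fin (ℓ ^ n)) :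
    Matrix.vecMul u (polarMatrix G (n + 1)) (outerIdx ℓ n (k, t)) =
      Matrix.vecMul (innerWord G u k) (polarMatrix G n) t := by
  rw [polarMatrix, ← Matrix.vecMul_vecMul, ← Matrix.vecMul_vecMul, vecMul_reindex_outer]
  simp only [vecMul_shuffle, vecMul_reindex_inner]

variable {G}

/-- Words of length `ℓ ^ (n + 1)` correspond to the inputs of the `ℓ` copies. -/
def innerWordEquiv (hG : IsUnit G.det) (n : ℕ) :
    (Fin (ℓ ^ (n + 1)) → ZMod 2) ≃ (Fin ℓ → Fin (ℓ ^ n) → ZMod 2) :=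
  (((innerIdx ℓ n).symm.arrowCongr (Equiv.refl (ZMod 2))).trans (Equiv.curry _ _ _)).trans
    ((Equiv.piCongrRight fun _ => Equiv.ofBijective _ (vecMul_bijective hG)).trans
      (Equiv.piComm _))

lemma innerWordEquiv_apply (hG : IsUnit G.det) (u : Fin (ℓ ^ (n + 1)) → ZMod 2) (k : Fin ℓ) :
    innerWordEquiv hG n u k = innerWord G u k := rfl

lemma innerWord_eq_iff (hG : IsUnit G.det) (u : Fin (ℓ ^ (n + 1)) → ZMod 2) (m : Fin (ℓ ^ n))
    (w : Fin ℓ → ZMod 2) :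
    (∀ k, innerWord G u k m = Matrix.vecMul w G k) ↔ w = block u m := by
  constructor
  · intro h
    exact (vecMul_bijective hG).1 (funext fun k => (h k).symm)
  · rintro rfl k
    rfl

/-- Splits a word over the `ℓ` copies. -/
def outerEquiv (B : Type*) (ℓ n : ℕ) : (Fin (ℓ ^ (n + 1)) → B) ≃ (Fin ℓ → Fin (ℓ ^ n) → B) :=
  ((outerIdx ℓ n).symm.arrowCongr (Equiv.refl B)).trans (Equiv.curry _ _ _)

lemma outerEquiv_apply {B : Type*} (y : Fin (ℓ ^ (n + 1)) → B) (k : Fin ℓ) (t : Fin (ℓ ^ n)) :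
    outerEquiv B ℓ n y k t = y (outerIdx ℓ n (k, t)) := rfl

lemma prod_ite_zero_of_iff {ι : Type*} [Fintype ι] {p : ι → Prop} [DecidablePred p] {q : Prop}
    [Decidable q] (h : (∀ i, p i) ↔ q) (f : ι → ℝ) :
    ∏ i, (if p i then f i else 0) = if q then ∏ i, f i else 0 := by
  split_ifs with hq
  · exact Finset.prod_congr rfl fun i _ => if_pos (h.2 hq i)
  · obtain ⟨i, hi⟩ := not_forall.1 fun h' => hq (h.1 h')
    exact Finset.prod_eq_zero (Finset.mem_univ i) (if_neg hi)

/-- Indices (m, j) are ordered lexicographically, so deciding letter j of block m first uses the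
blocks before m in all copies, then the letters before j. Two words `u`, `u'` occur because the
iterated split lists block m separately from the inner words; only the blocks before m need agree.
-/
lemma branchSum_polar_succ (hG : IsUnit G.det) (y : Fin (ℓ ^ (n + 1)) → A) (m : Fin (ℓ ^ n))
    (j : Fin ℓ) (u u' : Fin (ℓ ^ (n + 1)) → ZMod 2) (b : ZMod 2)
    (hu : ∀ m' < m, block u' m' = block u m') :
    branchSum (fun w => ∏ k, branchSum (fun x => ∏ t, K (outerEquiv A ℓ n y k t)
        (Matrix.vecMul x (polarMatrix G n) t)) m (innerWord G u k) (Matrix.vecMul w G k))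
        j (block u' m) b =
      branchSum (fun w => ∏ t, K (y t) (Matrix.vecMul w (polarMatrix G (n + 1)) t))
        (innerIdx ℓ n (m, j)) u' b := by
  set p : Fin ℓ → (Fin (ℓ ^ n) → ZMod 2) → ℝ := fun k x => ∏ t, K (outerEquiv A ℓ n y k t)
    (Matrix.vecMul x (polarMatrix G n) t) with hp
  have hprod : ∀ w, ∏ t, K (y t) (Matrix.vecMul w (polarMatrix G (n + 1)) t) =
      ∏ k, p k (innerWord G w k) := by
    intro w
    rw [← (outerIdx ℓ n).prod_comp, Fintype.prod_prod_type]
    simp only [vecMul_polarMatrix_succ, hp, outerEquiv_apply]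
  have h1 : ∀ w : Fin ℓ → ZMod 2, ∏ k, branchSum (p k) m (innerWord G u k) (Matrix.vecMul w G k) =
      ∑ z : Fin (ℓ ^ (n + 1)) → ZMod 2, if (∀ m' < m, block z m' = block u m') ∧ w = block z m
        then ∏ k, p k (innerWord G z k) else 0 := by
    intro w
    simp only [branchSum, Finset.sum_filter]
    rw [Fintype.prod_sum, ← (innerWordEquiv hG n).sum_comp]
    refine Finset.sum_congr rfl fun z _ => ?_
    refine prod_ite_zero_of_iff ?_ _
    simp only [innerWordEquiv_apply]
    rw [← innerWord_eq_iff hG z m w, forall_and]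
    refine and_congr ?_ Iff.rfl
    constructor
    · intro h m' hm'
      exact ((innerWord_eq_iff hG z m' (block u m')).1 fun k => h k m' hm').symm
    · intro h k m' hm'
      exact (innerWord_eq_iff hG z m' (block u m')).2 (h m' hm').symm k
  change branchSum (fun w => ∏ k, branchSum (p k) m (innerWord G u k) (Matrix.vecMul w G k))
    j (block u' m) b = _
  simp only [h1, hprod]
  rw [branchSum, Finset.sum_comm, branchSum, Finset.sum_filter]
  refine Finset.sum_congr rfl fun z _ => ?_
  rw [Finset.sum_filter]
  simp only [← ite_and]
  have h2 : ∀ w : Fin ℓ → ZMod 2, (((∀ i < j, w i = block u' m i) ∧ w j = b) ∧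
      (∀ m' < m, block z m' = block u m') ∧ w = block z m) ↔
      w = block z m ∧ ((∀ i < innerIdx ℓ n (m, j), z i = u' i) ∧ z (innerIdx ℓ n (m, j)) = b) := by
    intro w
    have h3 : (∀ i < innerIdx ℓ n (m, j), z i = u' i) ↔
        (∀ i < j, block z m i = block u' m i) ∧ ∀ m' < m, block z m' = block u m' := by
      constructor
      · intro h
        refine ⟨fun i hi => h _ ((innerIdx_lt_iff n _ _ _ _).2 (Or.inr ⟨rfl, hi⟩)),
          fun m' hm' => ?_⟩
        rw [← hu m' hm']
        exact funext fun i => h _ ((innerIdx_lt_iff n _ _ _ _).2 (Or.inl hm'))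
      · rintro ⟨ha, hb⟩ i hi
        obtain ⟨⟨m', j'⟩, rfl⟩ := (innerIdx ℓ n).surjective i
        rcases (innerIdx_lt_iff n _ _ _ _).1 hi with hm' | ⟨rfl, hj'⟩
        · exact congrFun ((hb m' hm').trans (hu m' hm').symm) j'
        · exact ha j' hj'
    rw [h3]
    constructor
    · rintro ⟨⟨ha, hb⟩, hc, rfl⟩
      exact ⟨rfl, ⟨ha, hc⟩, hb⟩
    · rintro ⟨rfl, ⟨ha, hc⟩, hb⟩
      exact ⟨⟨ha, hb⟩, hc, rfl⟩
  simp only [h2, ite_and]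
  simp

lemma splitCoef_succ_exponent {N m j : ℕ} (hj : j < ℓ) (hm : m < N) :
    ℓ - 1 + (ℓ - j) + (N - 1 + (N - m)) * ℓ = ℓ + (N * ℓ - 1 + (N * ℓ - (j + ℓ * m))) := by
  obtain ⟨a, rfl⟩ := Nat.exists_eq_add_of_lt hj
  obtain ⟨b, rfl⟩ := Nat.exists_eq_add_of_lt hm
  have h1 : m + b + 1 - 1 + (m + b + 1 - m) = m + b + (b + 1) := by omega
  have h2 : (m + b + 1) * (j + a + 1) =
      (j + a + 1) * m + ((j + a + 1) * b + (j + a + 1)) := by ring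
  have h3 : (m + b + (b + 1)) * (j + a + 1) =
      (j + a + 1) * m + ((j + a + 1) * b + ((j + a + 1) * b + (j + a + 1))) := by ring
  rw [h1, h2, h3]
  omega

lemma splitCoef_succ (m : Fin (ℓ ^ n)) (j : Fin ℓ) :
    (1 : ℝ) / 2 ^ (ℓ - 1) * (1 / 2 ^ (ℓ - j.val)) *
      (1 / 2 ^ (ℓ ^ n - 1) * (1 / 2 ^ (ℓ ^ n - m.val))) ^ ℓ =
    1 / 2 ^ ℓ * (1 / 2 ^ (ℓ ^ (n + 1) - 1) *
      (1 / 2 ^ (ℓ ^ (n + 1) - (innerIdx ℓ n (m, j)).val))) := by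
  simp only [← one_div_pow, ← pow_add, ← pow_mul]
  rw [splitCoef_succ_exponent j.2 m.2, innerIdx_val, pow_succ]

lemma branchSum_const_mul {N : ℕ} (c : ℝ) (p : (Fin N → ZMod 2) → ℝ) (j : Fin N)
    (v : Fin N → ZMod 2) (b : ZMod 2) :
    branchSum (fun w => c * p w) j v b = c * branchSum p j v b :=
  (Finset.mul_sum _ _ _).symm

/-- The factor 1/2^ℓ is due to the iterated split listing an additional word of ℓ letters in its
output. -/
lemma split_split_eq (hG : IsUnit G.det) (y : Fin (ℓ ^ (n + 1)) → A) (m : Fin (ℓ ^ n))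
    (j : Fin ℓ) (u u' : Fin (ℓ ^ (n + 1)) → ZMod 2) (b : ZMod 2)
    (hu : ∀ m' < m, block u' m' = block u m') :
    split G j (split (polarMatrix G n) m K)
        (fun k => (outerEquiv A ℓ n y k, innerWord G u k), block u' m) b =
      1 / 2 ^ ℓ * split (polarMatrix G (n + 1)) (innerIdx ℓ n (m, j)) K (y, u') b := by
  simp only [split]
  rw [← branchSum_polar_succ hG y m j u u' b hu]
  have h : ∀ (c : ℝ) (f : Fin ℓ → ℝ), ∏ k, c * f k = c ^ ℓ * ∏ k, f k := fun c f => by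
    rw [Finset.prod_mul_distrib, Finset.prod_const, Finset.card_univ, Fintype.card_fin]
  simp only [h, branchSum_const_mul]
  rw [← mul_assoc, ← mul_assoc, splitCoef_succ]

/-- Splitting at depth `n + 1` amounts to splitting at depth `n` and then once more. -/
lemma hasSum_split_succ (hG : IsUnit G.det) (m : Fin (ℓ ^ n)) (j : Fin ℓ) {φ : ℝ → ℝ → ℝ}
    (hφ : ∀ c a b, 0 ≤ c → φ (c * a) (c * b) = c * φ a b) {S : ℝ}
    (h : HasSum (fun p => φ (split (polarMatrix G (n + 1)) (innerIdx ℓ n (m, j)) K p 0)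
      (split (polarMatrix G (n + 1)) (innerIdx ℓ n (m, j)) K p 1)) S) :
    HasSum (fun p => φ (split G j (split (polarMatrix G n) m K) p 0)
      (split G j (split (polarMatrix G n) m K) p 1)) S := by
  let e1 : (Fin (ℓ ^ (n + 1)) → A) × (Fin (ℓ ^ (n + 1)) → ZMod 2) ≃
      (Fin ℓ → (Fin (ℓ ^ n) → A) × (Fin (ℓ ^ n) → ZMod 2)) :=
    ((outerEquiv A ℓ n).prodCongr (innerWordEquiv hG n)).trans
      (Equiv.arrowProdEquivProdArrow _ _ _).symm
  -- The additional word is translated by block m of u, so that it becomes the difference between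
  -- the two versions of that block; δ v writes this difference into block m. The sum for a fixed v
  -- is then a translate of the given one, and the 2^ℓ values of v cancel the factor.
  let e := e1.prodShear fun p => Equiv.addLeft (block p.2 m)
  rw [← e.hasSum_iff]
  let δ : (Fin ℓ → ZMod 2) → Fin (ℓ ^ (n + 1)) → ZMod 2 := fun v i =>
    if ((innerIdx ℓ n).symm i).1 = m then v ((innerIdx ℓ n).symm i).2 else 0
  have h1 : ∀ v, HasSum (fun p : (Fin (ℓ ^ (n + 1)) → A) × (Fin (ℓ ^ (n + 1)) → ZMod 2) =>
      1 / 2 ^ ℓ * φ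
        (split (polarMatrix G (n + 1)) (innerIdx ℓ n (m, j)) K (p.1, p.2 + δ v) 0)
        (split (polarMatrix G (n + 1)) (innerIdx ℓ n (m, j)) K (p.1, p.2 + δ v) 1))
      (1 / 2 ^ ℓ * S) := fun v =>
    (((Equiv.refl _).prodCongr (Equiv.addRight (δ v))).hasSum_iff.2 h).mul_left _
  have h2 := hasSum_prod_fintype h1
  rw [Finset.sum_const, Finset.card_univ, Fintype.card_fun, ZMod.card, Fintype.card_fin,
    nsmul_eq_mul, ← mul_assoc] at h2
  push_cast at h2
  rw [mul_one_div_cancel (by positivity), one_mul] at h2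
  refine h2.congr_fun ?_
  rintro ⟨⟨y, u⟩, v⟩
  have hb : ∀ m', block (u + δ v) m' = block u m' + if m' = m then v else 0 := by
    intro m'
    funext i
    simp only [block, Pi.add_apply, δ, Equiv.symm_apply_apply]
    split_ifs <;> rfl
  have he : e ((y, u), v) =
      (fun k => (outerEquiv A ℓ n y k, innerWord G u k), block (u + δ v) m) := by
    rw [hb, if_pos rfl]
    rfl
  have hlt : ∀ m' < m, block (u + δ v) m' = block u m' := fun m' hm' => by
    rw [hb, if_neg hm'.ne, add_zero]
  simp only [Function.comp, he, split_split_eq hG y m j u (u + δ v) _ hlt]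
  exact hφ _ _ _ (by positivity)

lemma IsKernel.bhatt_split_succ (hK : IsKernel K) (hG : IsUnit G.det) (m : Fin (ℓ ^ n))
    (j : Fin ℓ) : bhatt (split (polarMatrix G (n + 1)) (innerIdx ℓ n (m, j)) K) =
      bhatt (split G j (split (polarMatrix G n) m K)) :=
  (hasSum_split_succ hG m j (φ := fun a b => √(a * b)) (fun _ _ _ hc => sqrt_mul_mul_mul hc)
    (hK.to_split _ _).summable_bhatt.hasSum).tsum_eq.symm

lemma IsKernel.condEnt_split_succ (hK : IsKernel K) (hG : IsUnit G.det) (m : Fin (ℓ ^ n))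
    (j : Fin ℓ) : condEnt (split (polarMatrix G (n + 1)) (innerIdx ℓ n (m, j)) K) =
      condEnt (split G j (split (polarMatrix G n) m K)) := by
  rw [condEnt, condEnt]
  congr 1
  exact (hasSum_split_succ hG m j (φ := binEnt) (fun _ _ _ _ => binEnt_mul _ _)
    (hK.to_split _ _).summable_binEnt.hasSum).tsum_eq.symm

end Recursion

end

end PolarCode

/-! ### Error probability of the successive cancellation decoder. -/

namespace PolarCode

noncomputable section

/-- Sequential decisions, each made with total probability one, have total probability one. -/
lemma sum_prod_sequential {N : ℕ} (s : Fin N → (Fin N → ZMod 2) → ℝ)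
    (hdep : ∀ i v v', (∀ k ≤ i, v k = v' k) → s i v = s i v')
    (hsum : ∀ i v, s i (Function.update v i 0) + s i (Function.update v i 1) = 1) :
    ∑ v, ∏ i, s i v = 1 := by
  induction N with
  | zero => simp
  | succ N ih =>
    rw [← (Fin.consEquiv fun _ => ZMod 2).sum_comp, Fintype.sum_prod_type]
    have h : ∀ b : ZMod 2, ∑ v : Fin N → ZMod 2, ∏ i, s i (Fin.consEquiv (fun _ => ZMod 2) (b, v)) =
        s 0 (Fin.cons b 0) := by
      intro b
      have h0 : ∀ v : Fin N → ZMod 2, ∏ i, s i (Fin.consEquiv (fun _ => ZMod 2) (b, v)) =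
          s 0 (Fin.cons b 0) * ∏ i : Fin N, s i.succ (Fin.cons b v) := by
        intro v
        rw [Fin.prod_univ_succ]
        congr 1
        refine hdep 0 _ _ fun k hk => ?_
        rw [Fin.le_zero_iff.1 hk]
        rfl
      simp only [h0]
      rw [← Finset.mul_sum, ih, mul_one]
      · intro i v v' hv
        refine hdep _ _ _ fun k hk => ?_
        refine Fin.cases ?_ (fun k hk => ?_) k hk
        · intro; rfl
        · simpa using hv k (Fin.succ_le_succ_iff.1 hk)
      · intro i v
        rw [Fin.cons_update, Fin.cons_update]
        exact hsum _ _
    simp only [h]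
    rw [sum_zmod_two]
    have := hsum 0 (Fin.cons 0 0)
    rwa [Fin.update_cons_zero, Fin.update_cons_zero] at this

section Decoder

variable {Y : Type*} (W : BDMC Y) {ℓ : ℕ} (G : Matrix (Fin ℓ) (Fin ℓ) (ZMod 2)) (n : ℕ)

lemma subchannelProb_eq (i : Fin (ℓ ^ n)) (y : Fin (ℓ ^ n) → Y) (v : Fin (ℓ ^ n) → ZMod 2)
    (b : ZMod 2) : subchannelProb W G n i y v b = 1 / 2 ^ (ℓ ^ n - 1) *
      branchSum (fun u => W.blockProb y (Matrix.vecMul u (polarMatrix G n))) i v b := rfl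

lemma branchSum_congr {N : ℕ} (p : (Fin N → ZMod 2) → ℝ) {i : Fin N} {v v' : Fin N → ZMod 2}
    (h : ∀ k < i, v k = v' k) (b : ZMod 2) : branchSum p i v b = branchSum p i v' b := by
  simp only [branchSum]
  refine Finset.sum_congr (Finset.filter_congr fun w _ => ?_) fun _ _ => rfl
  refine and_congr_left fun _ => ?_
  exact forall₂_congr fun k hk => by rw [h k hk]

variable (F : Finset (Fin (ℓ ^ n))) (u : Fin (ℓ ^ n) → ZMod 2) (y : Fin (ℓ ^ n) → Y)

lemma scStep_congr {i : Fin (ℓ ^ n)} {u u' v v' : Fin (ℓ ^ n) → ZMod 2} (hu : u i = u' i)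
    (h : ∀ k ≤ i, v k = v' k) : scStep W G n F u y v i = scStep W G n F u' y v' i := by
  have hb : ∀ b, subchannelProb W G n i y v b = subchannelProb W G n i y v' b := fun b => by
    rw [subchannelProb_eq, subchannelProb_eq, branchSum_congr _ (fun k hk => h k hk.le)]
  simp only [scStep, hb, h i le_rfl, hu]

lemma scStep_update_add (v : Fin (ℓ ^ n) → ZMod 2) (i : Fin (ℓ ^ n)) :
    scStep W G n F u y (Function.update v i 0) i + scStep W G n F u y (Function.update v i 1) i =
      1 := by
  have hb : ∀ b c, subchannelProb W G n i y (Function.update v i c) b =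
      subchannelProb W G n i y v b := fun b c => by
    rw [subchannelProb_eq, subchannelProb_eq,
      branchSum_congr _ (fun k hk => Function.update_of_ne hk.ne _ _)]
  have h11 : (1 + 1 : ZMod 2) = 0 := by decide
  have h10 : (1 : ZMod 2) ≠ 0 := by decide
  simp only [scStep, hb, Function.update_self, zero_add, h11]
  by_cases hi : i ∈ F
  · rcases zmod_two_eq (u i) with h | h <;> simp [hi, h]
  · simp only [hi, if_false]
    rcases lt_trichotomy (subchannelProb W G n i y v 0) (subchannelProb W G n i y v 1) with h | h | h
    · simp [h, h.not_gt, h.ne']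
    · simp [h]; norm_num
    · simp [h, h.not_gt, h.ne']

lemma scStep_nonneg (v : Fin (ℓ ^ n) → ZMod 2) (i : Fin (ℓ ^ n)) :
    0 ≤ scStep W G n F u y v i := by
  simp only [scStep]; split_ifs <;> norm_num

lemma scStep_le_one (v : Fin (ℓ ^ n) → ZMod 2) (i : Fin (ℓ ^ n)) :
    scStep W G n F u y v i ≤ 1 := by
  simp only [scStep]; split_ifs <;> norm_num

lemma scStep_of_mem {i : Fin (ℓ ^ n)} (hi : i ∈ F) : scStep W G n F u y u i = 1 := by
  simp [scStep, hi]

lemma scLaw_nonneg (v : Fin (ℓ ^ n) → ZMod 2) : 0 ≤ scLaw W G n F u y v :=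
  Finset.prod_nonneg fun _ _ => scStep_nonneg _ _ _ _ _ _ _ _

/-- The probability of being right is a product of steps taken after the true prefix, so error
propagation never has to be considered. -/
lemma sum_scLaw_ne : ∑ v : Fin (ℓ ^ n) → ZMod 2 with v ≠ u, scLaw W G n F u y v =
    1 - scLaw W G n F u y u := by
  have h := sum_prod_sequential (fun i v => scStep W G n F u y v i)
    (fun i v v' h => scStep_congr W G n F y rfl h) fun i v => scStep_update_add W G n F u y v i
  change ∑ v, scLaw W G n F u y v = 1 at h
  rw [← h, ← Finset.sum_filter_add_sum_filter_not Finset.univ (fun v => v ≠ u)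
    (fun v => scLaw W G n F u y v)]
  simp [Finset.filter_eq']

lemma one_sub_prod_le {ι : Type*} (s : Finset ι) {f : ι → ℝ} (h0 : ∀ i, 0 ≤ f i)
    (h1 : ∀ i, f i ≤ 1) : 1 - ∏ i ∈ s, f i ≤ ∑ i ∈ s, (1 - f i) := by
  classical
  induction s using Finset.induction_on with
  | empty => simp
  | insert a s ha ih =>
    rw [Finset.prod_insert ha, Finset.sum_insert ha]
    have h2 : ∏ i ∈ s, f i ≤ 1 := Finset.prod_le_one (fun i _ => h0 i) fun i _ => h1 i
    have h3 : 0 ≤ ∏ i ∈ s, f i := Finset.prod_nonneg fun i _ => h0 i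
    nlinarith [h0 a, h1 a]

/-- The word `y` contributes the minimum of the two likelihoods to the probability of a wrong
decision about an information bit, all earlier decisions being right. -/
lemma sum_mul_one_sub_scStep {i : Fin (ℓ ^ n)} (hi : i ∉ F) :
    ∑ u : Fin (ℓ ^ n) → ZMod 2, 1 / 2 ^ (ℓ ^ n) *
      (W.blockProb y (Matrix.vecMul u (polarMatrix G n)) * (1 - scStep W G n F u y u i)) =
    1 / 2 * ∑ v, min (split (polarMatrix G n) i W.prob (y, v) 0)
      (split (polarMatrix G n) i W.prob (y, v) 1) := by
  set p : (Fin (ℓ ^ n) → ZMod 2) → ℝ := fun u =>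
    W.blockProb y (Matrix.vecMul u (polarMatrix G n)) with hp
  set e : (Fin (ℓ ^ n) → ZMod 2) → ℝ := fun u => 1 - scStep W G n F u y u i with he
  have h1 : ∑ v, prefixSum (fun u => p u * e u) i v = 2 ^ (ℓ ^ n - i.val) * ∑ u, p u * e u :=
    sum_sum_prefix i.val i.2.le fun u => p u * e u
  have h2 : ∀ v, prefixSum (fun u => p u * e u) i v =
      min (branchSum p i v 0) (branchSum p i v 1) := by
    intro v
    have h3 : ∀ b, branchSum (fun u => p u * e u) i v b =
        branchSum p i v b * e (Function.update v i b) := by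
      intro b
      rw [branchSum, branchSum, Finset.sum_mul]
      refine Finset.sum_congr rfl fun w hw => ?_
      have hw' := (prefix_succ_iff i v w b).1 (Finset.mem_filter.1 hw).2
      simp only [he]
      rw [scStep_congr W G n F y (hw' i (Nat.lt_succ_self _))
        (fun k hk => hw' k (Nat.lt_succ_of_le hk))]
    rw [← branchSum_add, h3, h3]
    have hb : ∀ b c, subchannelProb W G n i y (Function.update v i c) b =
        1 / 2 ^ (ℓ ^ n - 1) * branchSum p i v b := fun b c => by
      rw [subchannelProb_eq, branchSum_congr _ (fun k hk => Function.update_of_ne hk.ne _ _)]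
    have h11 : (1 + 1 : ZMod 2) = 0 := by decide
    have hc : (0 : ℝ) < 1 / 2 ^ (ℓ ^ n - 1) := by positivity
    simp only [he, scStep, hi, if_false, hb, Function.update_self, zero_add, h11,
      mul_lt_mul_iff_right₀ hc, mul_right_inj' hc.ne']
    -- The likelihood of the rejected bit is lost, which is the smaller one; in a tie, half of each
    -- is lost.
    rcases lt_trichotomy (branchSum p i v 0) (branchSum p i v 1) with h | h | h
    · simp [h, h.not_gt, h.ne', h.le]
    · simp [h]; ring
    · simp [h, h.not_gt, h.ne', h.le]
  have h4 : ∀ v, min (split (polarMatrix G n) i W.prob (y, v) 0)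
      (split (polarMatrix G n) i W.prob (y, v) 1) =
      1 / 2 ^ (ℓ ^ n - 1) * (1 / 2 ^ (ℓ ^ n - i.val)) *
        min (branchSum p i v 0) (branchSum p i v 1) := fun v =>
    (mul_min_of_nonneg _ _ (by positivity)).symm
  simp only [h4, ← h2]
  rw [← Finset.mul_sum, ← Finset.mul_sum]
  rw [h1]
  have h5 : (2 : ℝ) ^ (ℓ ^ n) = 2 ^ (ℓ ^ n - 1) * 2 := by
    rw [← pow_succ]; congr 1; have := i.2; omega
  rw [h5]
  change _ * ∑ u, p u * e u = _
  field_simp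

variable {F}

lemma summable_mul_of_le_one {A : Type*} {f g : A → ℝ} (hf : Summable f) (hf0 : ∀ a, 0 ≤ f a)
    (hg0 : ∀ a, 0 ≤ g a) (hg1 : ∀ a, g a ≤ 1) : Summable fun a => f a * g a :=
  hf.of_nonneg_of_le (fun a => mul_nonneg (hf0 a) (hg0 a))
    fun a => mul_le_of_le_one_right (hf0 a) (hg1 a)

lemma hasSum_one_sub_scStep {i : Fin (ℓ ^ n)} (hi : i ∉ F) :
    HasSum (fun y => ∑ u : Fin (ℓ ^ n) → ZMod 2, 1 / 2 ^ (ℓ ^ n) *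
      (W.blockProb y (Matrix.vecMul u (polarMatrix G n)) * (1 - scStep W G n F u y u i)))
      (1 / 2 * ∑' p, min (split (polarMatrix G n) i W.prob p 0)
        (split (polarMatrix G n) i W.prob p 1)) := by
  have hs := ((isKernel_prob W).to_split (polarMatrix G n) i).summable_min
  have h1 : ∀ v, Summable fun y => min (split (polarMatrix G n) i W.prob (y, v) 0)
      (split (polarMatrix G n) i W.prob (y, v) 1) := fun v =>
    hs.comp_injective (i := fun y => (y, v)) fun a a' h => (Prod.ext_iff.1 h).1
  rw [(hasSum_prod_fintype fun v => (h1 v).hasSum).tsum_eq]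
  refine ((hasSum_sum (s := Finset.univ) fun v _ => (h1 v).hasSum).mul_left (1 / 2)).congr_fun
    fun y => ?_
  rw [sum_mul_one_sub_scStep W G n F y hi]

lemma hasSum_errorProb :
    HasSum (fun y => ∑ u : Fin (ℓ ^ n) → ZMod 2, 1 / 2 ^ (ℓ ^ n) *
      (W.blockProb y (Matrix.vecMul u (polarMatrix G n)) * (1 - scLaw W G n F u y u)))
      (errorProb W G n F) := by
  rw [errorProb]
  simp only [sum_scLaw_ne]
  refine hasSum_sum fun u _ => HasSum.mul_left _ (Summable.hasSum ?_)
  refine summable_mul_of_le_one ((isKernel_prob W).hasSum_prod _).summable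
    (fun y => (isKernel_prob W).prod_nonneg _ _) (fun y => ?_) fun y => ?_
  · rw [sub_nonneg]
    exact Finset.prod_le_one (fun i _ => scStep_nonneg _ _ _ _ _ _ _ _)
      fun i _ => scStep_le_one _ _ _ _ _ _ _ _
  · exact sub_le_self _ (scLaw_nonneg _ _ _ _ _ _ _)

/-- Union bound over the unfrozen steps, each with true prefix; frozen steps are never wrong. -/
lemma errorProb_le : errorProb W G n F ≤
    ∑ i ∈ Fᶜ, bhatt (split (polarMatrix G n) i W.prob) := by
  have h := hasSum_le (fun y => ?_) (hasSum_errorProb W G n (F := F))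
    (hasSum_sum (s := Fᶜ) fun i hi => hasSum_one_sub_scStep W G n (Finset.mem_compl.1 hi))
  · refine h.trans (Finset.sum_le_sum fun i _ => ?_)
    have hK := (isKernel_prob W).to_split (polarMatrix G n) i
    linarith [hK.tsum_min_le_bhatt, bhatt_nonneg (K := split (polarMatrix G n) i W.prob)]
  · rw [Finset.sum_comm]
    refine Finset.sum_le_sum fun u _ => ?_
    rw [← Finset.mul_sum, ← Finset.mul_sum]
    refine mul_le_mul_of_nonneg_left (mul_le_mul_of_nonneg_left ?_
      ((isKernel_prob W).prod_nonneg _ _)) (by positivity)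
    rw [scLaw]
    refine (one_sub_prod_le _ (fun i => scStep_nonneg W G n F u y u i)
      fun i => scStep_le_one W G n F u y u i).trans (le_of_eq ?_)
    refine (Finset.sum_subset (Finset.subset_univ _) fun i _ hi => ?_).symm
    rw [Finset.mem_compl, not_not] at hi
    rw [scStep_of_mem _ _ _ _ _ _ hi, sub_self]

/-- Being right altogether is no likelier than being right at step i; the loss there is half the sum
of minima, itself at least z²/2. -/
lemma le_errorProb {i : Fin (ℓ ^ n)} (hi : i ∉ F) :
    bhatt (split (polarMatrix G n) i W.prob) ^ 2 / 4 ≤ errorProb W G n F := by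
  have h := hasSum_le (fun y => ?_) (hasSum_one_sub_scStep W G n hi) (hasSum_errorProb W G n (F := F))
  · have hK := (isKernel_prob W).to_split (polarMatrix G n) i
    linarith [hK.sq_bhatt_le_tsum_min]
  · refine Finset.sum_le_sum fun u _ => mul_le_mul_of_nonneg_left (mul_le_mul_of_nonneg_left ?_
      ((isKernel_prob W).prod_nonneg _ _)) (by positivity)
    refine sub_le_sub_left ?_ _
    rw [scLaw, ← Finset.mul_prod_erase _ _ (Finset.mem_univ i)]
    exact mul_le_of_le_one_right (scStep_nonneg _ _ _ _ _ _ _ _)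
      (Finset.prod_le_one (fun i _ => scStep_nonneg _ _ _ _ _ _ _ _)
        fun i _ => scStep_le_one _ _ _ _ _ _ _ _)

end Decoder

end

end PolarCode

/-! ### The Gaussian tail and the central limit theorem for words. -/

namespace PolarCode

noncomputable section

section Gaussian

open ProbabilityTheory

lemma gaussQ_eq_integral (t : ℝ) : gaussQ t = ∫ x in Set.Ioi t, gaussianPDFReal 0 1 x := by
  rw [gaussQ, ← integral_const_mul]
  refine integral_congr_ae (Eventually.of_forall fun x => ?_)
  simp [gaussianPDFReal, neg_div]

lemma gaussQ_eq_measure (t : ℝ) : gaussQ t = (gaussianReal 0 1).real (Set.Ioi t) := by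
  rw [measureReal_def, gaussianReal_apply_eq_integral 0 one_ne_zero,
    ENNReal.toReal_ofReal (integral_nonneg fun x => gaussianPDFReal_nonneg _ _ _),
    gaussQ_eq_integral]

lemma gaussQ_sub (s t : ℝ) : gaussQ s - gaussQ t = ∫ x in s..t, gaussianPDFReal 0 1 x := by
  rw [gaussQ_eq_integral, gaussQ_eq_integral]
  exact intervalIntegral.integral_Ioi_sub_Ioi' (integrable_gaussianPDFReal 0 1).integrableOn
    (integrable_gaussianPDFReal 0 1).integrableOn

lemma gaussQ_strictAnti : StrictAnti gaussQ := by
  intro s t hst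
  rw [← sub_pos, gaussQ_sub]
  exact intervalIntegral.intervalIntegral_pos_of_pos
    (integrable_gaussianPDFReal 0 1).intervalIntegrable
    (fun x => gaussianPDFReal_pos _ _ _ one_ne_zero) hst

lemma continuous_gaussQ : Continuous gaussQ := by
  have h : gaussQ = fun t => gaussQ 0 - ∫ x in (0 : ℝ)..t, gaussianPDFReal 0 1 x := by
    funext t
    rw [← gaussQ_sub]; ring
  rw [h]
  exact continuous_const.sub (intervalIntegral.continuous_primitive
    (fun _ _ => (integrable_gaussianPDFReal 0 1).intervalIntegrable) 0)

lemma gaussQ_eq_one_sub_cdf (t : ℝ) : gaussQ t = 1 - cdf (gaussianReal 0 1) t := by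
  rw [gaussQ_eq_measure, cdf_eq_real, ← Set.compl_Iic, probReal_compl_eq_one_sub measurableSet_Iic]

/-- Only a preimage is needed, and the intermediate value theorem gives one between the limits 0 and
1. -/
lemma gaussQ_gaussQInv {p : ℝ} (h0 : 0 < p) (h1 : p < 1) : gaussQ (gaussQInv p) = p := by
  refine Function.invFun_eq ?_
  have hT : Tendsto gaussQ atTop (nhds 0) := by
    simpa [gaussQ_eq_one_sub_cdf] using
      (tendsto_cdf_atTop (gaussianReal 0 1)).const_sub 1 |>.congr fun t =>
        (gaussQ_eq_one_sub_cdf t).symm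
  have hB : Tendsto gaussQ atBot (nhds 1) := by
    simpa [gaussQ_eq_one_sub_cdf] using
      (tendsto_cdf_atBot (gaussianReal 0 1)).const_sub 1 |>.congr fun t =>
        (gaussQ_eq_one_sub_cdf t).symm
  obtain ⟨a, ha⟩ := (hT.eventually (gt_mem_nhds h0)).exists
  obtain ⟨b, hb⟩ := (hB.eventually (lt_mem_nhds h1)).exists
  obtain ⟨c, hc⟩ := mem_range_of_exists_le_of_exists_ge continuous_gaussQ ⟨a, ha.le⟩ ⟨b, hb.le⟩
  exact ⟨c, hc⟩

end Gaussian

/-- The proportion of words `d` of length `k` with `a ≤ ∑ i, g (d i)`. -/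
def wordFrac {ℓ : ℕ} (g : Fin ℓ → ℝ) (k : ℕ) (a : ℝ) : ℝ :=
  ((Finset.univ.filter fun d : Fin k → Fin ℓ => a ≤ ∑ i, g (d i)).card : ℝ) / (ℓ : ℝ) ^ k

section WordCLT

open ProbabilityTheory

variable {ℓ : ℕ}

/-- The law of an infinite word with independent uniform letters. -/
def wordMeasure (ℓ : ℕ) [NeZero ℓ] : Measure (ℕ → Fin ℓ) :=
  Measure.infinitePi fun _ => uniformOn Set.univ

instance [NeZero ℓ] : IsProbabilityMeasure (wordMeasure ℓ) := by
  unfold wordMeasure; infer_instance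

lemma uniformOn_real_singleton [NeZero ℓ] (i : Fin ℓ) :
    (uniformOn (Set.univ : Set (Fin ℓ))).real {i} = 1 / ℓ := by
  rw [measureReal_def, uniformOn_univ]
  simp

lemma integral_uniformOn_fin [NeZero ℓ] (g : Fin ℓ → ℝ) :
    ∫ i, g i ∂(uniformOn Set.univ) = 1 / ℓ * ∑ i, g i := by
  rw [integral_fintype Integrable.of_finite, Finset.mul_sum]
  simp only [uniformOn_real_singleton, smul_eq_mul]

lemma wordMeasure_map (k : ℕ) [NeZero ℓ] :
    (wordMeasure ℓ).map (fun ω (i : Fin k) => ω i) =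
      Measure.pi fun _ => uniformOn Set.univ := by
  have h := iIndepFun_infinitePi (P := fun _ : ℕ => uniformOn (Set.univ : Set (Fin ℓ)))
    (X := fun _ => id) fun _ => measurable_id
  have h2 := h.precomp (g := fun i : Fin k => i.val) Fin.val_injective
  have h3 := h2.map_fun_eq_pi_map fun i => (measurable_pi_apply i.val).aemeasurable
  simpa [Measure.infinitePi_map_eval, wordMeasure] using h3

lemma wordMeasure_real_eq (g : Fin ℓ → ℝ) (k : ℕ) (a : ℝ) [NeZero ℓ] :
    (wordMeasure ℓ).real {ω | a ≤ ∑ i ∈ Finset.range k, g (ω i)} = wordFrac g k a := by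
  have h1 : {ω : ℕ → Fin ℓ | a ≤ ∑ i ∈ Finset.range k, g (ω i)} =
      (fun ω (i : Fin k) => ω i) ⁻¹' {d | a ≤ ∑ i, g (d i)} := by
    ext ω
    simp only [Set.mem_ofPred_eq, Set.mem_preimage]
    rw [Fin.sum_univ_eq_sum_range fun i => g (ω i)]
  rw [h1, ← map_measureReal_apply (by fun_prop) (Set.toFinite _).measurableSet, wordMeasure_map]
  have h2 : {d : Fin k → Fin ℓ | a ≤ ∑ i, g (d i)} =
      ((Finset.univ.filter fun d : Fin k → Fin ℓ => a ≤ ∑ i, g (d i) : Finset _) : Set _) := by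
    ext d; simp
  rw [h2, ← sum_measureReal_singleton]
  have h3 : ∀ d : Fin k → Fin ℓ,
      (Measure.pi fun _ : Fin k => uniformOn (Set.univ : Set (Fin ℓ))).real {d} = 1 / (ℓ : ℝ) ^ k := by
    intro d
    rw [measureReal_def, Measure.pi_singleton, ENNReal.toReal_prod]
    have := fun i : Fin k => uniformOn_real_singleton (d i)
    simp only [measureReal_def] at this
    simp [this]
  simp only [h3]
  rw [Finset.sum_const, nsmul_eq_mul, wordFrac, mul_one_div]

lemma wordFrac_antitone (g : Fin ℓ → ℝ) (k : ℕ) : Antitone (wordFrac g k) := by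
  intro a b hab
  refine div_le_div_of_nonneg_right ?_ (by positivity)
  exact_mod_cast Finset.card_le_card (Finset.monotone_filter_right _ fun d _ hd => hab.trans hd)

/-- Convergence in distribution, evaluated on the half-line [t, ∞), whose boundary is a null set for
the Gaussian law. -/
lemma tendsto_wordFrac_normalized [NeZero ℓ] {g : Fin ℓ → ℝ} (h0 : ∑ i, g i = 0)
    (h1 : 1 / (ℓ : ℝ) * ∑ i, g i ^ 2 = 1) (t : ℝ) :
    Tendsto (fun k : ℕ => wordFrac g k (t * √k)) atTop (nhds (gaussQ t)) := by
  have hg : Measurable g := measurable_of_finite g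
  have hmap : ∀ i : ℕ, (wordMeasure ℓ).map (fun ω => ω i) = uniformOn Set.univ :=
    fun i => Measure.infinitePi_map_eval _ i
  have hint : ∀ f : Fin ℓ → ℝ, ∫ ω, f (ω 0) ∂(wordMeasure ℓ) = 1 / ℓ * ∑ i, f i := by
    intro f
    rw [← integral_uniformOn_fin, ← hmap 0, integral_map (measurable_pi_apply 0).aemeasurable
      (measurable_of_finite f).aestronglyMeasurable]
  have hclt := tendstoInDistribution_inv_sqrt_mul_sum (P := wordMeasure ℓ)
    (P' := gaussianReal 0 1) (X := fun i ω => g (ω i)) (Y := id)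
    ⟨by fun_prop, by simp⟩ ?_ ?_ ?_ ?_
  · have hE : (gaussianReal 0 1) (frontier (Set.Ici t)) = 0 := by
      have := nullSingletonClass_gaussianReal (μ := 0) (v := 1) one_ne_zero
      rw [frontier_Ici]
      exact measure_singleton t
    have h2 := ProbabilityMeasure.tendsto_measure_of_null_frontier_of_tendsto' hclt.tendsto
      (E := Set.Ici t) (by simpa using hE)
    simp only [ProbabilityMeasure.coe_mk, Measure.map_id] at h2
    have h3 := (ENNReal.tendsto_toReal (measure_ne_top _ _)).comp h2
    have h4 : ((gaussianReal 0 1) (Set.Ici t)).toReal = gaussQ t := by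
      have := nullSingletonClass_gaussianReal (μ := 0) (v := 1) one_ne_zero
      rw [gaussQ_eq_measure, measureReal_def, measure_congr Ioi_ae_eq_Ici]
    rw [h4] at h3
    refine h3.congr' ?_
    filter_upwards [eventually_gt_atTop 0] with k hk
    have hk' : 0 < √(k : ℝ) := by positivity
    simp only [Function.comp]
    rw [Measure.map_apply (by fun_prop) measurableSet_Ici, ← wordMeasure_real_eq, measureReal_def]
    congr 2
    ext ω
    simp only [Set.mem_preimage, Set.mem_Ici, Set.mem_ofPred_eq]
    rw [inv_mul_eq_div, le_div_iff₀ hk']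
  · rw [hint, h0, mul_zero]
  · rw [← h1]
    exact hint fun i => g i ^ 2
  · exact iIndepFun_infinitePi fun _ => hg
  · intro i
    refine ⟨(hg.comp (measurable_pi_apply i)).aemeasurable,
      (hg.comp (measurable_pi_apply 0)).aemeasurable, ?_⟩
    rw [← Function.comp_def g, ← Function.comp_def g, ← Measure.map_map hg (by fun_prop),
      ← Measure.map_map hg (by fun_prop), hmap, hmap]

/-- The central limit theorem for words with uniform letters. -/
lemma tendsto_wordFrac [NeZero ℓ] {g : Fin ℓ → ℝ} {μ v : ℝ} (hμ : μ = 1 / ℓ * ∑ i, g i)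
    (hv : v = 1 / ℓ * ∑ i, (g i - μ) ^ 2) (hv0 : 0 < v) {a : ℕ → ℝ} {t : ℝ}
    (ha : Tendsto (fun k : ℕ => (a k - μ * k) / √k) atTop (nhds (t * √v))) :
    Tendsto (fun k => wordFrac g k (a k)) atTop (nhds (gaussQ t)) := by
  have hℓ : (ℓ : ℝ) ≠ 0 := Nat.cast_ne_zero.2 (NeZero.ne ℓ)
  have hsv : 0 < √v := Real.sqrt_pos.2 hv0
  let g' : Fin ℓ → ℝ := fun i => (g i - μ) / √v
  have h0 : ∑ i, g' i = 0 := by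
    rw [← Finset.sum_div, Finset.sum_sub_distrib, Finset.sum_const, Finset.card_univ,
      Fintype.card_fin, nsmul_eq_mul, hμ]
    field_simp
    simp
  have h1 : 1 / (ℓ : ℝ) * ∑ i, g' i ^ 2 = 1 := by
    simp only [g', div_pow, Real.sq_sqrt hv0.le]
    rw [← Finset.sum_div, ← mul_div_assoc, ← hv, div_self hv0.ne']
  have hfrac : ∀ k a, wordFrac g k a = wordFrac g' k ((a - μ * k) / √v) := by
    intro k a
    rw [wordFrac, wordFrac]
    congr 3
    refine Finset.filter_congr fun d _ => ?_
    rw [← Finset.sum_div, div_le_div_iff_of_pos_right hsv, Finset.sum_sub_distrib, Finset.sum_const,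
      Finset.card_univ, Fintype.card_fin, nsmul_eq_mul, mul_comm (k : ℝ), sub_le_sub_iff_right]
  have hs : Tendsto (fun k : ℕ => (a k - μ * k) / √k / √v) atTop (nhds t) := by
    have := ha.div_const (√v)
    rwa [mul_div_cancel_right₀ _ hsv.ne'] at this
  have hmul : ∀ k : ℕ, 0 < k → (a k - μ * k) / √v = (a k - μ * k) / √k / √v * √k := by
    intro k hk
    have : 0 < √(k : ℝ) := by positivity
    field_simp
  -- The normalized threshold only converges to t. It is eventually below any s > t and above any s
  -- < t, so monotonicity of `wordFrac` and continuity of Q reduce to fixed s.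
  rw [tendsto_order]
  constructor
  · intro b hb
    obtain ⟨s, hts, hs'⟩ : ∃ s, t < s ∧ b < gaussQ s := by
      have := (continuous_gaussQ.tendsto t).eventually (lt_mem_nhds hb)
      obtain ⟨s, h1, h2⟩ := ((this.filter_mono nhdsWithin_le_nhds).and
        (self_mem_nhdsWithin (s := Set.Ioi t))).exists
      exact ⟨s, h2, h1⟩
    filter_upwards [(tendsto_wordFrac_normalized h0 h1 s).eventually (lt_mem_nhds hs'),
      hs.eventually (gt_mem_nhds hts), eventually_gt_atTop 0] with k h2 h3 hk
    refine h2.trans_le ?_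
    rw [hfrac, hmul k hk]
    exact wordFrac_antitone _ _ (mul_le_mul_of_nonneg_right h3.le (Real.sqrt_nonneg _))
  · intro b hb
    obtain ⟨s, hts, hs'⟩ : ∃ s, s < t ∧ gaussQ s < b := by
      have := (continuous_gaussQ.tendsto t).eventually (gt_mem_nhds hb)
      obtain ⟨s, h1, h2⟩ := ((this.filter_mono nhdsWithin_le_nhds).and
        (self_mem_nhdsWithin (s := Set.Iio t))).exists
      exact ⟨s, h2, h1⟩
    filter_upwards [(tendsto_wordFrac_normalized h0 h1 s).eventually (gt_mem_nhds hs'),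
      hs.eventually (lt_mem_nhds hts), eventually_gt_atTop 0] with k h2 h3 hk
    refine lt_of_le_of_lt ?_ h2
    rw [hfrac, hmul k hk]
    exact wordFrac_antitone _ _ (mul_le_mul_of_nonneg_right h3.le (Real.sqrt_nonneg _))

end WordCLT

end

end PolarCode

/-! ### The process of z and h along words; polarization. -/

namespace PolarCode

noncomputable section

/-- The Bhattacharyya parameters `z` and the conditional entropies `h` along the tree of channels
generated by a kernel with partial distances `D`. -/
structure PolarProcess {ℓ : ℕ} (D : Fin ℓ → ℕ) (z h : (n : ℕ) → Fin (ℓ ^ n) → ℝ) : Prop where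
  z_nonneg : ∀ n i, 0 ≤ z n i
  z_le_one : ∀ n i, z n i ≤ 1
  pow_le : ∀ n i j, z n i ^ D j ≤ z (n + 1) (innerIdx ℓ n (i, j))
  le_pow : ∀ n i j, z (n + 1) (innerIdx ℓ n (i, j)) ≤ 2 ^ ℓ * z n i ^ D j
  h_le_one : ∀ n i, h n i ≤ 1
  h_nonneg : ∀ n i, 0 ≤ h n i
  sum_h : ∀ n i, ∑ j, h (n + 1) (innerIdx ℓ n (i, j)) = ℓ * h n i
  gap : ∃ j, ∀ n i, h (n + 1) (innerIdx ℓ n (i, j)) ≤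
    h n i - (1 - z n i) * z n i ^ 2 / (2 * Real.log 2)
  h_le : ∀ n i, h n i ≤ 2 / Real.log 2 * z n i
  one_sub_h_le : ∀ n i, Real.log 2 * (1 - h n i) ≤ 1 - z n i ^ 2

/-- The proportion of indices at depth `n` with the property `P`. -/
def frac (ℓ n : ℕ) (P : Fin (ℓ ^ n) → Prop) [DecidablePred P] : ℝ :=
  ((Finset.univ.filter P).card : ℝ) / (ℓ : ℝ) ^ n

section Words

variable {ℓ : ℕ}

/-- The descendants of the index `i` at depth `m` are labelled by words. -/
def wordEquiv (ℓ m : ℕ) : (k : ℕ) → Fin (ℓ ^ m) × (Fin k → Fin ℓ) ≃ Fin (ℓ ^ (m + k))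
  | 0 => Equiv.prodUnique _ _
  | k + 1 => ((Equiv.refl _).prodCongr
      ((Fin.snocEquiv fun _ : Fin (k + 1) => Fin ℓ).symm.trans (Equiv.prodComm _ _))).trans
      ((Equiv.prodAssoc _ _ _).symm.trans
        (((wordEquiv ℓ m k).prodCongr (Equiv.refl _)).trans (innerIdx ℓ (m + k))))

lemma wordEquiv_zero (m : ℕ) (i : Fin (ℓ ^ m)) (d : Fin 0 → Fin ℓ) :
    wordEquiv ℓ m 0 (i, d) = i := rfl

lemma wordEquiv_succ (m k : ℕ) (i : Fin (ℓ ^ m)) (d : Fin (k + 1) → Fin ℓ) :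
    wordEquiv ℓ m (k + 1) (i, d) =
      innerIdx ℓ (m + k) (wordEquiv ℓ m k (i, Fin.init d), d (Fin.last k)) := rfl

lemma sum_word_succ {M : Type*} [AddCommMonoid M] (k : ℕ) (f : (Fin (k + 1) → Fin ℓ) → M) :
    ∑ d, f d = ∑ d : Fin k → Fin ℓ, ∑ j, f (Fin.snoc d j) := by
  rw [← (Fin.snocEquiv fun _ : Fin (k + 1) => Fin ℓ).sum_comp, Fintype.sum_prod_type,
    Finset.sum_comm]
  rfl

lemma frac_add (m k : ℕ) (P : Fin (ℓ ^ (m + k)) → Prop) [DecidablePred P] :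
    frac ℓ (m + k) P = (∑ i, ((Finset.univ.filter fun d : Fin k → Fin ℓ =>
      P (wordEquiv ℓ m k (i, d))).card : ℝ) / (ℓ : ℝ) ^ k) / (ℓ : ℝ) ^ m := by
  have e : (ℓ : ℝ) ^ (m + k) = (ℓ : ℝ) ^ k * (ℓ : ℝ) ^ m := by rw [pow_add, mul_comm]
  rw [frac, e, ← Finset.sum_div, div_div]
  congr 1
  simp only [Finset.card_filter]
  push_cast
  rw [← (wordEquiv ℓ m k).sum_comp, Fintype.sum_prod_type]

/-- The sum of the reciprocals of the partial products of `D` along a word. -/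
def recipSum (D : Fin ℓ → ℕ) : (k : ℕ) → (Fin k → Fin ℓ) → ℝ
  | 0, _ => 0
  | k + 1, d => recipSum D k (Fin.init d) + ∏ i, (1 / (D (d i) : ℝ))

lemma recipSum_nonneg (D : Fin ℓ → ℕ) (k : ℕ) (d : Fin k → Fin ℓ) : 0 ≤ recipSum D k d := by
  induction k with
  | zero => exact le_rfl
  | succ k ih => exact add_nonneg (ih _) (Finset.prod_nonneg fun i _ => by positivity)

lemma sum_recipSum_succ (D : Fin ℓ → ℕ) (k : ℕ) :
    ∑ d, recipSum D (k + 1) d = ℓ * ∑ d, recipSum D k d + (∑ j, 1 / (D j : ℝ)) ^ (k + 1) := by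
  simp only [recipSum]
  rw [Finset.sum_add_distrib, sum_word_succ]
  congr 1
  · simp [Finset.mul_sum]
  · exact (Fintype.sum_pow (fun j => 1 / (D j : ℝ)) (k + 1)).symm

/-- The mean of the reciprocal of a product of r independent D's is ρ^r, so the mean of `recipSum`
is a partial geometric series. The induction carries its tail ρ^(k+1)/(1-ρ). -/
lemma sum_recipSum_le [NeZero ℓ] (D : Fin ℓ → ℕ) {ρ : ℝ} (hρ : ρ = 1 / ℓ * ∑ j, 1 / (D j : ℝ))
    (hρ1 : ρ < 1) (k : ℕ) : (∑ d, recipSum D k d) / (ℓ : ℝ) ^ k ≤ 1 / (1 - ρ) := by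
  have hℓ : (0 : ℝ) < ℓ := Nat.cast_pos.2 (NeZero.pos ℓ)
  have hρ0 : 0 ≤ ρ := by rw [hρ]; positivity
  have h : (∑ d, recipSum D k d) / (ℓ : ℝ) ^ k + ρ ^ (k + 1) / (1 - ρ) ≤ 1 / (1 - ρ) := by
    induction k with
    | zero =>
      simp only [recipSum, Finset.sum_const_zero, zero_div, zero_add, pow_one]
      exact div_le_div_of_nonneg_right hρ1.le (by linarith)
    | succ k ih =>
      refine le_trans (le_of_eq ?_) ih
      have h1 : (∑ j, 1 / (D j : ℝ)) = ℓ * ρ := by rw [hρ]; field_simp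
      have h2 : 1 - ρ ≠ 0 := by linarith
      rw [sum_recipSum_succ, h1, add_div, pow_succ (ℓ : ℝ), mul_pow, ← pow_succ,
        mul_div_cancel_left₀ _ (by positivity), pow_succ (ℓ : ℝ),
        mul_comm ((ℓ : ℝ) ^ k) (ℓ : ℝ), mul_div_mul_left _ _ hℓ.ne']
      field_simp
      ring
  have h2 : 0 ≤ ρ ^ (k + 1) / (1 - ρ) := div_nonneg (by positivity) (by linarith)
  linarith

lemma card_recipSum_gt_le [NeZero ℓ] (D : Fin ℓ → ℕ) {ρ : ℝ}
    (hρ : ρ = 1 / ℓ * ∑ j, 1 / (D j : ℝ)) (hρ1 : ρ < 1) (k : ℕ) {B : ℝ} (hB : 0 < B) :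
    ((Finset.univ.filter fun d : Fin k → Fin ℓ => B < recipSum D k d).card : ℝ) / (ℓ : ℝ) ^ k ≤
      1 / (1 - ρ) / B := by
  have hℓ : (0 : ℝ) < ℓ := Nat.cast_pos.2 (NeZero.pos ℓ)
  rw [le_div_iff₀ hB]
  refine le_trans ?_ (sum_recipSum_le D hρ hρ1 k)
  rw [div_mul_eq_mul_div]
  refine div_le_div_of_nonneg_right ?_ (by positivity)
  rw [← nsmul_eq_mul]
  refine (Finset.card_nsmul_le_sum _ _ _ fun d hd => ((Finset.mem_filter.1 hd).2).le).trans ?_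
  exact Finset.sum_le_univ_sum_of_nonneg fun d => recipSum_nonneg D k d

end Words

section Paths

variable {ℓ : ℕ} {D : Fin ℓ → ℕ} {z h : (n : ℕ) → Fin (ℓ ^ n) → ℝ}

lemma PolarProcess.pow_le_word (H : PolarProcess D z h) (m k : ℕ) (i : Fin (ℓ ^ m))
    (d : Fin k → Fin ℓ) :
    z m i ^ (∏ r, D (d r)) ≤ z (m + k) (wordEquiv ℓ m k (i, d)) := by
  induction k with
  | zero => simp [wordEquiv_zero]
  | succ k ih =>
    rw [wordEquiv_succ, Fin.prod_univ_castSucc, pow_mul]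
    exact (pow_le_pow_left₀ (pow_nonneg (H.z_nonneg _ _) _) (ih (Fin.init d)) _).trans
      (H.pow_le _ _ _)

/-- A factor 2^ℓ incurred at one step is raised to the later D's. Inside the power by the full
product its exponent becomes the reciprocal of the product up to that step, hence `recipSum`. -/
lemma PolarProcess.word_le_pow (H : PolarProcess D z h) (hD : ∀ j, 1 ≤ D j) (m k : ℕ)
    (i : Fin (ℓ ^ m)) (d : Fin k → Fin ℓ) :
    z (m + k) (wordEquiv ℓ m k (i, d)) ≤
      (z m i * ((2 : ℝ) ^ ℓ) ^ recipSum D k d) ^ (∏ r, D (d r)) := by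
  induction k with
  | zero => simp [wordEquiv_zero, recipSum]
  | succ k ih =>
    rw [wordEquiv_succ]
    refine (H.le_pow _ _ _).trans ((mul_le_mul_of_nonneg_left (pow_le_pow_left₀ (H.z_nonneg _ _)
      (ih (Fin.init d)) _) (by positivity)).trans (le_of_eq ?_))
    have hP : (∏ i : Fin k, D (Fin.init d i)) * D (d (Fin.last k)) = ∏ i, D (d i) :=
      (Fin.prod_univ_castSucc fun i => D (d i)).symm
    rw [← pow_mul, hP, recipSum, Real.rpow_add (by positivity), ← mul_assoc,
      mul_pow _ (((2 : ℝ) ^ ℓ) ^ ∏ i, (1 / (D (d i) : ℝ))), mul_comm]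
    congr 1
    rw [← Real.rpow_natCast (_ ^ _), ← Real.rpow_mul (by positivity), Nat.cast_prod,
      ← Finset.prod_mul_distrib]
    rw [Finset.prod_eq_one, Real.rpow_one]
    intro r _
    have : (D (d r) : ℝ) ≠ 0 := by
      have := hD (d r)
      positivity
    field_simp

lemma PolarProcess.sum_h_word (H : PolarProcess D z h) (m k : ℕ) (i : Fin (ℓ ^ m)) :
    ∑ d, h (m + k) (wordEquiv ℓ m k (i, d)) = (ℓ : ℝ) ^ k * h m i := by
  induction k with
  | zero => simp [wordEquiv_zero]
  | succ k ih =>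
    rw [sum_word_succ]
    simp only [wordEquiv_succ, Fin.init_snoc, Fin.snoc_last]
    have := fun d => H.sum_h (m + k) (wordEquiv ℓ m k (i, d))
    change ∑ d : Fin k → Fin ℓ, ∑ j, h (m + k + 1)
      (innerIdx ℓ (m + k) (wordEquiv ℓ m k (i, d), j)) = _
    simp only [this]
    rw [← Finset.mul_sum, ih, pow_succ]
    ring

lemma PolarProcess.sum_h_eq (H : PolarProcess D z h) (n : ℕ) :
    ∑ i, h n i = (ℓ : ℝ) ^ n * h 0 0 := by
  induction n with
  | zero =>
    have e : (ℓ : ℝ) ^ 0 = 1 := pow_zero _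
    rw [e, one_mul]
    exact Fin.sum_univ_one fun i : Fin 1 => h 0 i
  | succ n ih =>
    rw [← (innerIdx ℓ n).sum_comp, Fintype.sum_prod_type]
    simp only [H.sum_h]
    rw [← Finset.mul_sum, ih, pow_succ]
    ring

lemma PolarProcess.sum_one_sub_h (H : PolarProcess D z h) (n : ℕ) :
    ∑ i, (1 - h n i) = (ℓ : ℝ) ^ n * (1 - h 0 0) := by
  rw [Finset.sum_sub_distrib, H.sum_h_eq]
  simp
  ring

lemma frac_mul_le_sum (n : ℕ) {P : Fin (ℓ ^ n) → Prop} [DecidablePred P] {f : Fin (ℓ ^ n) → ℝ}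
    {c : ℝ} (hf : ∀ i, 0 ≤ f i) (hP : ∀ i, P i → c ≤ f i) :
    frac ℓ n P * c ≤ (∑ i, f i) / (ℓ : ℝ) ^ n := by
  rw [frac, div_mul_eq_mul_div]
  refine div_le_div_of_nonneg_right ?_ (by positivity)
  rw [← nsmul_eq_mul]
  refine (Finset.card_nsmul_le_sum _ f _ fun i hi => hP i (Finset.mem_filter.1 hi).2).trans ?_
  exact Finset.sum_le_univ_sum_of_nonneg hf

lemma frac_le_one [NeZero ℓ] (n : ℕ) (P : Fin (ℓ ^ n) → Prop) [DecidablePred P] :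
    frac ℓ n P ≤ 1 := by
  have hℓ : (0 : ℝ) < ℓ := Nat.cast_pos.2 (NeZero.pos ℓ)
  rw [frac, div_le_one (by positivity)]
  have := Finset.card_filter_le (Finset.univ : Finset (Fin (ℓ ^ n))) P
  rw [Finset.card_univ, Fintype.card_fin] at this
  exact_mod_cast this

lemma frac_nonneg (n : ℕ) (P : Fin (ℓ ^ n) → Prop) [DecidablePred P] : 0 ≤ frac ℓ n P := by
  unfold frac; positivity

/-- The variance of one step of the entropy martingale tends to zero, hence polarization. -/
lemma PolarProcess.tendsto_frac_mid [NeZero ℓ] (H : PolarProcess D z h) {δ : ℝ} (hδ : 0 < δ) :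
    Tendsto (fun n => frac ℓ n fun i => δ < z n i ∧ z n i < 1 - δ) atTop (nhds 0) := by
  have hℓ : (0 : ℝ) < ℓ := Nat.cast_pos.2 (NeZero.pos ℓ)
  have hl : 0 < Real.log 2 := Real.log_pos one_lt_two
  obtain ⟨j₀, hgap⟩ := H.gap
  let b : ℕ → ℝ := fun n => (∑ i, h n i ^ 2) / (ℓ : ℝ) ^ n
  let f : (n : ℕ) → Fin (ℓ ^ n) → ℝ := fun n i =>
    ((1 - z n i) * z n i ^ 2 / (2 * Real.log 2)) ^ 2
  have hf0 : ∀ n i, 0 ≤ f n i := fun n i => sq_nonneg _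
  -- The second moment b of h grows at each level by the mean one-step variance, to which the letter
  -- j₀ contributes at least f/ℓ. As b is bounded by 1, its increments vanish in the limit.
  have hstep : ∀ n, (∑ i, f n i) / (ℓ : ℝ) ^ n ≤ ℓ * (b (n + 1) - b n) := by
    intro n
    have h1 : ∀ i, ℓ * h n i ^ 2 + f n i ≤ ∑ j, h (n + 1) (innerIdx ℓ n (i, j)) ^ 2 := by
      intro i
      have h2 : ∑ j, (h (n + 1) (innerIdx ℓ n (i, j)) - h n i) ^ 2 =
          ∑ j, h (n + 1) (innerIdx ℓ n (i, j)) ^ 2 - ℓ * h n i ^ 2 := by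
        simp only [sub_sq]
        rw [Finset.sum_add_distrib, Finset.sum_sub_distrib, ← Finset.sum_mul, ← Finset.mul_sum,
          H.sum_h, Finset.sum_const, Finset.card_univ, Fintype.card_fin, nsmul_eq_mul]
        ring
      have h3 : f n i ≤ (h (n + 1) (innerIdx ℓ n (i, j₀)) - h n i) ^ 2 := by
        have h4 : 0 ≤ (1 - z n i) * z n i ^ 2 / (2 * Real.log 2) :=
          div_nonneg (mul_nonneg (sub_nonneg.2 (H.z_le_one n i)) (sq_nonneg _)) (by positivity)
        have h5 := hgap n i
        rw [← neg_sq (h (n + 1) _ - _)]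
        exact pow_le_pow_left₀ h4 (by linarith) 2
      have h6 := Finset.single_le_sum (f := fun j => (h (n + 1) (innerIdx ℓ n (i, j)) - h n i) ^ 2)
        (fun j _ => sq_nonneg _) (Finset.mem_univ j₀)
      linarith
    have h7 := Finset.sum_le_sum (s := Finset.univ) fun i _ => h1 i
    rw [Finset.sum_add_distrib, ← Finset.mul_sum] at h7
    have h8 : b (n + 1) = (∑ i, ∑ j, h (n + 1) (innerIdx ℓ n (i, j)) ^ 2) / (ℓ : ℝ) ^ (n + 1) := by
      simp only [b]
      rw [← (innerIdx ℓ n).sum_comp, Fintype.sum_prod_type]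
    rw [h8]
    simp only [b]
    have h9 : ℓ * ((∑ i, ∑ j, h (n + 1) (innerIdx ℓ n (i, j)) ^ 2) / (ℓ : ℝ) ^ (n + 1) -
        (∑ i, h n i ^ 2) / (ℓ : ℝ) ^ n) = ((∑ i, ∑ j, h (n + 1) (innerIdx ℓ n (i, j)) ^ 2) -
        ℓ * ∑ i, h n i ^ 2) / (ℓ : ℝ) ^ n := by
      have e : (ℓ : ℝ) ^ (n + 1) = (ℓ : ℝ) ^ n * ℓ := pow_succ _ _
      rw [e]
      field_simp
    rw [h9]
    exact div_le_div_of_nonneg_right (by linarith) (by positivity)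
  have hmono : Monotone b := monotone_nat_of_le_succ fun n => by
    have h1 := hstep n
    have h2 : 0 ≤ (∑ i, f n i) / (ℓ : ℝ) ^ n :=
      div_nonneg (Finset.sum_nonneg fun i _ => hf0 n i) (by positivity)
    exact sub_nonneg.1 ((mul_nonneg_iff_of_pos_left hℓ).1 (h2.trans h1))
  have hbdd : BddAbove (Set.range b) := by
    refine ⟨1, ?_⟩
    rintro _ ⟨n, rfl⟩
    simp only [b]
    rw [div_le_one (by positivity)]
    refine (Finset.sum_le_sum fun i _ => pow_le_one₀ (H.h_nonneg n i) (H.h_le_one n i)).trans ?_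
    simp
  have hconv := tendsto_atTop_ciSup hmono hbdd
  have hdiff : Tendsto (fun n => ℓ * (b (n + 1) - b n)) atTop (nhds 0) := by
    have := (((hconv.comp (tendsto_add_atTop_nat 1)).sub hconv).const_mul (ℓ : ℝ))
    simpa using this
  set c := (δ * δ ^ 2 / (2 * Real.log 2)) ^ 2 with hc
  have hc0 : 0 < c := by positivity
  have hdiff2 := hdiff.div_const c
  rw [zero_div] at hdiff2
  refine squeeze_zero (fun n => frac_nonneg _ _) (fun n => ?_) hdiff2
  rw [le_div_iff₀ hc0]
  refine (frac_mul_le_sum n (hf0 n) fun i hi => ?_).trans (hstep n)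
  refine pow_le_pow_left₀ (by positivity) (div_le_div_of_nonneg_right ?_ (by positivity)) 2
  exact mul_le_mul (by linarith [hi.2]) (pow_le_pow_left₀ hδ.le hi.1.le 2) (by positivity)
    (by linarith [hi.2])

lemma frac_eq_sum (n : ℕ) (P : Fin (ℓ ^ n) → Prop) [DecidablePred P] :
    frac ℓ n P = (∑ i, if P i then (1 : ℝ) else 0) / (ℓ : ℝ) ^ n := by
  rw [frac, Finset.card_filter]; push_cast; rfl

lemma PolarProcess.one_sub_h_le_of_le (H : PolarProcess D z h) {δ : ℝ} {n : ℕ} {i : Fin (ℓ ^ n)}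
    (hz : 1 - δ ≤ z n i) : 1 - h n i ≤ 2 / Real.log 2 * δ := by
  have hl : 0 < Real.log 2 := Real.log_pos one_lt_two
  have h1 := H.one_sub_h_le n i
  have h0 := H.z_nonneg n i
  have h2 := H.z_le_one n i
  rw [div_mul_eq_mul_div, le_div_iff₀ hl]
  nlinarith

/-- The average of 1 - h is the constant 1 - h 0 0. Indices with z near 1 add little to it and
intermediate ones are rare, so small z must carry the rest. -/
lemma PolarProcess.le_frac_small [NeZero ℓ] (H : PolarProcess D z h) {δ ε : ℝ} (hδ : 0 < δ)
    (hε : 0 < ε) : ∀ᶠ n in atTop, 1 - h 0 0 - ε ≤ frac ℓ n fun i => z n i ≤ δ := by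
  have hℓ : (0 : ℝ) < ℓ := Nat.cast_pos.2 (NeZero.pos ℓ)
  have hl : 0 < Real.log 2 := Real.log_pos one_lt_two
  set δ' := min δ (ε * Real.log 2 / 4) with hδ'
  have hδ'0 : 0 < δ' := lt_min hδ (by positivity)
  filter_upwards [(H.tendsto_frac_mid hδ'0).eventually (gt_mem_nhds (half_pos hε))] with n hn
  have h1 : ∀ i, 1 - h n i ≤ (if z n i ≤ δ then (1 : ℝ) else 0) +
      (if δ' < z n i ∧ z n i < 1 - δ' then (1 : ℝ) else 0) + ε / 2 := by
    intro i
    have hh := H.h_nonneg n i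
    split_ifs with ha hb hb
    · linarith
    · linarith
    · linarith
    · have hz : δ' < z n i := lt_of_le_of_lt (min_le_left _ _) (not_le.1 ha)
      have hz' : 1 - δ' ≤ z n i := not_lt.1 fun h => hb ⟨hz, h⟩
      have h2 := H.one_sub_h_le_of_le hz'
      have h3 : 2 / Real.log 2 * δ' ≤ 2 / Real.log 2 * (ε * Real.log 2 / 4) :=
        mul_le_mul_of_nonneg_left (min_le_right _ _) (by positivity)
      have h4 : 2 / Real.log 2 * (ε * Real.log 2 / 4) = ε / 2 := by field_simp; ring
      linarith
  have h2 := div_le_div_of_nonneg_right (Finset.sum_le_sum (s := Finset.univ) fun i _ => h1 i)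
    (by positivity : 0 ≤ (ℓ : ℝ) ^ n)
  rw [Finset.sum_add_distrib, Finset.sum_add_distrib, add_div, add_div, ← frac_eq_sum,
    ← frac_eq_sum, H.sum_one_sub_h, mul_div_cancel_left₀ _ (by positivity), Finset.sum_const,
    Finset.card_univ, Fintype.card_fin, nsmul_eq_mul, Nat.cast_pow,
    mul_div_cancel_left₀ _ (by positivity)] at h2
  linarith

/-- Each index with z ≤ δ contributes nearly 1 to the conserved average of 1 - h. -/
lemma PolarProcess.frac_small_le [NeZero ℓ] (H : PolarProcess D z h) {δ : ℝ} (hδ : 0 ≤ δ) (n : ℕ) :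
    (frac ℓ n fun i => z n i ≤ δ) ≤ 1 - h 0 0 + 2 / Real.log 2 * δ := by
  have hℓ : (0 : ℝ) < ℓ := Nat.cast_pos.2 (NeZero.pos ℓ)
  have hl : 0 < Real.log 2 := Real.log_pos one_lt_two
  have h1 := frac_mul_le_sum n (P := fun i => z n i ≤ δ) (f := fun i => 1 - h n i)
    (c := 1 - 2 / Real.log 2 * δ) (fun i => sub_nonneg.2 (H.h_le_one n i)) fun i hi => by
      have := H.h_le n i
      have h2 : 2 / Real.log 2 * z n i ≤ 2 / Real.log 2 * δ :=
        mul_le_mul_of_nonneg_left hi (by positivity)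
      linarith
  rw [H.sum_one_sub_h, mul_div_cancel_left₀ _ (by positivity)] at h1
  have h2 := frac_le_one n fun i => z n i ≤ δ
  have h3 : 0 ≤ 2 / Real.log 2 * δ := by positivity
  nlinarith

end Paths

end

end PolarCode

/-! ### The Gaussian proportion of very good indices. -/

namespace PolarCode

noncomputable section

lemma gaussQ_nonneg (t : ℝ) : 0 ≤ gaussQ t := by
  rw [gaussQ_eq_measure]
  exact measureReal_nonneg

lemma gaussQ_le_one (t : ℝ) : gaussQ t ≤ 1 := by
  rw [gaussQ_eq_measure]
  exact measureReal_le_one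

section Thresholds

variable {a : ℕ → ℝ} {μ L : ℝ}

/-- A fixed number m of initial levels and a constant c are invisible on the scale √k. -/
lemma tendsto_shift_threshold (ha : Tendsto (fun n : ℕ => (a n - μ * n) / √n) atTop (nhds L))
    (m : ℕ) (c : ℝ) :
    Tendsto (fun k : ℕ => (a (m + k) - c - μ * k) / √k) atTop (nhds L) := by
  have hsq : Tendsto (fun k : ℕ => √(k : ℝ)) atTop atTop :=
    Real.tendsto_sqrt_atTop.comp tendsto_natCast_atTop_atTop
  have h1 : Tendsto (fun k : ℕ => (a (m + k) - μ * (m + k : ℕ)) / √(m + k : ℕ)) atTop (nhds L) := by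
    have := ha.comp (tendsto_add_atTop_nat m)
    simpa only [Function.comp_def, add_comm] using this
  have h2 : Tendsto (fun k : ℕ => √(m / k + 1 : ℝ)) atTop (nhds 1) := by
    have h3 : Tendsto (fun k : ℕ => (m / k + 1 : ℝ)) atTop (nhds (0 + 1)) :=
      (tendsto_const_nhds.div_atTop tendsto_natCast_atTop_atTop).add_const 1
    have := (Real.continuous_sqrt.tendsto _).comp h3
    simpa [Function.comp_def] using this
  have h3 : Tendsto (fun k : ℕ => (μ * m - c) / √(k : ℝ)) atTop (nhds 0) :=
    tendsto_const_nhds.div_atTop hsq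
  have h4 := (h1.mul h2).add h3
  rw [mul_one, add_zero] at h4
  refine h4.congr' ?_
  filter_upwards [eventually_gt_atTop 0] with k hk
  have hk' : (0 : ℝ) < k := Nat.cast_pos.2 hk
  have hmk : (0 : ℝ) < √((m + k : ℕ) : ℝ) := Real.sqrt_pos.2 (by positivity)
  have e : √(m / k + 1 : ℝ) = √((m + k : ℕ) : ℝ) / √k := by
    rw [← Real.sqrt_div (by positivity)]
    congr 1
    push_cast
    field_simp
  rw [e, div_mul_div_comm, mul_comm (√((m + k : ℕ) : ℝ)), mul_div_mul_right _ _ hmk.ne', ← add_div]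
  push_cast
  congr 1
  ring

lemma tendsto_atTop_threshold (hμ : 0 < μ)
    (ha : Tendsto (fun n : ℕ => (a n - μ * n) / √n) atTop (nhds L)) : Tendsto a atTop atTop := by
  have hsq : Tendsto (fun k : ℕ => √(k : ℝ)) atTop atTop :=
    Real.tendsto_sqrt_atTop.comp tendsto_natCast_atTop_atTop
  have h1 := hsq.atTop_mul_atTop₀ ((hsq.const_mul_atTop hμ).atTop_add ha)
  refine h1.congr' ?_
  filter_upwards [eventually_gt_atTop 0] with k hk
  have hk' : (0 : ℝ) < √(k : ℝ) := Real.sqrt_pos.2 (Nat.cast_pos.2 hk)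
  have e : √(k : ℝ) * √k = k := Real.mul_self_sqrt (Nat.cast_nonneg k)
  rw [mul_add, mul_div_cancel₀ _ hk'.ne']
  nlinarith

lemma tendsto_two_rpow_neg {ℓ : ℕ} (hℓ : 2 ≤ ℓ) (ha : Tendsto a atTop atTop) :
    Tendsto (fun n => (2 : ℝ) ^ (-(ℓ : ℝ) ^ a n)) atTop (nhds 0) := by
  have h1 : Tendsto (fun n => (ℓ : ℝ) ^ a n) atTop atTop :=
    (tendsto_rpow_atTop_of_base_gt_one _ (by exact_mod_cast hℓ)).comp ha
  exact (tendsto_rpow_atBot_of_base_gt_one 2 one_lt_two).comp (tendsto_neg_atTop_atBot.comp h1)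

end Thresholds

lemma le_sum_logb_iff {ℓ : ℕ} (hℓ : 2 ≤ ℓ) {D : Fin ℓ → ℕ} (hD : ∀ j, 1 ≤ D j) (k : ℕ)
    (d : Fin k → Fin ℓ) (x : ℝ) :
    x ≤ ∑ i, Real.logb ℓ (D (d i)) ↔ (ℓ : ℝ) ^ x ≤ (∏ i, D (d i) : ℕ) := by
  have h0 : ∀ i, (0 : ℝ) < D (d i) := fun i => Nat.cast_pos.2 (hD _)
  rw [← Real.logb_prod _ _ fun i _ => (h0 i).ne', Nat.cast_prod,
    Real.le_logb_iff_rpow_le (by exact_mod_cast hℓ) (Finset.prod_pos fun i _ => h0 i)]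

lemma wordFrac_le_one {ℓ : ℕ} [NeZero ℓ] (g : Fin ℓ → ℝ) (k : ℕ) (x : ℝ) : wordFrac g k x ≤ 1 := by
  have hℓ : (0 : ℝ) < ℓ := Nat.cast_pos.2 (NeZero.pos ℓ)
  rw [wordFrac, div_le_one (by positivity)]
  refine (Nat.cast_le.2 (Finset.card_filter_le _ _)).trans ?_
  simp

section Paths

variable {ℓ : ℕ} {D : Fin ℓ → ℕ} {z h : (n : ℕ) → Fin (ℓ ^ n) → ℝ}

lemma eventually_of_shift {p : ℕ → Prop} (m : ℕ) (hp : ∀ᶠ k in atTop, p (m + k)) :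
    ∀ᶠ n in atTop, p n := by
  obtain ⟨K, hK⟩ := eventually_atTop.1 hp
  filter_upwards [eventually_ge_atTop (m + K)] with n hn
  obtain ⟨k, rfl⟩ := Nat.exists_eq_add_of_le ((Nat.le_add_right m K).trans hn)
  exact hK k (Nat.le_of_add_le_add_left hn)

/-- Outside a set of words bounded by Markov's inequality, the factors 2^ℓ cost at most (2^ℓ)^B. The
start is small enough that the base of the power remains at most 1/2. -/
lemma PolarProcess.le_card_word [NeZero ℓ] (H : PolarProcess D z h) (hℓ : 2 ≤ ℓ)
    (hD : ∀ j, 1 ≤ D j) {ρ : ℝ} (hρ : ρ = 1 / ℓ * ∑ j, 1 / (D j : ℝ)) (hρ1 : ρ < 1) {B : ℝ}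
    (hB : 0 < B) (m k : ℕ) (i : Fin (ℓ ^ m)) (hi : z m i ≤ 1 / 2 / ((2 : ℝ) ^ ℓ) ^ B) (x : ℝ) :
    wordFrac (fun j => Real.logb ℓ (D j)) k x - 1 / (1 - ρ) / B ≤
      ((Finset.univ.filter fun d : Fin k → Fin ℓ =>
        z (m + k) (wordEquiv ℓ m k (i, d)) ≤ 2 ^ (-(ℓ : ℝ) ^ x)).card : ℝ) / (ℓ : ℝ) ^ k := by
  refine (sub_le_sub_left (card_recipSum_gt_le D hρ hρ1 k hB) _).trans ?_
  rw [wordFrac, sub_le_iff_le_add, ← add_div]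
  refine div_le_div_of_nonneg_right ?_ (by positivity)
  norm_cast
  refine (Finset.card_le_card fun d hd => ?_).trans (Finset.card_union_le _ _)
  rw [Finset.mem_union, Finset.mem_filter, Finset.mem_filter]
  rw [Finset.mem_filter, le_sum_logb_iff hℓ hD] at hd
  by_cases hd' : B < recipSum D k d
  · exact Or.inr ⟨Finset.mem_univ _, hd'⟩
  refine Or.inl ⟨Finset.mem_univ _, (H.word_le_pow hD m k i d).trans ?_⟩
  have h1 : z m i * ((2 : ℝ) ^ ℓ) ^ recipSum D k d ≤ 1 / 2 := by
    have h2 : ((2 : ℝ) ^ ℓ) ^ recipSum D k d ≤ ((2 : ℝ) ^ ℓ) ^ B :=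
      Real.rpow_le_rpow_of_exponent_le (one_le_pow₀ one_le_two) (not_lt.1 hd')
    refine (mul_le_mul hi h2 (by positivity) (by positivity)).trans (le_of_eq ?_)
    exact div_mul_cancel₀ _ (by positivity)
  refine (pow_le_pow_left₀ (mul_nonneg (H.z_nonneg _ _) (by positivity)) h1 _).trans ?_
  rw [Real.rpow_neg zero_le_two, one_div, inv_pow, ← Real.rpow_natCast]
  exact inv_anti₀ (by positivity) (Real.rpow_le_rpow_of_exponent_le one_le_two hd.2)

lemma PolarProcess.le_frac [NeZero ℓ] (H : PolarProcess D z h) (hℓ : 2 ≤ ℓ) (hD : ∀ j, 1 ≤ D j)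
    (hρ1 : 1 / ℓ * ∑ j, 1 / (D j : ℝ) < 1) {μ v : ℝ} (hμ : μ = 1 / ℓ * ∑ j, Real.logb ℓ (D j))
    (hv : v = 1 / ℓ * ∑ j, (Real.logb ℓ (D j) - μ) ^ 2) (hv0 : 0 < v) {a : ℕ → ℝ} {t : ℝ}
    (ha : Tendsto (fun k : ℕ => (a k - μ * k) / √k) atTop (nhds (t * √v))) {ε : ℝ} (hε : 0 < ε) :
    ∀ᶠ n in atTop, (1 - h 0 0) * gaussQ t - ε ≤
      frac ℓ n fun i => z n i ≤ 2 ^ (-(ℓ : ℝ) ^ a n) := by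
  have hℓ0 : (0 : ℝ) < ℓ := Nat.cast_pos.2 (NeZero.pos ℓ)
  set ρ : ℝ := 1 / ℓ * ∑ j, 1 / (D j : ℝ) with hρ
  have hρ2 : 0 < 1 - ρ := by linarith
  set e := ε / 4 with he
  have he0 : 0 < e := by positivity
  -- B makes the exceptional words a proportion at most e; δ and then the depth m depend on it, and
  -- only k tends to infinity afterwards.
  set B := 1 / (1 - ρ) / e with hBdef
  have hB : 0 < B := by positivity
  have hBe : 1 / (1 - ρ) / B = e := by rw [hBdef]; field_simp
  set δ := 1 / 2 / ((2 : ℝ) ^ ℓ) ^ B with hδ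
  obtain ⟨m, hm⟩ := (H.le_frac_small (δ := δ) (by positivity) he0).exists
  refine eventually_of_shift m ?_
  have hw := tendsto_wordFrac hμ hv hv0 (a := fun k => a (m + k) - 0)
    (tendsto_shift_threshold ha m 0)
  filter_upwards [hw.eventually (lt_mem_nhds (sub_lt_self (gaussQ t) he0))] with k hk
  simp only [sub_zero] at hk
  set y := wordFrac (fun j => Real.logb ℓ (D j)) k (a (m + k)) - e with hy
  have hx : (frac ℓ m fun i => z m i ≤ δ) * y ≤
      frac ℓ (m + k) fun i => z (m + k) i ≤ 2 ^ (-(ℓ : ℝ) ^ a (m + k)) := by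
    rw [frac_add]
    refine frac_mul_le_sum m (fun i => by positivity) fun i hi => ?_
    have := H.le_card_word hℓ hD hρ hρ1 hB m k i hi (a (m + k))
    rwa [hBe] at this
  refine le_trans ?_ hx
  have hy1 : y ≤ 1 := by
    have := wordFrac_le_one (fun j => Real.logb ℓ (D j)) k (a (m + k))
    linarith
  have hQ := gaussQ_nonneg t
  have hI0 := H.h_nonneg 0 0
  have hI1 := H.h_le_one 0 0
  have hx1 := frac_le_one m fun i => z m i ≤ δ
  rcases le_total 0 y with hy0 | hy0
  · have h1 := mul_le_mul_of_nonneg_right hm hy0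
    nlinarith
  · nlinarith

/-- z ≥ 2^(-lam), so reaching 2^(-ℓ^x) needs lam·∏D ≥ ℓ^x: the starting value shifts the threshold
by the constant log_ℓ lam. The maximum with 1 keeps lam positive. -/
lemma PolarProcess.card_word_le (H : PolarProcess D z h) (hℓ : 2 ≤ ℓ) (hD : ∀ j, 1 ≤ D j) {m : ℕ}
    {i : Fin (ℓ ^ m)} (hi : 0 < z m i) : ∃ c, ∀ k x,
    ((Finset.univ.filter fun d : Fin k → Fin ℓ =>
        z (m + k) (wordEquiv ℓ m k (i, d)) ≤ 2 ^ (-(ℓ : ℝ) ^ x)).card : ℝ) / (ℓ : ℝ) ^ k ≤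
      wordFrac (fun j => Real.logb ℓ (D j)) k (x - c) := by
  have hℓ1 : (1 : ℝ) < ℓ := by exact_mod_cast hℓ
  have hℓ0 : (0 : ℝ) < ℓ := by linarith
  set lam := max 1 (-Real.logb 2 (z m i)) with hlam
  have hlam0 : 0 < lam := lt_of_lt_of_le one_pos (le_max_left _ _)
  refine ⟨Real.logb ℓ lam, fun k x => ?_⟩
  rw [wordFrac]
  refine div_le_div_of_nonneg_right (Nat.cast_le.2 (Finset.card_le_card fun d hd => ?_))
    (by positivity)
  rw [Finset.mem_filter, le_sum_logb_iff hℓ hD]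
  rw [Finset.mem_filter] at hd
  refine ⟨Finset.mem_univ _, ?_⟩
  rw [Real.rpow_sub hℓ0, Real.rpow_logb hℓ0 hℓ1.ne' hlam0, div_le_iff₀ hlam0]
  have h1 : (2 : ℝ) ^ (-lam) ≤ z m i := by
    rw [← Real.le_logb_iff_rpow_le one_lt_two hi]
    linarith [le_max_right 1 (-Real.logb 2 (z m i))]
  have h2 := ((pow_le_pow_left₀ (by positivity) h1 _).trans (H.pow_le_word m k i d)).trans hd.2
  rw [← Real.rpow_natCast, ← Real.rpow_mul zero_le_two,
    Real.rpow_le_rpow_left_iff one_lt_two] at h2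
  linarith

/-- A descendant with z ≤ τ has 1 - h ≥ 1/2, and the average of 1 - h over descendants is conserved;
Markov's inequality bounds their proportion. -/
lemma PolarProcess.card_word_le_one_sub_h (H : PolarProcess D z h) [NeZero ℓ] {τ : ℝ}
    (hτ : 2 / Real.log 2 * τ ≤ 1 / 2) (m k : ℕ) (i : Fin (ℓ ^ m)) :
    ((Finset.univ.filter fun d : Fin k → Fin ℓ =>
        z (m + k) (wordEquiv ℓ m k (i, d)) ≤ τ).card : ℝ) / (ℓ : ℝ) ^ k ≤ 2 * (1 - h m i) := by
  have hℓ0 : (0 : ℝ) < ℓ := Nat.cast_pos.2 (NeZero.pos ℓ)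
  have hl : 0 < Real.log 2 := Real.log_pos one_lt_two
  rw [div_le_iff₀ (by positivity)]
  have h1 : ∑ d, (1 - h (m + k) (wordEquiv ℓ m k (i, d))) = (ℓ : ℝ) ^ k * (1 - h m i) := by
    rw [Finset.sum_sub_distrib, H.sum_h_word]
    simp
    ring
  have h2 := Finset.card_nsmul_le_sum (Finset.univ.filter fun d : Fin k → Fin ℓ =>
    z (m + k) (wordEquiv ℓ m k (i, d)) ≤ τ) (fun d => 1 - h (m + k) (wordEquiv ℓ m k (i, d)))
    (1 / 2) fun d hd => by
      have h3 := H.h_le (m + k) (wordEquiv ℓ m k (i, d))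
      have h4 := mul_le_mul_of_nonneg_left (Finset.mem_filter.1 hd).2
        (by positivity : 0 ≤ 2 / Real.log 2)
      linarith
  have h3 := Finset.sum_le_univ_sum_of_nonneg (s := Finset.univ.filter fun d : Fin k → Fin ℓ =>
    z (m + k) (wordEquiv ℓ m k (i, d)) ≤ τ)
    (f := fun d => 1 - h (m + k) (wordEquiv ℓ m k (i, d)))
    fun d => sub_nonneg.2 (H.h_le_one _ _)
  rw [nsmul_eq_mul] at h2
  linarith

lemma PolarProcess.z_pos (H : PolarProcess D z h) (h0 : 0 < z 0 0) (n : ℕ) (i : Fin (ℓ ^ n)) :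
    0 < z n i := by
  induction n with
  | zero => rwa [show i = 0 from Subsingleton.elim (α := Fin 1) i 0]
  | succ n ih =>
    obtain ⟨⟨m, j⟩, rfl⟩ := (innerIdx ℓ n).surjective i
    exact (pow_pos (ih m) _).trans_le (H.pow_le n m j)

lemma PolarProcess.frac_le [NeZero ℓ] (H : PolarProcess D z h) (hℓ : 2 ≤ ℓ) (hD : ∀ j, 1 ≤ D j)
    (h00 : 0 < z 0 0) {μ v : ℝ} (hμ : μ = 1 / ℓ * ∑ j, Real.logb ℓ (D j)) (hμ0 : 0 < μ)
    (hv : v = 1 / ℓ * ∑ j, (Real.logb ℓ (D j) - μ) ^ 2) (hv0 : 0 < v) {a : ℕ → ℝ} {t : ℝ}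
    (ha : Tendsto (fun k : ℕ => (a k - μ * k) / √k) atTop (nhds (t * √v))) {ε : ℝ} (hε : 0 < ε) :
    ∀ᶠ n in atTop, (frac ℓ n fun i => z n i ≤ 2 ^ (-(ℓ : ℝ) ^ a n)) ≤
      (1 - h 0 0) * gaussQ t + ε := by
  have hℓ0 : (0 : ℝ) < ℓ := Nat.cast_pos.2 (NeZero.pos ℓ)
  have hl : 0 < Real.log 2 := Real.log_pos one_lt_two
  -- Expanding (Q + e)(I + e) + 3e leaves six errors of size at most e; e ≤ 1 takes care of e².
  set e := min 1 (ε / 6) with he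
  have he0 : 0 < e := lt_min one_pos (by positivity)
  have he1 : e ≤ 1 := min_le_left _ _
  have he6 : 6 * e ≤ ε := by linarith [min_le_right 1 (ε / 6)]
  set δ := e * Real.log 2 / 2 with hδ
  have hδ0 : 0 < δ := by positivity
  have hAδ : 2 / Real.log 2 * δ = e := by rw [hδ]; field_simp
  obtain ⟨m, hm⟩ := ((H.tendsto_frac_mid hδ0).eventually (gt_mem_nhds he0)).exists
  have hsmall := H.frac_small_le hδ0.le m
  rw [hAδ] at hsmall
  refine eventually_of_shift m ?_
  -- The constants depend on the starting index, but there are finitely many at depth m, so the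
  -- limit theorem holds for all of them at once.
  choose c hc using fun i => H.card_word_le hℓ hD (H.z_pos h00 m i)
  have hw : ∀ᶠ k in atTop, ∀ i,
      wordFrac (fun j => Real.logb ℓ (D j)) k (a (m + k) - c i) ≤ gaussQ t + e :=
    eventually_all.2 fun i => (tendsto_wordFrac hμ hv hv0
      (tendsto_shift_threshold ha m (c i))).eventually
        (ge_mem_nhds (lt_add_of_pos_right _ he0))
  have hτ : ∀ᶠ k in atTop, 2 / Real.log 2 * (2 : ℝ) ^ (-(ℓ : ℝ) ^ a (m + k)) ≤ 1 / 2 := by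
    have h1 := (tendsto_two_rpow_neg hℓ (tendsto_atTop_threshold hμ0 ha)).const_mul
      (2 / Real.log 2)
    rw [mul_zero] at h1
    have h2 := h1.comp (tendsto_add_atTop_nat m)
    simp only [Function.comp_def, add_comm _ m] at h2
    exact h2.eventually (ge_mem_nhds (by norm_num))
  filter_upwards [hw, hτ] with k hk hτk
  have hQ := gaussQ_nonneg t
  have hQ1 := gaussQ_le_one t
  -- Small starting z obeys the Gaussian bound, intermediate z the trivial bound 1, and z near 1 the
  -- entropy bound 2(1 - h) ≤ 2e.
  have hbd : ∀ i, ((Finset.univ.filter fun d : Fin k → Fin ℓ => z (m + k) (wordEquiv ℓ m k (i, d)) ≤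
      2 ^ (-(ℓ : ℝ) ^ a (m + k))).card : ℝ) / (ℓ : ℝ) ^ k ≤
      (gaussQ t + e) * (if z m i ≤ δ then (1 : ℝ) else 0) +
        (if δ < z m i ∧ z m i < 1 - δ then (1 : ℝ) else 0) + 2 * e := by
    intro i
    have h1 := (hc i k (a (m + k))).trans (hk i)
    split_ifs with h2 h3 h3
    · linarith
    · linarith
    · have h4 := (hc i k (a (m + k))).trans (wordFrac_le_one _ _ _)
      linarith
    · have h4 : 1 - δ ≤ z m i := not_lt.1 fun h5 => h3 ⟨not_le.1 h2, h5⟩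
      have h5 := H.one_sub_h_le_of_le h4
      have h6 := H.card_word_le_one_sub_h hτk m k i
      linarith
  rw [frac_add]
  refine (div_le_div_of_nonneg_right (Finset.sum_le_sum fun i _ => hbd i) (by positivity)).trans ?_
  rw [Finset.sum_add_distrib, Finset.sum_add_distrib, add_div, add_div, ← Finset.mul_sum,
    mul_div_assoc, ← frac_eq_sum, ← frac_eq_sum, Finset.sum_const, Finset.card_univ,
    Fintype.card_fin, nsmul_eq_mul, Nat.cast_pow, mul_div_cancel_left₀ _ (by positivity)]
  have hI0 := H.h_nonneg 0 0
  have h7 := mul_le_mul_of_nonneg_left hsmall (by linarith : 0 ≤ gaussQ t + e)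
  nlinarith

end Paths

end

end PolarCode

/-! ### Partial distances and the passage from G to the process. -/

namespace PolarCode

noncomputable section

section Distances

variable {ℓ : ℕ} {G : Matrix (Fin ℓ) (Fin ℓ) (ZMod 2)}

lemma two_le_of_not_blockTriangular
    (hpol : ∀ σ : Equiv.Perm (Fin ℓ), ¬ (G.submatrix id σ).BlockTriangular id) : 2 ≤ ℓ := by
  by_contra h
  have : Subsingleton (Fin ℓ) := Fin.subsingleton_iff_le_one.2 (by omega)
  exact hpol 1 fun i j hij => absurd hij (by rw [Subsingleton.elim i j]; exact lt_irrefl _)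

lemma one_le_partialDist (hG : IsUnit G.det) (j : Fin ℓ) : 1 ≤ partialDist G j := by
  obtain ⟨d, -, hd, h⟩ := exists_hammingNorm_eq_partialDist G j
  rw [← h, Nat.one_le_iff_ne_zero, Ne, hammingNorm_eq_zero]
  intro h0
  have : d = 0 := (vecMul_bijective hG).1 (by simpa using h0)
  simp [this] at hd

/-- If two columns have their last entry in row j, any word beginning at j has coordinate 1 in both.
-/
lemma exists_two_le_partialDist (hG : IsUnit G.det)
    (hpol : ∀ σ : Equiv.Perm (Fin ℓ), ¬ (G.submatrix id σ).BlockTriangular id) :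
    ∃ j, 2 ≤ partialDist G j := by
  obtain ⟨j, a, b, hab, ha, hb, ha0, hb0⟩ := exists_last_entries_eq hG hpol
  refine ⟨j, ?_⟩
  obtain ⟨d, hd0, hd, h⟩ := exists_hammingNorm_eq_partialDist G j
  have hone : ∀ c, G j c = 1 → (∀ i, j < i → G i c = 0) → Matrix.vecMul d G c = 1 := by
    intro c hc hc0
    rw [Matrix.vecMul, dotProduct, Finset.sum_eq_single j]
    · rw [hd, hc, one_mul]
    · intro i _ hij
      rcases lt_or_gt_of_ne hij with hi | hi
      · rw [hd0 i hi, zero_mul]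
      · rw [hc0 i hi, mul_zero]
    · simp
  rw [← h]
  refine (Finset.card_pair hab).symm.le.trans ?_
  rw [hammingNorm]
  refine Finset.card_le_card fun c hc => ?_
  rw [Finset.mem_filter]
  rcases Finset.mem_insert.1 hc with rfl | hc
  · exact ⟨Finset.mem_univ _, by rw [hone _ ha ha0]; decide⟩
  · rw [Finset.mem_singleton.1 hc]
    exact ⟨Finset.mem_univ _, by rw [hone _ hb hb0]; decide⟩

/-- Some row c of G⁻¹ begins with 1, and times G it is a unit vector. Together with E(G) > 0 this
makes V(G) positive, as the central limit theorem requires. -/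
lemma partialDist_zero [NeZero ℓ] (hG : IsUnit G.det) : partialDist G 0 = 1 := by
  refine le_antisymm ?_ (one_le_partialDist hG 0)
  obtain ⟨c, hc⟩ : ∃ c, G⁻¹ c 0 = 1 := by
    by_contra! h
    have h1 : (G * G⁻¹) 0 0 = 0 := by
      rw [Matrix.mul_apply]
      refine Finset.sum_eq_zero fun c _ => ?_
      rw [(zmod_two_eq (G⁻¹ c 0)).resolve_right (h c), mul_zero]
    rw [Matrix.mul_nonsing_inv _ hG, Matrix.one_apply_eq] at h1
    exact one_ne_zero h1
  have h1 : Matrix.vecMul (G⁻¹ c) G = Pi.single c 1 := by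
    have h2 : (G⁻¹ * G) c = Matrix.vecMul (G⁻¹ c) G := rfl
    rw [← h2, Matrix.nonsing_inv_mul _ hG]
    ext i
    rw [Matrix.one_apply, Pi.single_apply]
    simp only [eq_comm]
  refine (partialDist_le_hammingNorm G (d := G⁻¹ c)
    (fun i hi => absurd hi (Fin.not_lt_zero i)) hc).trans ?_
  rw [h1, hammingNorm]
  refine (Finset.card_le_card (t := {c}) fun i hi => ?_).trans (Finset.card_singleton c).le
  rw [Finset.mem_singleton]
  by_contra hic
  exact (Finset.mem_filter.1 hi).2 (Pi.single_eq_of_ne hic _)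

lemma recip_partialDist_lt_one [NeZero ℓ] (hG : IsUnit G.det)
    (hpol : ∀ σ : Equiv.Perm (Fin ℓ), ¬ (G.submatrix id σ).BlockTriangular id) :
    1 / ℓ * ∑ j, 1 / (partialDist G j : ℝ) < 1 := by
  have hℓ : (0 : ℝ) < ℓ := Nat.cast_pos.2 (NeZero.pos ℓ)
  rw [one_div_mul_eq_div, div_lt_one hℓ]
  obtain ⟨j, hj⟩ := exists_two_le_partialDist hG hpol
  have h1 : ∑ j, 1 / (partialDist G j : ℝ) < ∑ _j : Fin ℓ, (1 : ℝ) := by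
    refine Finset.sum_lt_sum (fun i _ => ?_) ⟨j, Finset.mem_univ _, ?_⟩
    · have : (1 : ℝ) ≤ partialDist G i := by exact_mod_cast one_le_partialDist hG i
      rw [div_le_one (by linarith)]
      exact this
    · have : (2 : ℝ) ≤ partialDist G j := by exact_mod_cast hj
      rw [div_lt_one (by linarith)]
      linarith
  simpa using h1

lemma exponent_pos [NeZero ℓ] (hG : IsUnit G.det)
    (hpol : ∀ σ : Equiv.Perm (Fin ℓ), ¬ (G.submatrix id σ).BlockTriangular id) :
    0 < exponent G := by
  have hℓ : (1 : ℝ) < ℓ := by exact_mod_cast two_le_of_not_blockTriangular hpol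
  obtain ⟨j, hj⟩ := exists_two_le_partialDist hG hpol
  refine mul_pos (by positivity) (Finset.sum_pos' (fun i _ => ?_) ⟨j, Finset.mem_univ _, ?_⟩)
  · exact Real.logb_nonneg hℓ (by exact_mod_cast one_le_partialDist hG i)
  · exact Real.logb_pos hℓ (by exact_mod_cast hj)

lemma secondExponent_pos [NeZero ℓ] (hG : IsUnit G.det)
    (hpol : ∀ σ : Equiv.Perm (Fin ℓ), ¬ (G.submatrix id σ).BlockTriangular id) :
    0 < secondExponent G := by
  have hℓ : (0 : ℝ) < ℓ := Nat.cast_pos.2 (NeZero.pos ℓ)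
  refine mul_pos (by positivity)
    (Finset.sum_pos' (fun i _ => sq_nonneg _) ⟨0, Finset.mem_univ _, ?_⟩)
  rw [partialDist_zero hG, Nat.cast_one, Real.logb_one, zero_sub, neg_sq]
  exact pow_pos (exponent_pos hG hpol) 2

end Distances

section Instance

variable {A : Type*} {K : A → ZMod 2 → ℝ} {ℓ : ℕ} {G : Matrix (Fin ℓ) (Fin ℓ) (ZMod 2)}

lemma IsKernel.polarProcess (hK : IsKernel K) (hG : IsUnit G.det)
    (hpol : ∀ σ : Equiv.Perm (Fin ℓ), ¬ (G.submatrix id σ).BlockTriangular id) :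
    PolarProcess (partialDist G) (fun n i => bhatt (split (polarMatrix G n) i K))
      (fun n i => condEnt (split (polarMatrix G n) i K)) where
  z_nonneg _ _ := bhatt_nonneg
  z_le_one _ _ := (hK.to_split _ _).bhatt_le_one
  pow_le n i j := by
    rw [hK.bhatt_split_succ hG]
    exact (hK.to_split _ _).le_bhatt_split G j
  le_pow n i j := by
    rw [hK.bhatt_split_succ hG]
    exact (hK.to_split _ _).bhatt_split_le G j
  h_le_one _ _ := (hK.to_split _ _).condEnt_le_one
  h_nonneg _ _ := (hK.to_split _ _).condEnt_nonneg
  sum_h n i := by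
    simp only [hK.condEnt_split_succ hG]
    exact (hK.to_split _ _).sum_condEnt_split hG
  gap := by
    obtain ⟨j, a, b, hab, ha, hb, ha0, hb0⟩ := exists_last_entries_eq hG hpol
    refine ⟨j, fun n i => ?_⟩
    rw [hK.condEnt_split_succ hG]
    exact (hK.to_split _ _).condEnt_split_le j hab ha hb ha0 hb0
  h_le _ _ := (hK.to_split _ _).condEnt_le_bhatt
  one_sub_h_le _ _ := (hK.to_split _ _).one_sub_condEnt_le

/-- Conservation of entropy for a transform of length one. -/
lemma IsKernel.condEnt_split_zero (hK : IsKernel K) :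
    condEnt (split (polarMatrix G 0) 0 K) = condEnt K := by
  have h := hK.sum_condEnt_split (M := polarMatrix G 0) (by rw [polarMatrix, Matrix.det_one]; simp)
  have e : ((ℓ ^ 0 : ℕ) : ℝ) = 1 := by simp
  rw [e, one_mul] at h
  exact (Fin.sum_univ_one fun i : Fin 1 => condEnt (split (polarMatrix G 0) i K)).symm.trans h

lemma IsKernel.bhatt_split_zero_pos (hK : IsKernel K) (h : 0 < condEnt K) :
    0 < bhatt (split (polarMatrix G 0) 0 K) := by
  have hl : 0 < Real.log 2 := Real.log_pos one_lt_two
  have h1 : 0 < bhatt K := pos_of_mul_pos_right (h.trans_le hK.condEnt_le_bhatt) (by positivity)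
  exact (pow_pos h1 _).trans_le (hK.le_bhatt_split _ _)

end Instance

lemma errorProb_nonneg {Y : Type*} (W : BDMC Y) {ℓ : ℕ} (G : Matrix (Fin ℓ) (Fin ℓ) (ZMod 2))
    (n : ℕ) (F : Finset (Fin (ℓ ^ n))) : 0 ≤ errorProb W G n F := by
  refine Finset.sum_nonneg fun u _ => mul_nonneg (by positivity) (tsum_nonneg fun y =>
    mul_nonneg (Finset.prod_nonneg fun i _ => ENNReal.toReal_nonneg)
      (Finset.sum_nonneg fun v _ => scLaw_nonneg _ _ _ _ _ _ _))

lemma tendsto_threshold {E V t : ℝ} {c : ℕ → ℝ} {L : ℝ}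
    (hc : Tendsto (fun n : ℕ => c n / √n) atTop (nhds L)) :
    Tendsto (fun n : ℕ => (E * n + t * √(V * n) + c n - E * n) / √n) atTop
      (nhds (t * √V + L)) := by
  refine (hc.const_add (t * √V)).congr' ?_
  filter_upwards [eventually_gt_atTop 0] with n hn
  have hn' : (0 : ℝ) < √(n : ℝ) := Real.sqrt_pos.2 (Nat.cast_pos.2 hn)
  rw [Real.sqrt_mul' _ (Nat.cast_nonneg n)]
  field_simp
  ring

/-- Eventually b n ≥ μn/2. With x = ℓ^(μn/2) one has ℓ^n = x^(2/μ), a power beaten by 2^(-x). -/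
lemma tendsto_pow_mul_two_rpow_neg {ℓ : ℕ} (hℓ : 2 ≤ ℓ) {b : ℕ → ℝ} {μ L : ℝ} (hμ : 0 < μ)
    (hb : Tendsto (fun n : ℕ => (b n - μ * n) / √n) atTop (nhds L)) :
    Tendsto (fun n => (ℓ : ℝ) ^ n * (2 : ℝ) ^ (-(ℓ : ℝ) ^ b n)) atTop (nhds 0) := by
  have hℓ1 : (1 : ℝ) < ℓ := by exact_mod_cast hℓ
  have hl : 0 < Real.log 2 := Real.log_pos one_lt_two
  have h1 : Tendsto (fun n : ℕ => b n - μ / 2 * n) atTop atTop := by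
    refine tendsto_atTop_threshold (μ := μ / 2) (L := L) (by positivity) (hb.congr fun n => ?_)
    congr 1
    ring
  have hx : Tendsto (fun n : ℕ => (ℓ : ℝ) ^ (μ / 2 * n : ℝ)) atTop atTop :=
    (tendsto_rpow_atTop_of_base_gt_one _ hℓ1).comp
      (tendsto_natCast_atTop_atTop.const_mul_atTop (by positivity))
  have h2 := (tendsto_rpow_mul_exp_neg_mul_atTop_nhds_zero (2 / μ) (Real.log 2) hl).comp hx
  refine squeeze_zero' (Eventually.of_forall fun n => by positivity) ?_ h2
  filter_upwards [h1.eventually_ge_atTop 0] with n hn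
  have e1 : ((ℓ : ℝ) ^ (μ / 2 * n : ℝ)) ^ (2 / μ) = (ℓ : ℝ) ^ n := by
    rw [← Real.rpow_mul (by positivity), ← Real.rpow_natCast]
    congr 1
    field_simp
  have e2 : ∀ x : ℝ, Real.exp (-Real.log 2 * x) = 2 ^ (-x) := fun x => by
    rw [Real.rpow_def_of_pos two_pos]
    congr 1
    ring
  simp only [Function.comp, e1, e2]
  refine mul_le_mul_of_nonneg_left (Real.rpow_le_rpow_of_exponent_le one_le_two ?_) (by positivity)
  exact neg_le_neg (Real.rpow_le_rpow_of_exponent_le hℓ1.le (by linarith))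

/-! ### Achievability and converse. -/

section Main

variable {Y : Type*} (W : BDMC Y) {ℓ : ℕ} (G : Matrix (Fin ℓ) (Fin ℓ) (ZMod 2))

/-- If a proportion at least `R` of the indices have Bhattacharyya parameter at most `τ n`, then
these indices yield polar codes of rate tending to `R`. -/
lemma exists_frozen_of_le_frac [NeZero ℓ] (hℓ : 2 ≤ ℓ) {R : ℝ} (hR : 0 < R) {τ : ℕ → ℝ}
    (h : ∀ ε > 0, ∀ᶠ n in atTop, R - ε ≤
      frac ℓ n fun i => bhatt (split (polarMatrix G n) i W.prob) ≤ τ n) (hτ : ∀ n, 0 ≤ τ n) :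
    ∃ F : (n : ℕ) → Finset (Fin (ℓ ^ n)), Tendsto (fun n => rate (F n)) atTop (nhds R) ∧
      ∀ n, errorProb W G n (F n) ≤ (ℓ : ℝ) ^ n * τ n := by
  have hℓ1 : (1 : ℝ) < ℓ := by exact_mod_cast hℓ
  -- Good indices are kept only up to ⌊Rℓ^n⌋, since they may exceed the proportion R.
  have hS : ∀ n, ∃ S ⊆ Finset.univ.filter
      fun i => bhatt (split (polarMatrix G n) i W.prob) ≤ τ n,
      S.card = min (Finset.univ.filter
        fun i => bhatt (split (polarMatrix G n) i W.prob) ≤ τ n).card ⌊R * (ℓ : ℝ) ^ n⌋₊ :=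
    fun n => Finset.exists_subset_card_eq (min_le_left _ _)
  choose S hSg hSc using hS
  refine ⟨fun n => (S n)ᶜ, ?_, fun n => ?_⟩
  · have hup : ∀ n, rate (S n)ᶜ ≤ R := by
      intro n
      rw [rate, compl_compl, hSc, div_le_iff₀ (by positivity)]
      exact (Nat.cast_le.2 (min_le_right _ _)).trans (Nat.floor_le (by positivity))
    rw [tendsto_order]
    refine ⟨fun b hb => ?_, fun b hb => Eventually.of_forall fun n => (hup n).trans_lt hb⟩
    have hinv : Tendsto (fun n : ℕ => R - 1 / (ℓ : ℝ) ^ n) atTop (nhds (R - 0)) :=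
      (tendsto_const_nhds.div_atTop (tendsto_pow_atTop_atTop_of_one_lt hℓ1)).const_sub R
    rw [sub_zero] at hinv
    filter_upwards [h ((R - b) / 2) (by linarith), hinv.eventually (lt_mem_nhds hb)] with n h1 h2
    have hp : (0 : ℝ) < (ℓ : ℝ) ^ n := by positivity
    rw [rate, compl_compl, hSc, lt_div_iff₀ hp, Nat.cast_min, lt_min_iff]
    constructor
    · rw [← lt_div_iff₀ hp]
      exact lt_of_lt_of_le (by linarith) h1
    · have h3 : b * (ℓ : ℝ) ^ n < R * (ℓ : ℝ) ^ n - 1 := by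
        have := mul_lt_mul_of_pos_right h2 hp
        rwa [sub_mul, div_mul_cancel₀ _ hp.ne'] at this
      exact h3.trans (Nat.sub_one_lt_floor _)
  · refine (errorProb_le W G n).trans ?_
    rw [compl_compl]
    refine (Finset.sum_le_card_nsmul _ _ (τ n) fun i hi =>
      (Finset.mem_filter.1 (hSg n hi)).2).trans ?_
    rw [nsmul_eq_mul]
    refine mul_le_mul_of_nonneg_right ?_ (hτ n)
    have := Finset.card_le_univ (S n)
    rw [Fintype.card_fin] at this
    exact_mod_cast this

/-- By pigeonhole some unfrozen index has z > τ. -/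
lemma le_errorProb_of_frac_lt {n : ℕ} {F : Finset (Fin (ℓ ^ n))} {τ : ℝ} (hτ : 0 ≤ τ)
    (h : (frac ℓ n fun i => bhatt (split (polarMatrix G n) i W.prob) ≤ τ) < rate F) :
    τ ^ 2 / 4 ≤ errorProb W G n F := by
  rw [frac, rate] at h
  have h1 : (Finset.univ.filter
      fun i => bhatt (split (polarMatrix G n) i W.prob) ≤ τ).card < Fᶜ.card := by
    by_contra hc
    exact not_lt.2 (div_le_div_of_nonneg_right (Nat.cast_le.2 (not_lt.1 hc)) (by positivity)) h
  obtain ⟨i, hi, hi'⟩ := Finset.exists_mem_notMem_of_card_lt_card h1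
  rw [Finset.mem_filter, not_and] at hi'
  refine le_trans ?_ (le_errorProb W G n (Finset.mem_compl.1 hi))
  exact div_le_div_of_nonneg_right
    (pow_le_pow_left₀ hτ (not_le.1 (hi' (Finset.mem_univ _))).le 2) (by norm_num)

variable {G}

lemma exists_polar_codes (hG : IsUnit G.det)
    (hpol : ∀ σ : Equiv.Perm (Fin ℓ), ¬ (G.submatrix id σ).BlockTriangular id)
    {R : ℝ} (hR0 : 0 < R) (hR : R < W.symCapacity) {f : ℕ → ℝ}
    (hf : f =o[atTop] (fun n : ℕ => √(n : ℝ))) :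
    ∃ F : (n : ℕ) → Finset (Fin (ℓ ^ n)),
      Tendsto (fun n => rate (F n)) atTop (nhds R) ∧
      (fun n => errorProb W G n (F n)) =o[atTop]
        (fun n : ℕ => (2 : ℝ) ^ (-(ℓ : ℝ) ^ (exponent G * n +
          gaussQInv (R / W.symCapacity) * √(secondExponent G * n) + f n))) := by
  have hℓ := two_le_of_not_blockTriangular hpol
  have hℓ2 : (2 : ℝ) ≤ ℓ := by exact_mod_cast hℓ
  have : NeZero ℓ := ⟨by omega⟩
  have hK := isKernel_prob W
  have hI := symCapacity_eq W
  have hI0 : 0 < W.symCapacity := hR0.trans hR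
  set t := gaussQInv (R / W.symCapacity) with ht
  have hQ : W.symCapacity * gaussQ t = R := by
    rw [ht, gaussQ_gaussQInv (by positivity) ((div_lt_one hI0).2 hR)]
    field_simp
  set b : ℕ → ℝ := fun n => exponent G * n + t * √(secondExponent G * n) + f n with hb
  have hsq : Tendsto (fun k : ℕ => √(k : ℝ)) atTop atTop :=
    Real.tendsto_sqrt_atTop.comp tendsto_natCast_atTop_atTop
  have hb1 : Tendsto (fun n : ℕ => (b n - exponent G * n) / √n) atTop
      (nhds (t * √(secondExponent G))) := by
    have h1 := tendsto_threshold (E := exponent G) (V := secondExponent G) (t := t)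
      hf.tendsto_div_nhds_zero
    rwa [add_zero] at h1
  have ha1 : Tendsto (fun n : ℕ => (b n + 1 - exponent G * n) / √n) atTop
      (nhds (t * √(secondExponent G))) := by
    have h1 := hb1.add ((tendsto_const_nhds (x := (1 : ℝ))).div_atTop hsq)
    rw [add_zero] at h1
    refine h1.congr fun n => ?_
    rw [← add_div]
    congr 1
    ring
  -- The extra 1 in the exponent at least squares the target bound, since ℓ ≥ 2; one of the two
  -- factors then absorbs the ℓ^n of the union bound.
  obtain ⟨F, hF, hFe⟩ := exists_frozen_of_le_frac W G hℓ hR0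
    (τ := fun n => 2 ^ (-(ℓ : ℝ) ^ (b n + 1))) (fun ε hε => by
      have h1 := (hK.polarProcess hG hpol).le_frac hℓ (one_le_partialDist hG)
        (recip_partialDist_lt_one hG hpol) rfl rfl (secondExponent_pos hG hpol) ha1 hε
      rwa [hK.condEnt_split_zero, ← hI, hQ] at h1) (fun n => by positivity)
  refine ⟨F, hF, ?_⟩
  have hlim := tendsto_pow_mul_two_rpow_neg hℓ (exponent_pos hG hpol) hb1
  refine isLittleO_iff.2 fun c hc => ?_
  filter_upwards [hlim.eventually (ge_mem_nhds hc)] with n hn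
  have hpos : (0 : ℝ) < 2 ^ (-(ℓ : ℝ) ^ b n) := by positivity
  rw [Real.norm_of_nonneg (errorProb_nonneg _ _ _ _), Real.norm_of_nonneg hpos.le]
  refine (hFe n).trans ?_
  have h1 : (2 : ℝ) ^ (-(ℓ : ℝ) ^ (b n + 1)) ≤ 2 ^ (-(ℓ : ℝ) ^ b n) * 2 ^ (-(ℓ : ℝ) ^ b n) := by
    rw [← Real.rpow_add two_pos]
    refine Real.rpow_le_rpow_of_exponent_le one_le_two ?_
    rw [Real.rpow_add_one (by positivity)]
    nlinarith [Real.rpow_nonneg (by positivity : (0 : ℝ) ≤ ℓ) (b n)]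
  calc (ℓ : ℝ) ^ n * 2 ^ (-(ℓ : ℝ) ^ (b n + 1))
      ≤ (ℓ : ℝ) ^ n * (2 ^ (-(ℓ : ℝ) ^ b n) * 2 ^ (-(ℓ : ℝ) ^ b n)) :=
        mul_le_mul_of_nonneg_left h1 (by positivity)
    _ = (ℓ : ℝ) ^ n * 2 ^ (-(ℓ : ℝ) ^ b n) * 2 ^ (-(ℓ : ℝ) ^ b n) := by ring
    _ ≤ c * 2 ^ (-(ℓ : ℝ) ^ b n) := mul_le_mul_of_nonneg_right hn hpos.le

lemma isLittleO_errorProb (hG : IsUnit G.det)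
    (hpol : ∀ σ : Equiv.Perm (Fin ℓ), ¬ (G.submatrix id σ).BlockTriangular id)
    {R : ℝ} (hR0 : 0 < R) (hR : R < W.symCapacity) (hW : W.symCapacity < 1)
    {F : (n : ℕ) → Finset (Fin (ℓ ^ n))} (hF : Tendsto (fun n => rate (F n)) atTop (nhds R))
    {ε : ℝ} (hε : 0 < ε) :
    (fun n : ℕ => (2 : ℝ) ^ (-(ℓ : ℝ) ^ (exponent G * n +
      gaussQInv (R / W.symCapacity) * √(secondExponent G * n) + ε * √(n : ℝ)))) =o[atTop]
    (fun n => errorProb W G n (F n)) := by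
  have hℓ := two_le_of_not_blockTriangular hpol
  have hℓ2 : (2 : ℝ) ≤ ℓ := by exact_mod_cast hℓ
  have : NeZero ℓ := ⟨by omega⟩
  have hK := isKernel_prob W
  have hI := symCapacity_eq W
  have hI0 : 0 < W.symCapacity := hR0.trans hR
  have hE := exponent_pos hG hpol
  have hV := secondExponent_pos hG hpol
  have hV' : 0 < √(secondExponent G) := Real.sqrt_pos.2 hV
  set t := gaussQInv (R / W.symCapacity) with ht
  have hQ : W.symCapacity * gaussQ t = R := by
    rw [ht, gaussQ_gaussQInv (by positivity) ((div_lt_one hI0).2 hR)]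
    field_simp
  -- Half of the slack ε√n moves t to t' > t, which pushes the proportion of good indices strictly
  -- below R. The other half covers the passage from τ² to τ⁴.
  set a : ℕ → ℝ := fun n => exponent G * n + t * √(secondExponent G * n) + ε / 2 * √n with ha
  have hsq : Tendsto (fun k : ℕ => √(k : ℝ)) atTop atTop :=
    Real.tendsto_sqrt_atTop.comp tendsto_natCast_atTop_atTop
  set t' := t + ε / 2 / √(secondExponent G) with ht'
  have ha1 : Tendsto (fun n : ℕ => (a n - exponent G * n) / √n) atTop
      (nhds (t' * √(secondExponent G))) := by
    rw [ht', add_mul, div_mul_cancel₀ _ hV'.ne']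
    refine tendsto_threshold (tendsto_const_nhds.congr' ?_)
    filter_upwards [eventually_gt_atTop 0] with n hn
    rw [mul_div_cancel_right₀ _ (Real.sqrt_pos.2 (Nat.cast_pos.2 hn)).ne']
  have hQ' : W.symCapacity * gaussQ t' < R := by
    rw [← hQ]
    exact mul_lt_mul_of_pos_left (gaussQ_strictAnti (lt_add_of_pos_right _ (by positivity))) hI0
  set e := (R - W.symCapacity * gaussQ t') / 2 with he
  have he0 : 0 < e := by linarith
  have hfrac := (hK.polarProcess hG hpol).frac_le hℓ (one_le_partialDist hG)
    (hK.bhatt_split_zero_pos (by linarith)) rfl hE rfl hV ha1 he0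
  rw [hK.condEnt_split_zero, ← hI] at hfrac
  have hτ := (tendsto_two_rpow_neg hℓ (tendsto_atTop_threshold hE ha1)).pow 2
  rw [zero_pow two_ne_zero] at hτ
  refine isLittleO_iff.2 fun c hc => ?_
  -- √n ≥ 4/ε gives ℓ^(ε√n/2) ≥ ℓ² ≥ 4, hence the bound τ⁴; the spare factor τ² tends to 0 and falls
  -- below c/4.
  filter_upwards [hfrac, hF.eventually (lt_mem_nhds (sub_lt_self R he0)),
    hτ.eventually (ge_mem_nhds (by positivity : (0 : ℝ) < c / 4)),
    hsq.eventually_ge_atTop (4 / ε)] with n h1 h2 h3 h4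
  have hle := le_errorProb_of_frac_lt W G (F := F n) (by positivity)
    (h1.trans_lt (lt_of_le_of_lt (by linarith) h2))
  rw [Real.norm_of_nonneg (errorProb_nonneg _ _ _ _), Real.norm_of_nonneg (by positivity)]
  refine le_trans ?_ (mul_le_mul_of_nonneg_left hle hc.le)
  set τ : ℝ := 2 ^ (-(ℓ : ℝ) ^ a n) with hτdef
  have h5 : (2 : ℝ) ^ (-(ℓ : ℝ) ^ (exponent G * n + t * √(secondExponent G * n) + ε * √n)) ≤
      τ ^ 4 := by
    rw [hτdef, ← Real.rpow_natCast (2 ^ _), ← Real.rpow_mul zero_le_two]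
    refine Real.rpow_le_rpow_of_exponent_le one_le_two ?_
    have e1 : exponent G * n + t * √(secondExponent G * n) + ε * √n = a n + ε / 2 * √n := by
      rw [ha]; ring
    have h6 : (2 : ℝ) ≤ ε / 2 * √n := by
      rw [div_le_iff₀ hε] at h4
      linarith
    have h7 : (4 : ℝ) ≤ (ℓ : ℝ) ^ (ε / 2 * √n) := by
      have h8 : (ℓ : ℝ) ^ (2 : ℝ) ≤ (ℓ : ℝ) ^ (ε / 2 * √n) :=
        Real.rpow_le_rpow_of_exponent_le (by linarith) h6
      rw [Real.rpow_two] at h8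
      nlinarith
    rw [e1, Real.rpow_add (by positivity)]
    push_cast
    nlinarith [Real.rpow_nonneg (by positivity : (0 : ℝ) ≤ ℓ) (a n)]
  refine h5.trans ?_
  have h8 : τ ^ 2 * τ ^ 2 ≤ c / 4 * τ ^ 2 := mul_le_mul_of_nonneg_right h3 (sq_nonneg _)
  calc τ ^ 4 = τ ^ 2 * τ ^ 2 := by ring
    _ ≤ c / 4 * τ ^ 2 := h8
    _ = c * (τ ^ 2 / 4) := by ring

end Main

end

end PolarCode

open PolarCode in
theorem mainTheorem8 {Y : Type*} [Countable Y] (W : BDMC Y)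
    {ℓ : ℕ} (G : Matrix (Fin ℓ) (Fin ℓ) (ZMod 2)) (hG : IsUnit G.det)
    (hpol : ∀ σ : Equiv.Perm (Fin ℓ), ¬ (G.submatrix id σ).BlockTriangular id)
    (R : ℝ) (hR0 : 0 < R) (hR : R < W.symCapacity) :
    (∀ f : ℕ → ℝ, f =o[atTop] (fun n : ℕ => √(n : ℝ)) →
      ∃ F : (n : ℕ) → Finset (Fin (ℓ ^ n)),
        Tendsto (fun n => rate (F n)) atTop (nhds R) ∧
        (fun n => errorProb W G n (F n)) =o[atTop]
          (fun n : ℕ => (2 : ℝ) ^ (-(ℓ : ℝ) ^ (exponent G * n +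
            gaussQInv (R / W.symCapacity) * √(secondExponent G * n) + f n)))) ∧
    (W.symCapacity < 1 →
      ∀ F : (n : ℕ) → Finset (Fin (ℓ ^ n)),
        Tendsto (fun n => rate (F n)) atTop (nhds R) →
        ∀ ε : ℝ, 0 < ε →
          (fun n : ℕ => (2 : ℝ) ^ (-(ℓ : ℝ) ^ (exponent G * n +
            gaussQInv (R / W.symCapacity) * √(secondExponent G * n) + ε * √(n : ℝ)))) =o[atTop]
          (fun n => errorProb W G n (F n))) :=
  ⟨fun _ hf => exists_polar_codes W hG hpol hR0 hR hf,
    fun hW _ hF _ hε => isLittleO_errorProb W hG hpol hR0 hR hW hF hε⟩
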